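/- All spaces are over $\mathbb C$. Let $\Gamma=\mathbb Z^2$, $\det(\mathbf m,\mathbf n)=m_1n_2-m_2n_1$, and let $L$ be the Virasoro-like algebra: the Lie algebra with basis $D(\mathbf m)$ ($\mathbf m\in\Gamma\setminus\{0\}$), $c_1,c_2$, where $c_1,c_2$ are central, $D(\mathbf 0)=0$, $h(\mathbf m)=m_1c_1+m_2c_2$ and $$[D(\mathbf m),D(\mathbf n)]=-\det(\mathbf m,\mathbf n)D(\mathbf m+\mathbf n)+\delta_{\mathbf m+\mathbf n,\mathbf 0}\,h(\mathbf m).$$ A $\mathbb Z^2$-graded $L$-module is an $L$-module $V=\bigoplus_{\mathbf n\in\Gamma}V_{\mathbf n}$ with $D(\mathbf m)V_{\mathbf n}\subseteq V_{\mathbf m+\mathbf n}$. It is nontrivial if $L$ does not act as zero; irreducible if it is nonzero and has no graded submodules other than $0$ and $V$; a generalized highest weight module if there are a $\mathbb Z$-basis $\{\mathbf b_1',\mathbf b_2'\}$ of $\Gamma$ and a nonzero homogeneous $v\in V$ with $D(\mathbf m)v=0$ for all $\mathbf m\in\mathbb Z_{\ge0}\mathbf b_1'+\mathbb Z_{\ge0}\mathbf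 b_2'$. Let $\mathcal O_{\mathbb Z^2}$ be the class of irreducible $\mathbb Z^2$-graded $L$-modules all of whose homogeneous subspaces are finite dimensional. Let $\{\mathbf b_1,\mathbf b_2\}$ be a $\mathbb Z$-basis of $\Gamma$. Put $L_j=\langle D(j\mathbf b_1+m\mathbf b_2)\mid m\in\mathbb Z\rangle\oplus\delta_{j,0}\langle c_1,c_2\rangle$, $L_+=\bigoplus_{j>0}L_j$ and $\mathscr H=\langle D(k\mathbf b_2),h(\mathbf b_2)\mid k\in\mathbb Z\rangle$. An exp-polynomial function over $L_0$ is a nonzero linear $\psi:L_0\to\mathbb C$ with $\psi(h(\mathbf b_2))=0$ for which there are polynomials $p_1,\dots,p_r\in\mathbb C[X]$ and nonzero $\alpha_1,\dots,\alpha_r\in\mathbb C$ with $$\psi(D(k\mathbf b_2))=\frac1k\sum_{j=1}^r p_j(k)\alpha_j^k\quad(k\in\mathbb Z\setminus\{0\}),\qquad \psi(h(\mathbf b_1))=-\det(\mathbf b_1,\mathbf b_2)\sum_{j=1}^r p_j(0).$$ For such $\psi$ let $\mathbb Cv_0$ be the one-dimensional $(L_0+L_+)$-module with $L_+v_0=0$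 and $xv_0=\psi(x)v_0$ for $x\in L_0$, let $\widehat V^+(\psi)$ be the quotient of $U(L)\otimes_{U(L_0+L_+)}\mathbb Cv_0$, $\mathbb Z$-graded with $v_0$ in degree $0$, by its largest proper graded submodule, and let $V(\psi)=\widehat V^+(\psi)\otimes\mathbb C[t^{\pm1}]$ with $$D(i\mathbf b_1+j\mathbf b_2)(v\otimes t^k)=(D(i\mathbf b_1+j\mathbf b_2)v)\otimes t^{k+j},\qquad c_l(v\otimes t^k)=(c_lv)\otimes t^k,$$ where $v\otimes t^k$ has degree $m\mathbf b_1+k\mathbf b_2$ if $v$ has degree $m$. For $i\in\mathbb Z$ let $W_i=U(\mathscr H)(v_0\otimes t^i)$, and for $s\in\mathbb N=\{1,2,\dots\}$ with $W_i=v_0\otimes\mathbb C[t^{\pm s}]t^i$ let $\overline V(\psi,i,s)$ be the quotient of $V(\psi)$ by its largest graded submodule that intersects $W_i$ trivially. **Theorem.** Let $V$ be a nontrivial generalized highest weight $\mathbb Z^2$-graded $L$-module. Then $V\in\mathcal O_{\mathbb Z^2}$ if and only if there are a $\mathbb Z$-basis $\{\mathbf b_1,\mathbf b_2\}$ of $\Gamma$,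 an exp-polynomial function $\psi$ over $L_0$, an $i\in\mathbb Z$ and an $s\in\mathbb N$ with $W_i=v_0\otimes\mathbb C[t^{\pm s}]t^i$ such that $V\cong\overline V(\psi,i,s)$ as $L$-modules. Moreover, if $V\in\mathcal O_{\mathbb Z^2}$, these data and the isomorphism can be chosen so that, for some $\mathbf d\in\Gamma$, the isomorphism maps $V_{\mathbf n}$ onto $\overline V(\psi,i,s)_{\mathbf n+\mathbf d}$ for every $\mathbf n\in\Gamma$. -/

import Mathlib

open scoped TensorProduct LaurentPolynomial

noncomputable section

/-! ### The Virasoro-like algebra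

`Γ = ℤ × ℤ`. The algebra has the basis `D(m)` (`m ∈ Γ`, `m ≠ 0`), `c₁`, `c₂`; by convention
`D(0) = 0`. -/

/-- The underlying space `⟨D(m) | m ≠ 0⟩ ⊕ ⟨c₁, c₂⟩` of the Virasoro-like algebra. -/
def VirasoroLike : Type := ({m : ℤ × ℤ // m ≠ 0} →₀ ℂ) × (ℂ × ℂ)

namespace VirasoroLike

instance : AddCommGroup VirasoroLike :=
  inferInstanceAs (AddCommGroup (({m : ℤ × ℤ // m ≠ 0} →₀ ℂ) × (ℂ × ℂ)))

instance : Module ℂ VirasoroLike :=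
  inferInstanceAs (Module ℂ (({m : ℤ × ℤ // m ≠ 0} →₀ ℂ) × (ℂ × ℂ)))

/-- `det(m, n) = m₁ n₂ - m₂ n₁`. -/
def det (m n : ℤ × ℤ) : ℤ := m.1 * n.2 - m.2 * n.1

/-- The element `D(m)`, with `D(0) = 0`. -/
def D (m : ℤ × ℤ) : VirasoroLike :=
  if hm : m ≠ 0 then (Finsupp.single ⟨m, hm⟩ 1, 0) else 0

/-- The central element `c₁`. -/
def c₁ : VirasoroLike := (0, (1, 0))

/-- The central element `c₂`. -/
def c₂ : VirasoroLike := (0, (0, 1))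

/-- `h(m) = m₁ c₁ + m₂ c₂`. -/
def h (m : ℤ × ℤ) : VirasoroLike := (m.1 : ℂ) • c₁ + (m.2 : ℂ) • c₂

/-- The linear map out of the Virasoro-like algebra with prescribed values `F m` at `D(m)`
(`m ≠ 0`), `y₁` at `c₁` and `y₂` at `c₂`. -/
def lift {M : Type*} [AddCommGroup M] [Module ℂ M] (F : ℤ × ℤ → M) (y₁ y₂ : M) :
    VirasoroLike →ₗ[ℂ] M :=
  LinearMap.coprod (Finsupp.linearCombination ℂ (fun m : {m : ℤ × ℤ // m ≠ 0} => F m.1))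
    (LinearMap.coprod (LinearMap.toSpanSingleton ℂ M y₁) (LinearMap.toSpanSingleton ℂ M y₂))

section lift

variable {M : Type*} [AddCommGroup M] [Module ℂ M] (F : ℤ × ℤ → M) (y₁ y₂ : M)

@[simp] theorem D_zero : D 0 = 0 := by simp [D]

theorem lift_D_of_ne {m : ℤ × ℤ} (hm : m ≠ 0) : lift F y₁ y₂ (D m) = F m := by
  have : D m = ((Finsupp.single ⟨m, hm⟩ 1, 0) : VirasoroLike) := dif_pos hm
  rw [this]
  refine (LinearMap.coprod_apply _ _ _).trans ?_
  simp

theorem lift_D (hF : F 0 = 0) (m : ℤ × ℤ) : lift F y₁ y₂ (D m) = F m := by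
  by_cases hm : m = 0
  · subst hm; simp [hF]
  · exact lift_D_of_ne F y₁ y₂ hm

@[simp] theorem lift_c₁ : lift F y₁ y₂ c₁ = y₁ := by
  refine (LinearMap.coprod_apply _ _ _).trans ?_
  simp [c₁]

@[simp] theorem lift_c₂ : lift F y₁ y₂ c₂ = y₂ := by
  refine (LinearMap.coprod_apply _ _ _).trans ?_
  simp [c₂]

/-- Linear maps that agree at all `D(m)` and at `c₁`, `c₂` are equal. -/
theorem linearMap_ext {f g : VirasoroLike →ₗ[ℂ] M} (hD : ∀ m, f (D m) = g (D m))
    (h₁ : f c₁ = g c₁) (h₂ : f c₂ = g c₂) : f = g := by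
  refine LinearMap.prod_ext (Finsupp.lhom_ext' fun m => LinearMap.ext_ring ?_)
    (LinearMap.prod_ext (LinearMap.ext_ring h₁) (LinearMap.ext_ring h₂))
  have := hD m.1
  have hm : D m.1 = ((Finsupp.single m 1, 0) : VirasoroLike) := dif_pos m.2
  rw [hm] at this
  exact this

end lift

/-- The value of the bracket `[D(m), D(n)] = - det(m, n) D(m + n) + δ_{m+n,0} h(m)`. -/
def bracketD (m n : ℤ × ℤ) : VirasoroLike :=
  (-(det m n : ℂ)) • D (m + n) + if m + n = 0 then h m else 0

/-- The bracket as a bilinear map; `c₁` and `c₂` are central. -/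
def bracket : VirasoroLike →ₗ[ℂ] VirasoroLike →ₗ[ℂ] VirasoroLike :=
  lift (fun m => lift (fun n => bracketD m n) 0 0) 0 0

@[simp] theorem h_zero : h 0 = 0 := by simp [h]

theorem h_neg (m : ℤ × ℤ) : h (-m) = - h m := by simp [h]; abel

theorem bracketD_zero_left (n : ℤ × ℤ) : bracketD 0 n = 0 := by
  simp [bracketD, det]

theorem bracketD_zero_right (m : ℤ × ℤ) : bracketD m 0 = 0 := by
  by_cases hm : m = 0 <;> simp [bracketD, det, hm]

theorem lift_zero_zero {M : Type*} [AddCommGroup M] [Module ℂ M] :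
    lift (fun _ => (0 : M)) 0 0 = 0 :=
  linearMap_ext (fun m => by rw [lift_D _ _ _ rfl]; rfl) (by simp) (by simp)

theorem bracket_D (m : ℤ × ℤ) : bracket (D m) = lift (fun n => bracketD m n) 0 0 := by
  rw [bracket, lift_D]
  simp only [bracketD_zero_left]
  exact lift_zero_zero

@[simp] theorem bracket_D_D (m n : ℤ × ℤ) : bracket (D m) (D n) = bracketD m n := by
  rw [bracket_D, lift_D _ _ _ (bracketD_zero_right m)]

@[simp] theorem bracket_c₁ : bracket c₁ = 0 := by simp [bracket]
@[simp] theorem bracket_c₂ : bracket c₂ = 0 := by simp [bracket]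
@[simp] theorem bracket_D_c₁ (m : ℤ × ℤ) : bracket (D m) c₁ = 0 := by simp [bracket_D]
@[simp] theorem bracket_D_c₂ (m : ℤ × ℤ) : bracket (D m) c₂ = 0 := by simp [bracket_D]
@[simp] theorem bracket_h (m : ℤ × ℤ) : bracket (h m) = 0 := by simp [h]
@[simp] theorem bracket_D_h (m n : ℤ × ℤ) : bracket (D m) (h n) = 0 := by simp [h]

theorem bracketD_antisymm (m n : ℤ × ℤ) : bracketD n m = - bracketD m n := by
  unfold bracketD
  rw [add_comm n m]
  have h1 : ((det n m : ℤ) : ℂ) = - (det m n : ℂ) := by simp [det]; ring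
  by_cases hmn : m + n = 0
  · have : n = -m := by rw [eq_neg_iff_add_eq_zero, add_comm]; exact hmn
    subst this
    simp [h_neg]
  · simp [hmn, h1]

theorem bracket_flip : bracket.flip = - bracket := by
  refine linearMap_ext (fun m => ?_) ?_ ?_
  · refine linearMap_ext (fun n => ?_) (by simp) (by simp)
    simp [bracketD_antisymm n m]
  · refine linearMap_ext (fun n => ?_) (by simp) (by simp)
    simp
  · refine linearMap_ext (fun n => ?_) (by simp) (by simp)
    simp

theorem bracket_antisymm (x y : VirasoroLike) : bracket x y = - bracket y x := by
  have := LinearMap.congr_fun (LinearMap.congr_fun bracket_flip y) x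
  simpa using this

/-- The Jacobi identity (Leibniz form) on the elements `D(m)`. -/
theorem jacobi_D (m n p : ℤ × ℤ) :
    bracket (D m) (bracketD n p) = bracket (bracketD m n) (D p) + bracket (D n) (bracketD m p) := by
  have e (m n p : ℤ × ℤ) :
      bracket (D m) (bracketD n p) = (-(det n p : ℂ)) • bracketD m (n + p) := by
    rw [bracketD, map_add, map_smul, bracket_D_D]
    split_ifs <;> simp
  have e2 : bracket (bracketD m n) (D p) = (-(det m n : ℂ)) • bracketD (m + n) p := by
    rw [bracket_antisymm, e, ← smul_neg, ← bracketD_antisymm]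
  rw [e m n p, e2, e n m p]
  unfold bracketD
  have a2 : m + n + p = m + (n + p) := by abel
  have a3 : n + (m + p) = m + (n + p) := by abel
  rw [a2, a3]
  by_cases h0 : m + (n + p) = 0
  · have hp : p = -(m + n) := by
      rw [eq_neg_iff_add_eq_zero, ← h0]; abel
    subst hp
    obtain ⟨m1, m2⟩ := m
    obtain ⟨n1, n2⟩ := n
    simp only [h0, D_zero, if_true, smul_zero, zero_add, h, det, smul_add, smul_smul]
    simp only [Prod.neg_mk, Prod.mk_add_mk]
    push_cast
    module
  · simp only [h0, if_false, add_zero, smul_smul, ← add_smul]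
    congr 1
    simp only [det, Prod.fst_add, Prod.snd_add]
    push_cast
    ring

theorem jacobi (x y z : VirasoroLike) :
    bracket x (bracket y z) = bracket (bracket x y) z + bracket y (bracket x z) := by
  let B := bracket
  let r1 : VirasoroLike →ₗ[ℂ] VirasoroLike →ₗ[ℂ] VirasoroLike →ₗ[ℂ] VirasoroLike :=
    (LinearMap.llcomp ℂ VirasoroLike VirasoroLike _ B) ∘ₗ B
  let l1 : VirasoroLike →ₗ[ℂ] VirasoroLike →ₗ[ℂ] VirasoroLike →ₗ[ℂ] VirasoroLike :=
    LinearMap.mk₂ ℂ (fun x y => B x ∘ₗ B y)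
      (fun _ _ _ => by ext; simp) (fun _ _ _ => by ext; simp)
      (fun _ _ _ => by ext; simp) (fun _ _ _ => by ext; simp)
  have key : l1 = r1 + l1.flip := by
    refine linearMap_ext (fun m => ?_) ?_ ?_
    · refine linearMap_ext (fun n => ?_) ?_ ?_
      · refine linearMap_ext (fun p => ?_) ?_ ?_
        · simpa [l1, r1, B] using jacobi_D m n p
        · simp [l1, r1, B, bracket_antisymm _ c₁]
        · simp [l1, r1, B, bracket_antisymm _ c₂]
      · ext z; simp [l1, r1, B]
      · ext z; simp [l1, r1, B]
    · ext y z; simp [l1, r1, B]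
    · ext y z; simp [l1, r1, B]
  exact LinearMap.congr_fun (LinearMap.congr_fun (LinearMap.congr_fun key x) y) z

instance : LieRing VirasoroLike where
  bracket x y := bracket x y
  add_lie x y z := by simp
  lie_add x y z := by simp
  lie_self x := by
    have := bracket_antisymm x x
    have h2 : (2 : ℂ) • bracket x x = 0 := by
      rw [two_smul]; nth_rewrite 1 [this]; exact neg_add_cancel _
    exact (smul_eq_zero.mp h2).resolve_left two_ne_zero
  leibniz_lie x y z := jacobi x y z

instance : LieAlgebra ℂ VirasoroLike where
  lie_smul t x y := by simp [Bracket.bracket]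

theorem lie_def (x y : VirasoroLike) : ⁅x, y⁆ = bracket x y := rfl

/-! ### Graded modules -/

/-- A subspace is graded (homogeneous) if it is the sum of its intersections with the homogeneous
subspaces. -/
def IsGradedSubspace {ι M : Type*} [AddCommGroup M] [Module ℂ M] (𝒢 : ι → Submodule ℂ M)
    (N : Submodule ℂ M) : Prop :=
  N = ⨆ i, N ⊓ 𝒢 i

section GradedModules

variable (V : Type*) [AddCommGroup V] [Module ℂ V] [LieRingModule VirasoroLike V]
  [LieModule ℂ VirasoroLike V] (𝒱 : ℤ × ℤ → Submodule ℂ V)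

/-- `V = ⨁ 𝒱 n` is a `ℤ²`-graded module: `D(m) 𝒱 n ⊆ 𝒱 (m + n)`. -/
structure IsGradedModule : Prop where
  isInternal : DirectSum.IsInternal 𝒱
  lie_mem : ∀ m n : ℤ × ℤ, ∀ v ∈ 𝒱 n, ⁅D m, v⁆ ∈ 𝒱 (m + n)

/-- A graded module is irreducible if it is nonzero and has no graded submodules other than
`0` and itself. -/
structure IsGradedIrreducible : Prop where
  nontrivial : Nontrivial V
  eq_bot_or_eq_top : ∀ N : LieSubmodule ℂ VirasoroLike V,
    IsGradedSubspace 𝒱 (N : Submodule ℂ V) → N = ⊥ ∨ N = ⊤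

/-- All homogeneous subspaces are finite dimensional. -/
def IsQuasiFinite : Prop := ∀ n, FiniteDimensional ℂ (𝒱 n)

/-- The class `𝒪_{ℤ²}`: irreducible quasi-finite graded modules. -/
def InClassO : Prop := IsGradedIrreducible V 𝒱 ∧ IsQuasiFinite V 𝒱

/-- There are a `ℤ`-basis `b'₁, b'₂` of `Γ` and a nonzero homogeneous `v` with `D(m) v = 0` for all
`m ∈ ℤ₊ b'₁ + ℤ₊ b'₂`. -/
def IsGeneralizedHighestWeight : Prop :=
  ∃ (b' : Module.Basis (Fin 2) ℤ (ℤ × ℤ)) (n : ℤ × ℤ), ∃ v ∈ 𝒱 n, v ≠ 0 ∧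
    ∀ k l : ℕ, ⁅D ((k : ℤ) • b' 0 + (l : ℤ) • b' 1), v⁆ = 0

end GradedModules

/-! ### The `ℤ`-grading of the algebra and the modules `V̂⁺(ψ)`

`b` is a `ℤ`-basis of `Γ`, with `b₁ = b 0` and `b₂ = b 1`. -/

section HighestWeight

variable (b : Module.Basis (Fin 2) ℤ (ℤ × ℤ))

/-- `L_j = ⟨D(j b₁ + m b₂) | m ∈ ℤ⟩ ⊕ δ_{j,0} ⟨c₁, c₂⟩`. -/
def gradedPiece (j : ℤ) : Submodule ℂ VirasoroLike :=
  Submodule.span ℂ (Set.range fun m : ℤ => D (j • b 0 + m • b 1)) ⊔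
    (if j = 0 then Submodule.span ℂ {c₁, c₂} else ⊥)

theorem D_mem_gradedPiece_zero (k : ℤ) : D (k • b 1) ∈ gradedPiece b 0 := by
  refine Submodule.mem_sup_left (Submodule.subset_span ⟨k, ?_⟩)
  simp

theorem h_mem_gradedPiece_zero (m : ℤ × ℤ) : h m ∈ gradedPiece b 0 := by
  refine Submodule.mem_sup_right ?_
  rw [if_pos rfl]
  exact add_mem (Submodule.smul_mem _ _ (Submodule.subset_span (by simp)))
    (Submodule.smul_mem _ _ (Submodule.subset_span (by simp)))

/-- `D(k b₂)` as an element of `L₀`. -/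
def D₀ (k : ℤ) : gradedPiece b 0 := ⟨D (k • b 1), D_mem_gradedPiece_zero b k⟩

/-- `h(m)` as an element of `L₀`. -/
def h₀ (m : ℤ × ℤ) : gradedPiece b 0 := ⟨h m, h_mem_gradedPiece_zero b m⟩

variable (ψ : gradedPiece b 0 →ₗ[ℂ] ℂ)

/-- `ψ` is an exp-polynomial function over `L₀`: it is nonzero, `ψ(h(b₂)) = 0`, and for some
polynomials `p_j = b_{j0} + b_{j1} X + ⋯` and nonzero numbers `α_j` one has
`ψ(D(k b₂)) = (∑_j p_j(k) α_j ^ k) / k` for `k ≠ 0` and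
`ψ(h(b₁)) = - det(b₁, b₂) ∑_j b_{j0}`. -/
structure IsExpPolynomial : Prop where
  ne_zero : ψ ≠ 0
  map_h_b₂ : ψ (h₀ b (b 1)) = 0
  exists_eq : ∃ (r : ℕ) (p : Fin r → Polynomial ℂ) (α : Fin r → ℂ), (∀ j, α j ≠ 0) ∧
    (∀ k : ℤ, k ≠ 0 → ψ (D₀ b k) = (∑ j, (p j).eval (k : ℂ) * α j ^ k) / (k : ℂ)) ∧
    ψ (h₀ b (b 0)) = -(det (b 0) (b 1) : ℂ) * ∑ j, (p j).coeff 0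

/-- The universal enveloping algebra `U(L)`. -/
abbrev U : Type := UniversalEnvelopingAlgebra ℂ VirasoroLike

/-- The canonical map `L → U(L)`. -/
def ι (x : VirasoroLike) : U := UniversalEnvelopingAlgebra.ι ℂ x

/-- The left ideal of `U(L)` generated by the `x ∈ L_j` with `j > 0` and by the `x - ψ(x)` with
`x ∈ L₀`; this is the annihilator of the generator `1 ⊗ v₀` of `U(L) ⊗_{U(L₀ + L₊)} ℂ v₀`. -/
def vermaIdeal : Submodule U U :=
  Submodule.span U ({u | ∃ j : ℤ, 0 < j ∧ ∃ x ∈ gradedPiece b j, u = ι x} ∪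
    {u | ∃ x : gradedPiece b 0, u = ι (x : VirasoroLike) - algebraMap ℂ U (ψ x)})

/-- The induced module `V̄⁺(ψ) = U(L) ⊗_{U(L₀ + L₊)} ℂ v₀`, as the quotient of `U(L)` by the left
ideal of the relations `x v₀ = 0` for `x ∈ L₊` and `x v₀ = ψ(x) v₀` for `x ∈ L₀`. -/
def Verma : Type := U ⧸ vermaIdeal b ψ

instance : AddCommGroup (Verma b ψ) := inferInstanceAs (AddCommGroup (U ⧸ vermaIdeal b ψ))
instance : Module U (Verma b ψ) := inferInstanceAs (Module U (U ⧸ vermaIdeal b ψ))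
instance : Module ℂ (Verma b ψ) := inferInstanceAs (Module ℂ (U ⧸ vermaIdeal b ψ))
instance : IsScalarTower ℂ U (Verma b ψ) :=
  inferInstanceAs (IsScalarTower ℂ U (U ⧸ vermaIdeal b ψ))

theorem ι_lie (x y : VirasoroLike) : ι ⁅x, y⁆ = ι x * ι y - ι y * ι x := by
  simp only [ι, LieHom.map_lie]
  exact Ring.lie_def _ _

instance : LieRingModule VirasoroLike (Verma b ψ) where
  bracket x v := ι x • v
  add_lie x y v := by simp only [ι, map_add, add_smul]
  lie_add x v w := smul_add _ _ _
  leibniz_lie x y v := by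
    simp only [ι_lie, sub_smul, mul_smul]
    abel

instance : LieModule ℂ VirasoroLike (Verma b ψ) where
  smul_lie t x v := by
    change ι (t • x) • v = t • (ι x • v)
    simp only [ι, map_smul, smul_assoc]
  lie_smul t x v := by
    change ι x • (t • v) = t • (ι x • v)
    rw [← algebraMap_smul U t v, ← algebraMap_smul U t (ι x • v), ← mul_smul, ← mul_smul,
      Algebra.commutes]

/-- The generator `v₀` of the induced module. -/
def vermaGen : Verma b ψ := (vermaIdeal b ψ).mkQ (1 : U)

/-- The `ℤ`-grading of the induced module with `v₀` in degree `0`: degree `n` is spanned by the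
`x₁ ⋯ x_k v₀` with `x_i ∈ L_{j_i}` and `j₁ + ⋯ + j_k = n`. -/
def vermaGrade (n : ℤ) : Submodule ℂ (Verma b ψ) :=
  Submodule.span ℂ {v | ∃ l : List (ℤ × VirasoroLike),
    (∀ p ∈ l, p.2 ∈ gradedPiece b p.1) ∧ (l.map Prod.fst).sum = n ∧
      v = (l.map fun p => ι p.2).prod • vermaGen b ψ}

/-- The maximal proper graded submodule `J` of the induced module, as the sum of all proper graded
submodules. -/
def vermaMaxSubmodule : LieSubmodule ℂ VirasoroLike (Verma b ψ) :=
  sSup {N | IsGradedSubspace (vermaGrade b ψ) (N : Submodule ℂ (Verma b ψ)) ∧ N ≠ ⊤}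

/-- The irreducible graded highest weight module `V̂⁺(ψ) = V̄⁺(ψ) / J`. -/
abbrev VHat : Type := Verma b ψ ⧸ vermaMaxSubmodule b ψ

/-- The generator `v₀` of `V̂⁺(ψ)`. -/
def vHatGen : VHat b ψ := LieSubmodule.Quotient.mk (vermaGen b ψ)

/-- The induced `ℤ`-grading of `V̂⁺(ψ)`. -/
def vHatGrade (n : ℤ) : Submodule ℂ (VHat b ψ) :=
  (vermaGrade b ψ n).map (LieSubmodule.Quotient.mk' (vermaMaxSubmodule b ψ) : _ →ₗ[ℂ] VHat b ψ)

end HighestWeight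

/-! ### The loop modules `M ⊗ ℂ[t, t⁻¹]` -/

section Loop

variable (δ : ℤ × ℤ →+ ℤ) (M : Type*) [AddCommGroup M] [Module ℂ M]

/-- The space `M ⊗ ℂ[t, t⁻¹]`, to carry the action twisted by `δ`. -/
@[nolint unusedArguments]
def LoopModule (_ : ℤ × ℤ →+ ℤ) (M : Type*) [AddCommGroup M] [Module ℂ M] : Type _ :=
  M ⊗[ℂ] ℂ[T;T⁻¹]

instance : AddCommGroup (LoopModule δ M) := inferInstanceAs (AddCommGroup (M ⊗[ℂ] ℂ[T;T⁻¹]))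
instance : Module ℂ (LoopModule δ M) := inferInstanceAs (Module ℂ (M ⊗[ℂ] ℂ[T;T⁻¹]))

/-- `v ↦ v ⊗ t ^ k`. -/
def loopMk (k : ℤ) : M →ₗ[ℂ] LoopModule δ M :=
  (TensorProduct.mk ℂ M ℂ[T;T⁻¹]).flip (LaurentPolynomial.T k)

/-- The operator `v ⊗ f ↦ φ v ⊗ t ^ k f`. -/
def loopOp (φ : Module.End ℂ M) (k : ℤ) : Module.End ℂ (LoopModule δ M) :=
  TensorProduct.map φ (LinearMap.mulLeft ℂ (LaurentPolynomial.T k : ℂ[T;T⁻¹]))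

theorem loopOp_mul (φ χ : Module.End ℂ M) (k l : ℤ) :
    loopOp δ M φ k * loopOp δ M χ l = loopOp δ M (φ * χ) (k + l) := by
  refine TensorProduct.ext' fun v f => ?_
  change φ (χ v) ⊗ₜ[ℂ] (_ * (_ * f)) = φ (χ v) ⊗ₜ[ℂ] (_ * f)
  rw [LaurentPolynomial.T_add, mul_assoc]

/-- `loopOp` as a linear map in the operator. -/
def loopOpₗ (k : ℤ) : Module.End ℂ M →ₗ[ℂ] Module.End ℂ (LoopModule δ M) where
  toFun φ := loopOp δ M φ k
  map_add' _ _ := TensorProduct.map_add_left _ _ _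
  map_smul' _ _ := TensorProduct.map_smul_left _ _ _

theorem loopOpₗ_mul (φ χ : Module.End ℂ M) (k l : ℤ) :
    loopOpₗ δ M k φ * loopOpₗ δ M l χ = loopOpₗ δ M (k + l) (φ * χ) := loopOp_mul δ M φ χ k l

variable [LieRingModule VirasoroLike M] [LieModule ℂ VirasoroLike M]

/-- The action of the algebra: `D(m) (v ⊗ t ^ k) = D(m) v ⊗ t ^ (k + δ m)` and
`c_i (v ⊗ t ^ k) = c_i v ⊗ t ^ k`. -/
def loopAction : VirasoroLike →ₗ[ℂ] Module.End ℂ (LoopModule δ M) :=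
  lift (fun m => loopOp δ M (LieModule.toEnd ℂ VirasoroLike M (D m)) (δ m))
    (loopOp δ M (LieModule.toEnd ℂ VirasoroLike M c₁) 0)
    (loopOp δ M (LieModule.toEnd ℂ VirasoroLike M c₂) 0)

theorem loopAction_D (m : ℤ × ℤ) :
    loopAction δ M (D m) = loopOpₗ δ M (δ m) (LieModule.toEnd ℂ VirasoroLike M (D m)) := by
  rw [loopAction, lift_D]
  · rfl
  · simp only [D_zero, map_zero]
    exact (loopOpₗ δ M 0).map_zero

theorem loopAction_c₁ :
    loopAction δ M c₁ = loopOpₗ δ M 0 (LieModule.toEnd ℂ VirasoroLike M c₁) := by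
  rw [loopAction, lift_c₁]; rfl

theorem loopAction_c₂ :
    loopAction δ M c₂ = loopOpₗ δ M 0 (LieModule.toEnd ℂ VirasoroLike M c₂) := by
  rw [loopAction, lift_c₂]; rfl

theorem loopAction_bracketD (m n : ℤ × ℤ) : loopAction δ M (bracketD m n) =
    loopOpₗ δ M (δ m + δ n) (LieModule.toEnd ℂ VirasoroLike M (bracketD m n)) := by
  unfold bracketD h
  by_cases h0 : m + n = 0
  · have : δ m + δ n = 0 := by rw [← map_add, h0, map_zero]
    simp only [h0, if_true, map_add, map_smul, D_zero, map_zero, smul_zero, loopAction_c₁,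
      loopAction_c₂, this]
  · simp only [h0, if_false, add_zero, map_smul, loopAction_D, map_add]

theorem lie_c₁ (x : VirasoroLike) : ⁅x, c₁⁆ = 0 := by rw [lie_def, bracket_antisymm]; simp
theorem lie_c₂ (x : VirasoroLike) : ⁅x, c₂⁆ = 0 := by rw [lie_def, bracket_antisymm]; simp
theorem c₁_lie (x : VirasoroLike) : ⁅c₁, x⁆ = 0 := by rw [lie_def]; simp
theorem c₂_lie (x : VirasoroLike) : ⁅c₂, x⁆ = 0 := by rw [lie_def]; simp

theorem commute_toEnd_of_lie_eq_zero {x y : VirasoroLike} (hxy : ⁅x, y⁆ = 0) :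
    LieModule.toEnd ℂ VirasoroLike M x * LieModule.toEnd ℂ VirasoroLike M y =
      LieModule.toEnd ℂ VirasoroLike M y * LieModule.toEnd ℂ VirasoroLike M x := by
  refine LinearMap.ext fun w => ?_
  change ⁅x, ⁅y, w⁆⁆ = ⁅y, ⁅x, w⁆⁆
  rw [leibniz_lie x y w, hxy, zero_lie, zero_add]

theorem loopAction_lie (x y : VirasoroLike) : loopAction δ M ⁅x, y⁆ =
    loopAction δ M x * loopAction δ M y - loopAction δ M y * loopAction δ M x := by
  let μ := LinearMap.mul ℂ (Module.End ℂ (LoopModule δ M))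
  let ρ := loopAction δ M
  have key : bracket.compr₂ ρ = μ.compl₁₂ ρ ρ - (μ.compl₁₂ ρ ρ).flip := by
    refine linearMap_ext (fun m => linearMap_ext (fun n => ?_) ?_ ?_)
      (linearMap_ext (fun n => ?_) ?_ ?_) (linearMap_ext (fun n => ?_) ?_ ?_)
    · simp only [μ, ρ, LinearMap.compr₂_apply, LinearMap.sub_apply, LinearMap.compl₁₂_apply,
        LinearMap.flip_apply, LinearMap.mul_apply', bracket_D_D, loopAction_bracketD, loopAction_D,
        loopOpₗ_mul]
      have e : LieModule.toEnd ℂ VirasoroLike M ⁅D m, D n⁆ =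
          LieModule.toEnd ℂ VirasoroLike M (D m) * LieModule.toEnd ℂ VirasoroLike M (D n) -
            LieModule.toEnd ℂ VirasoroLike M (D n) * LieModule.toEnd ℂ VirasoroLike M (D m) :=
        LinearMap.ext fun w => lie_lie (D m) (D n) w
      rw [add_comm (δ n), ← map_sub, ← bracket_D_D, ← lie_def, e]
    all_goals
      simp only [μ, ρ, LinearMap.compr₂_apply, LinearMap.sub_apply, LinearMap.compl₁₂_apply,
        LinearMap.flip_apply, LinearMap.mul_apply', loopAction_c₁, loopAction_c₂, loopAction_D,
        loopOpₗ_mul, bracket_c₁, bracket_c₂, bracket_D_c₁, bracket_D_c₂, LinearMap.zero_apply,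
        map_zero]
      rw [eq_comm, sub_eq_zero, add_comm, commute_toEnd_of_lie_eq_zero]
      simp only [lie_c₁, lie_c₂, c₁_lie, c₂_lie]
  exact LinearMap.congr_fun (LinearMap.congr_fun key x) y

instance : LieRingModule VirasoroLike (LoopModule δ M) where
  bracket x w := loopAction δ M x w
  add_lie x y w := by simp
  lie_add x v w := by simp
  leibniz_lie x y w := by
    simp only [loopAction_lie, LinearMap.sub_apply, Module.End.mul_apply]
    abel

instance : LieModule ℂ VirasoroLike (LoopModule δ M) where
  smul_lie t x w := by
    change loopAction δ M (t • x) w = t • loopAction δ M x w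
    simp
  lie_smul t x w := (loopAction δ M x).map_smul t w

theorem lie_loopMk (m : ℤ × ℤ) (v : M) (k : ℤ) :
    ⁅D m, loopMk δ M k v⁆ = loopMk δ M (k + δ m) ⁅D m, v⁆ := by
  change loopAction δ M (D m) _ = _
  rw [loopAction_D]
  change ⁅D m, v⁆ ⊗ₜ[ℂ] ((LaurentPolynomial.T (δ m) : ℂ[T;T⁻¹]) * LaurentPolynomial.T k) =
    ⁅D m, v⁆ ⊗ₜ[ℂ] LaurentPolynomial.T (k + δ m)
  rw [← LaurentPolynomial.T_add, add_comm]

end Loop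

/-! ### The modules `V(ψ)` and `V̄(ψ, i, s)` -/

section VBar

variable (b : Module.Basis (Fin 2) ℤ (ℤ × ℤ)) (ψ : gradedPiece b 0 →ₗ[ℂ] ℂ)

/-- The `b₂`-coordinate on `Γ`. -/
def coord₂ : ℤ × ℤ →+ ℤ := (b.coord 1).toAddMonoidHom

/-- `V(ψ) = V̂⁺(ψ) ⊗ ℂ[t, t⁻¹]` with
`D(i b₁ + j b₂) (v ⊗ t ^ k) = D(i b₁ + j b₂) v ⊗ t ^ (k + j)`. -/
abbrev VPsi : Type := LoopModule (coord₂ b) (VHat b ψ)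

/-- The homogeneous subspace of `V(ψ)` of degree `γ = m b₁ + k b₂`, that is `V̂⁺(ψ)_m ⊗ t ^ k`. -/
def vPsiGrade (γ : ℤ × ℤ) : Submodule ℂ (VPsi b ψ) :=
  (vHatGrade b ψ (b.repr γ 0)).map (loopMk (coord₂ b) (VHat b ψ) (b.repr γ 1))

/-- `v₀ ⊗ t ^ k`. -/
def topVec (k : ℤ) : VPsi b ψ := loopMk (coord₂ b) (VHat b ψ) k (vHatGen b ψ)

/-- The Heisenberg subalgebra `ℋ` generated (equivalently, spanned) by the `D(k b₂)` and
`h(b₂)`. -/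
def heisenberg : LieSubalgebra ℂ VirasoroLike :=
  LieSubalgebra.lieSpan ℂ VirasoroLike (insert (h (b 1)) (Set.range fun k : ℤ => D (k • b 1)))

/-- `W_i = U(ℋ) (v₀ ⊗ t ^ i)`. -/
def W (i : ℤ) : Submodule ℂ (VPsi b ψ) :=
  (LieSubmodule.lieSpan ℂ (heisenberg b) {topVec b ψ i}).toSubmodule

/-- `W_i = v₀ ⊗ ℂ[t ^ s, t ^ (-s)] t ^ i`, the condition on `s` under which `V̄(ψ, i, s)` is
defined. -/
def HasPeriod (i : ℤ) (s : ℕ) : Prop :=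
  W b ψ i = Submodule.span ℂ (Set.range fun k : ℤ => topVec b ψ (i + s * k))

/-- The largest graded submodule of `V(ψ)` that intersects `W_i` trivially, as the sum of all
such submodules. -/
def vBarKernel (i : ℤ) : LieSubmodule ℂ VirasoroLike (VPsi b ψ) :=
  sSup {N | IsGradedSubspace (vPsiGrade b ψ) (N : Submodule ℂ (VPsi b ψ)) ∧
    (N : Submodule ℂ (VPsi b ψ)) ⊓ W b ψ i = ⊥}

/-- The module `V̄(ψ, i, s)`, for the `s` with `HasPeriod b ψ i s`. -/
abbrev VBar (i : ℤ) : Type := VPsi b ψ ⧸ vBarKernel b ψ i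

/-- The induced `ℤ²`-grading of `V̄(ψ, i, s)`. -/
def vBarGrade (i : ℤ) (γ : ℤ × ℤ) : Submodule ℂ (VBar b ψ i) :=
  (vPsiGrade b ψ γ).map (LieSubmodule.Quotient.mk' (vBarKernel b ψ i) : _ →ₗ[ℂ] VBar b ψ i)

end VBar

end VirasoroLike

end

noncomputable section

set_option linter.unusedSectionVars false

namespace VirasoroLike

/-! ### The algebra and its modules -/

/-! Bounding the support. If one nonzero homogeneous vector is killed by `D(m)` for all `m` in a
quadrant, then every vector is killed on some translate of the open quadrant, and `D(-m)` is
injective for `m` in it: a vector killed by `D(-m)` would be killed by the whole algebra. Hence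
dimensions cannot increase along the quadrant, they stabilise, and the support misses a translate of
it (`exists_translate_eq_bot`). If no half-plane bounded the support, then for every `α ≠ 0` one of
`D(α)`, `D(-α)` would be injective, and these choices would form an archimedean total order on `Γ`
along which dimensions decrease. Such an order on a group of rank two is dense, which leaves room
for a nonzero homogeneous space that brackets force to vanish (`exists_isHalfPlaneBounded`). The
bounding direction lies in `Γ`, so in a suitable basis the module has a top layer.

Reading the top layer. Raising a lowered top vector returns to the top layer with a coefficient
depending only on the total shift (`raise_lower`). Finite dimension of the layers below therefore
constrains the top one. The first layer down forces `h(b₂)` to act as zero (`central_eq_zero`); then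
the `D(k b₂)` commute, and a Schur argument makes the top layer a copy of `ℂ[t ^ s, t ^ (-s)]` on
which `D(k b₂)` is a multiple of multiplication by `t ^ k` (`HasTopLayer.exists_shift_basis`). The
second layer down shows that some `D(k b₂)` acts nontrivially (`HasTopLayer.exists_lie_ne_zero`). A
linear relation in the first layer down becomes a linear recurrence for `k ψ(D(k b₂))`, whose
solutions are exponential polynomials (`HasTopLayer.exists_expPolynomial`). An irreducible graded
module is determined by its top layer, by a graph argument (`IsShiftModule.exists_equiv`), and
`VBar` has the same one.

Converse. Recurrence propagates downwards: in the irreducible highest weight module each sequence `k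
↦ D(j b₁ + k b₂) w` with `j < 0` is recurrent, so it spans a finite dimensional space, and
homogeneous subspaces are finite dimensional by induction on the depth
(`finiteDimensional_vHatGrade`). The given isomorphism need not respect degrees, so the grading must
also be unique up to translation (`IsShiftModule.exists_grading_eq`); this comes from the fact that
in the Laurent polynomial ring `1` cannot split into several homogeneous parts.

That the induced module is nonzero is obtained without the Poincaré-Birkhoff-Witt theorem: the
formal sum of the top vectors realises its generator, and in the converse a zero induced module
would make the given module trivial. -/

theorem det_add_left (m n p : ℤ × ℤ) : det (m + n) p = det m p + det n p := by
  simp [det]; ring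

theorem det_add_right (m n p : ℤ × ℤ) : det m (n + p) = det m n + det m p := by
  simp [det]; ring

theorem det_neg_left (m n : ℤ × ℤ) : det (-m) n = -det m n := by
  simp [det]; ring

theorem det_neg_right (m n : ℤ × ℤ) : det m (-n) = -det m n := by
  simp [det]; ring

theorem det_sub_left (m n p : ℤ × ℤ) : det (m - n) p = det m p - det n p := by
  simp [det]; ring

theorem det_sub_right (m n p : ℤ × ℤ) : det m (n - p) = det m n - det m p := by
  simp [det]; ring

theorem det_zsmul_left (k : ℤ) (m n : ℤ × ℤ) : det (k • m) n = k * det m n := by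
  simp [det]; ring

theorem det_zsmul_right (k : ℤ) (m n : ℤ × ℤ) : det m (k • n) = k * det m n := by
  simp [det]; ring

theorem det_nsmul_left (k : ℕ) (m n : ℤ × ℤ) : det (k • m) n = k * det m n := by
  simp [det]; ring

theorem det_nsmul_right (k : ℕ) (m n : ℤ × ℤ) : det m (k • n) = k * det m n := by
  simp [det]; ring

@[simp] theorem det_self (m : ℤ × ℤ) : det m m = 0 := by simp [det]; ring

@[simp] theorem det_zero_left (m : ℤ × ℤ) : det 0 m = 0 := by simp [det]

@[simp] theorem det_zero_right (m : ℤ × ℤ) : det m 0 = 0 := by simp [det]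

theorem det_comm (m n : ℤ × ℤ) : det m n = -det n m := by simp [det]; ring

theorem exists_det_ne_zero {m : ℤ × ℤ} (hm : m ≠ 0) : ∃ n, det m n ≠ 0 := by
  by_contra! hc
  have h1 := hc (1, 0)
  have h2 := hc (0, 1)
  simp only [det] at h1 h2
  exact hm (Prod.ext (by simpa using h2) (by simpa using h1))

/-- Elements of `Γ` that are both parallel to a nonzero `q` are parallel. -/
theorem det_eq_zero_trans {m n q : ℤ × ℤ} (hq : q ≠ 0) (hm : det m q = 0) (hn : det n q = 0) :
    det m n = 0 := by
  obtain ⟨p, hp⟩ := exists_det_ne_zero hq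
  have : det q p * det m n = 0 := by
    simp only [det] at *
    linear_combination (m.1 * p.2 - m.2 * p.1) * (-hn) + (n.1 * p.2 - n.2 * p.1) * hm
  exact (mul_eq_zero.mp this).resolve_left hp

theorem h_add (m n : ℤ × ℤ) : h (m + n) = h m + h n := by
  simp only [h, Prod.fst_add, Prod.snd_add]; push_cast; module

theorem h_zsmul (k : ℤ) (m : ℤ × ℤ) : h (k • m) = (k : ℂ) • h m := by
  simp only [h, Prod.smul_fst, Prod.smul_snd, smul_eq_mul]; push_cast; module

theorem lie_D_D (m n : ℤ × ℤ) : ⁅D m, D n⁆ = bracketD m n := by rw [lie_def, bracket_D_D]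

theorem lie_D_D_neg (m : ℤ × ℤ) : ⁅D m, D (-m)⁆ = h m := by
  rw [lie_D_D, bracketD]; simp

theorem lie_h (m : ℤ × ℤ) (x : VirasoroLike) : ⁅x, h m⁆ = 0 := by
  simp only [h, lie_add, lie_smul, lie_c₁, lie_c₂, smul_zero, add_zero]

theorem h_lie (m : ℤ × ℤ) (x : VirasoroLike) : ⁅h m, x⁆ = 0 := by
  rw [← lie_skew, lie_h, neg_zero]

theorem c₁_eq_h : c₁ = h (1, 0) := by simp [h]

theorem c₂_eq_h : c₂ = h (0, 1) := by simp [h]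

section Modules

variable {V : Type*} [AddCommGroup V] [Module ℂ V] [LieRingModule VirasoroLike V]

theorem D_lie_D_lie [LieModule ℂ VirasoroLike V] (m n : ℤ × ℤ) (v : V) :
    ⁅D m, ⁅D n, v⁆⁆ = ⁅D n, ⁅D m, v⁆⁆ + (-(det m n : ℂ)) • ⁅D (m + n), v⁆ +
      (if m + n = 0 then ⁅h m, v⁆ else 0) := by
  rw [leibniz_lie, lie_D_D, bracketD, add_lie, smul_lie]
  split_ifs
  · abel
  · rw [zero_lie]; abel

theorem D_lie_D_lie_of_ne [LieModule ℂ VirasoroLike V] {m n : ℤ × ℤ} (hmn : m + n ≠ 0) (v : V) :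
    ⁅D m, ⁅D n, v⁆⁆ = ⁅D n, ⁅D m, v⁆⁆ + (-(det m n : ℂ)) • ⁅D (m + n), v⁆ := by
  rw [D_lie_D_lie, if_neg hmn, add_zero]

theorem h_lie_lie (m : ℤ × ℤ) (x : VirasoroLike) (v : V) : ⁅h m, ⁅x, v⁆⁆ = ⁅x, ⁅h m, v⁆⁆ := by
  rw [leibniz_lie, h_lie, zero_lie, zero_add]

theorem h_lie_eq (m : ℤ × ℤ) (v : V) : ⁅h m, v⁆ = ⁅D m, ⁅D (-m), v⁆⁆ - ⁅D (-m), ⁅D m, v⁆⁆ := by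
  rw [leibniz_lie, lie_D_D_neg]; abel

/-- A property of elements of the algebra that is linear and holds for all `D(m)` and all `h(m)`
holds for all elements. -/
theorem induction_D {p : VirasoroLike → Prop} (hD : ∀ m, p (D m)) (hh : ∀ m, p (h m))
    (hadd : ∀ x y, p x → p y → p (x + y)) (hsmul : ∀ (t : ℂ) x, p x → p (t • x))
    (x : VirasoroLike) : p x := by
  have h0 : p 0 := by simpa using hsmul 0 _ (hD 0)
  let N : Submodule ℂ VirasoroLike :=
    { carrier := {x | p x}
      add_mem' := fun ha hb => hadd _ _ ha hb
      zero_mem' := h0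
      smul_mem' := fun t y hy => hsmul t y hy }
  have : N.mkQ = 0 := by
    refine linearMap_ext (fun m => ?_) ?_ ?_
    · simpa using (Submodule.Quotient.mk_eq_zero N).2 (hD m)
    · rw [c₁_eq_h]; simpa using (Submodule.Quotient.mk_eq_zero N).2 (hh (1, 0))
    · rw [c₂_eq_h]; simpa using (Submodule.Quotient.mk_eq_zero N).2 (hh (0, 1))
  have hx := LinearMap.congr_fun this x
  exact (Submodule.Quotient.mk_eq_zero N).1 hx

/-- The central elements need no separate check, because `h(m)` is the commutator of `D(m)` and
`D(-m)`. -/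
theorem lie_mem_of_forall_D [LieModule ℂ VirasoroLike V] {N : Submodule ℂ V}
    (hN : ∀ m, ∀ v ∈ N, ⁅D m, v⁆ ∈ N) (x : VirasoroLike) {v : V} (hv : v ∈ N) : ⁅x, v⁆ ∈ N := by
  refine induction_D (p := fun x => ⁅x, v⁆ ∈ N) (fun m => hN m v hv) (fun m => ?_)
    (fun x y hx hy => ?_) (fun t x hx => ?_) x
  · rw [h_lie_eq]
    exact N.sub_mem (hN _ _ (hN _ _ hv)) (hN _ _ (hN _ _ hv))
  · rw [add_lie]; exact N.add_mem hx hy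
  · rw [smul_lie]; exact N.smul_mem t hx

/-- A subspace that is stable under all `D(m)` is a submodule. -/
def ofStable [LieModule ℂ VirasoroLike V] (N : Submodule ℂ V)
    (hN : ∀ m, ∀ v ∈ N, ⁅D m, v⁆ ∈ N) : LieSubmodule ℂ VirasoroLike V :=
  { N with lie_mem := fun hv => lie_mem_of_forall_D hN _ hv }

@[simp] theorem mem_ofStable [LieModule ℂ VirasoroLike V] {N : Submodule ℂ V}
    {hN : ∀ m, ∀ v ∈ N, ⁅D m, v⁆ ∈ N} {v : V} : v ∈ ofStable N hN ↔ v ∈ N := Iff.rfl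

@[simp] theorem coe_ofStable [LieModule ℂ VirasoroLike V] {N : Submodule ℂ V}
    {hN : ∀ m, ∀ v ∈ N, ⁅D m, v⁆ ∈ N} : (ofStable N hN : Submodule ℂ V) = N := rfl

theorem isTrivial_of_forall_D [LieModule ℂ VirasoroLike V] (hD : ∀ m (v : V), ⁅D m, v⁆ = 0) :
    LieModule.IsTrivial VirasoroLike V :=
  ⟨fun x v => by
    refine induction_D (p := fun x => ⁅x, v⁆ = 0) (fun m => hD m v) (fun m => ?_)
      (fun x y hx hy => ?_) (fun t x hx => ?_) x
    · simp only [h_lie_eq, hD, sub_zero]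
    · simp only [add_lie, hx, hy, add_zero]
    · simp only [smul_lie, hx, smul_zero]⟩

/-- The operator `v ↦ x v` as a linear map. -/
abbrev act [LieModule ℂ VirasoroLike V] (x : VirasoroLike) : V →ₗ[ℂ] V :=
  LieModule.toEnd ℂ VirasoroLike V x

end Modules

/-! ### Gradings -/

section Grading

variable {ι M : Type*} [DecidableEq ι] [AddCommGroup M] [Module ℂ M] {𝒢 : ι → Submodule ℂ M}

/-- The projection onto a homogeneous component. -/
def gproj (hI : DirectSum.IsInternal 𝒢) (i : ι) : M →ₗ[ℂ] M :=
  (𝒢 i).subtype ∘ₗ DirectSum.component ℂ ι (fun i => 𝒢 i) i ∘ₗ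
    (LinearEquiv.ofBijective (DirectSum.coeLinearMap 𝒢) hI).symm.toLinearMap

variable (hI : DirectSum.IsInternal 𝒢)
include hI

theorem gproj_mem (i : ι) (x : M) : gproj hI i x ∈ 𝒢 i := Submodule.coe_mem _

theorem gproj_of_mem {i : ι} {x : M} (hx : x ∈ 𝒢 i) : gproj hI i x = x := by
  have := DirectSum.IsInternal.ofBijective_coeLinearMap_of_mem hI hx
  simp only [gproj, LinearMap.comp_apply]
  exact congrArg Subtype.val this

theorem gproj_of_mem_ne {i j : ι} (hij : j ≠ i) {x : M} (hx : x ∈ 𝒢 j) : gproj hI i x = 0 := by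
  have := DirectSum.IsInternal.ofBijective_coeLinearMap_of_mem_ne hI hij hx
  simp only [gproj, LinearMap.comp_apply]
  exact congrArg Subtype.val this

theorem gproj_induction {p : M → Prop} (h0 : p 0) (hadd : ∀ x y, p x → p y → p (x + y))
    (hmem : ∀ i, ∀ x ∈ 𝒢 i, p x) (x : M) : p x := by
  have hx : x ∈ ⨆ i, 𝒢 i := by rw [hI.submodule_iSup_eq_top]; trivial
  exact Submodule.iSup_induction 𝒢 (motive := p) hx hmem h0 hadd

theorem exists_finset_sum_gproj (x : M) :
    ∃ s : Finset ι, (∀ i ∉ s, gproj hI i x = 0) ∧ x = ∑ i ∈ s, gproj hI i x := by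
  classical
  refine gproj_induction hI (p := fun x => ∃ s : Finset ι, (∀ i ∉ s, gproj hI i x = 0) ∧
    x = ∑ i ∈ s, gproj hI i x) ⟨∅, by simp, by simp⟩ ?_ ?_ x
  · rintro x y ⟨s, hs, hx⟩ ⟨t, ht, hy⟩
    refine ⟨s ∪ t, fun i hi => ?_, ?_⟩
    · simp only [Finset.mem_union, not_or] at hi
      rw [map_add, hs i hi.1, ht i hi.2, add_zero]
    · simp only [map_add, Finset.sum_add_distrib]
      rw [← Finset.sum_subset (Finset.subset_union_left (s₁ := s) (s₂ := t))
        (fun i _ hi => hs i hi), ← hx,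
        ← Finset.sum_subset (Finset.subset_union_right (s₁ := s) (s₂ := t))
        (fun i _ hi => ht i hi), ← hy]
  · intro i x hx
    refine ⟨{i}, fun j hj => gproj_of_mem_ne hI ?_ hx, ?_⟩
    · rintro rfl; simp at hj
    · simp [gproj_of_mem hI hx]

theorem mem_of_gproj_mem {N : Submodule ℂ M} {x : M} (hx : ∀ i, gproj hI i x ∈ N) : x ∈ N := by
  obtain ⟨s, -, hs⟩ := exists_finset_sum_gproj hI x
  rw [hs]
  exact N.sum_mem fun i _ => hx i

theorem eq_zero_of_gproj {x : M} (hx : ∀ i, gproj hI i x = 0) : x = 0 := by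
  simpa using mem_of_gproj_mem hI (N := ⊥) (x := x) (by simpa using hx)

theorem mem_of_gproj_eq_zero {i : ι} {x : M} (hx : ∀ j, j ≠ i → gproj hI j x = 0) : x ∈ 𝒢 i := by
  refine mem_of_gproj_mem hI fun j => ?_
  by_cases hj : j = i
  · subst hj; exact gproj_mem hI _ _
  · rw [hx j hj]; exact zero_mem _

theorem isGradedSubspace_iff {N : Submodule ℂ M} :
    IsGradedSubspace 𝒢 N ↔ ∀ i, ∀ x ∈ N, gproj hI i x ∈ N := by
  constructor
  · intro hN i x hx
    rw [hN] at hx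
    refine Submodule.iSup_induction (fun i => N ⊓ 𝒢 i) (motive := fun x => gproj hI i x ∈ N) hx
      ?_ ?_ ?_
    · rintro j y ⟨hy, hy'⟩
      by_cases hj : j = i
      · subst hj; rwa [gproj_of_mem hI hy']
      · rw [gproj_of_mem_ne hI hj hy']; exact zero_mem _
    · rw [map_zero]; exact zero_mem _
    · intro x y hx hy; rw [map_add]; exact add_mem hx hy
  · intro hN
    refine le_antisymm (fun x hx => ?_) (iSup_le fun i => inf_le_left)
    exact mem_of_gproj_mem hI fun i => Submodule.mem_iSup_of_mem i ⟨hN i x hx, gproj_mem hI i x⟩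

omit hI

/-- A family of subspaces that spans the space and that admits projections is a grading. -/
theorem isInternal_of_proj (hsup : ⨆ i, 𝒢 i = ⊤) (p : ι → M →ₗ[ℂ] M)
    (hp : ∀ i, ∀ x ∈ 𝒢 i, p i x = x) (hp' : ∀ i j, j ≠ i → ∀ x ∈ 𝒢 j, p i x = 0) :
    DirectSum.IsInternal 𝒢 := by
  rw [DirectSum.isInternal_submodule_iff_iSupIndep_and_iSup_eq_top]
  refine ⟨fun i => ?_, hsup⟩
  rw [Submodule.disjoint_def]
  intro x hx hx'
  rw [← hp i x hx]
  have : (⨆ j, ⨆ (_ : j ≠ i), 𝒢 j) ≤ LinearMap.ker (p i) :=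
    iSup₂_le fun j hj y hy => hp' i j hj y hy
  exact this hx'

omit [DecidableEq ι] in
theorem IsGradedSubspace.sSup {s : Set (Submodule ℂ M)} (hs : ∀ N ∈ s, IsGradedSubspace 𝒢 N) :
    IsGradedSubspace 𝒢 (sSup s) := by
  refine le_antisymm (sSup_le fun N hN => ?_) (iSup_le fun i => inf_le_left)
  rw [hs N hN]
  exact iSup_mono fun i => inf_le_inf_right _ (le_sSup hN)

/-- The induced grading of the quotient by a graded subspace. -/
theorem isInternal_mkQ (hI : DirectSum.IsInternal 𝒢) {N : Submodule ℂ M}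
    (hN : IsGradedSubspace 𝒢 N) : DirectSum.IsInternal fun i => (𝒢 i).map N.mkQ := by
  refine isInternal_of_proj ?_
    (fun i => N.mapQ N (gproj hI i) fun x hx => (isGradedSubspace_iff hI).1 hN i x hx) ?_ ?_
  · rw [← Submodule.map_iSup, hI.submodule_iSup_eq_top, Submodule.map_top, Submodule.range_mkQ]
  · rintro i _ ⟨x, hx, rfl⟩
    simp [gproj_of_mem hI hx]
  · rintro i j hj _ ⟨x, hx, rfl⟩
    simp [gproj_of_mem_ne hI hj hx]

end Grading

/-! ### Graded modules, with degrees in a quotient of `Γ` -/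

section GradedBy

variable {ι : Type*} [DecidableEq ι] [AddCommGroup ι] (φ : ℤ × ℤ →+ ι)
  {M : Type*} [AddCommGroup M] [Module ℂ M] [LieRingModule VirasoroLike M]
  [LieModule ℂ VirasoroLike M] (𝒢 : ι → Submodule ℂ M)

/-- `M = ⨁ 𝒢 i` with `D(m) 𝒢 i ⊆ 𝒢 (φ m + i)`. -/
structure IsGradedBy : Prop where
  isInternal : DirectSum.IsInternal 𝒢
  lie_mem : ∀ m i, ∀ v ∈ 𝒢 i, ⁅D m, v⁆ ∈ 𝒢 (φ m + i)

theorem isGradedBy_id_iff {M : Type*} [AddCommGroup M] [Module ℂ M] [LieRingModule VirasoroLike M]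
    [LieModule ℂ VirasoroLike M] {𝒢 : ℤ × ℤ → Submodule ℂ M} :
    IsGradedBy (AddMonoidHom.id _) 𝒢 ↔ IsGradedModule M 𝒢 :=
  ⟨fun h => ⟨h.1, h.2⟩, fun h => ⟨h.1, h.2⟩⟩

variable {φ 𝒢} (hG : IsGradedBy φ 𝒢)
include hG

theorem IsGradedBy.gproj_lie (m : ℤ × ℤ) (i : ι) (v : M) :
    gproj hG.isInternal (φ m + i) ⁅D m, v⁆ = ⁅D m, gproj hG.isInternal i v⁆ := by
  refine gproj_induction hG.isInternal (p := fun v =>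
    gproj hG.isInternal (φ m + i) ⁅D m, v⁆ = ⁅D m, gproj hG.isInternal i v⁆) (by simp)
    (fun x y hx hy => by simp only [lie_add, map_add, hx, hy]) (fun j x hx => ?_) v
  by_cases hj : j = i
  · subst hj
    rw [gproj_of_mem _ hx, gproj_of_mem _ (hG.lie_mem m _ x hx)]
  · rw [gproj_of_mem_ne _ hj hx, gproj_of_mem_ne _ (fun h => hj (add_left_cancel h))
      (hG.lie_mem m _ x hx), lie_zero]

theorem IsGradedBy.gproj_lie' (m : ℤ × ℤ) (i : ι) (v : M) :
    gproj hG.isInternal i ⁅D m, v⁆ = ⁅D m, gproj hG.isInternal (i - φ m) v⁆ := by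
  rw [← hG.gproj_lie, add_sub_cancel]

theorem IsGradedBy.h_lie_mem (m : ℤ × ℤ) {i : ι} {v : M} (hv : v ∈ 𝒢 i) : ⁅h m, v⁆ ∈ 𝒢 i := by
  rw [h_lie_eq]
  have h1 := hG.lie_mem m _ _ (hG.lie_mem (-m) _ _ hv)
  have h2 := hG.lie_mem (-m) _ _ (hG.lie_mem m _ _ hv)
  simp only [map_neg, add_neg_cancel_left, neg_add_cancel_left] at h1 h2
  exact sub_mem h1 h2

/-- The submodule generated by a graded subspace is graded. -/
theorem IsGradedBy.isGradedSubspace_lieSpan {T : Set M}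
    (hT : ∀ t ∈ T, ∀ i, gproj hG.isInternal i t ∈ LieSubmodule.lieSpan ℂ VirasoroLike T) :
    IsGradedSubspace 𝒢 (LieSubmodule.lieSpan ℂ VirasoroLike T : Submodule ℂ M) := by
  rw [isGradedSubspace_iff hG.isInternal]
  intro i x hx
  let R := LieSubmodule.lieSpan ℂ VirasoroLike T
  let N : Submodule ℂ M := ⨅ i, (R : Submodule ℂ M).comap (gproj hG.isInternal i)
  have hN : ∀ m, ∀ v ∈ N, ⁅D m, v⁆ ∈ N := fun m v hv => by
    simp only [N, Submodule.mem_iInf, Submodule.mem_comap] at hv ⊢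
    intro i
    rw [hG.gproj_lie']
    exact R.lie_mem (hv _)
  have hle : R ≤ ofStable N hN := LieSubmodule.lieSpan_le.2 fun t ht => by
    simp only [SetLike.mem_coe, mem_ofStable, N, Submodule.mem_iInf, Submodule.mem_comap]
    exact hT t ht
  have := hle hx
  simp only [mem_ofStable, N, Submodule.mem_iInf, Submodule.mem_comap] at this
  exact this i

theorem IsGradedBy.isGradedSubspace_lieSpan_of_homogeneous {T : Set M}
    (hT : ∀ t ∈ T, ∃ i, t ∈ 𝒢 i) :
    IsGradedSubspace 𝒢 (LieSubmodule.lieSpan ℂ VirasoroLike T : Submodule ℂ M) := by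
  refine hG.isGradedSubspace_lieSpan fun t ht i => ?_
  obtain ⟨j, hj⟩ := hT t ht
  by_cases hij : j = i
  · subst hij; rw [gproj_of_mem _ hj]; exact LieSubmodule.subset_lieSpan ht
  · rw [gproj_of_mem_ne _ hij hj]; exact zero_mem _

theorem IsGradedBy.quotient {N : LieSubmodule ℂ VirasoroLike M}
    (hN : IsGradedSubspace 𝒢 (N : Submodule ℂ M)) :
    IsGradedBy φ fun i => (𝒢 i).map (LieSubmodule.Quotient.mk' N : M →ₗ[ℂ] M ⧸ N) where
  isInternal := isInternal_mkQ hG.isInternal hN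
  lie_mem := by
    rintro m i _ ⟨x, hx, rfl⟩
    exact ⟨⁅D m, x⁆, hG.lie_mem m i x hx, rfl⟩

end GradedBy

/-! ### Modules generated by vectors of top degree -/

section Triangular

variable {M : Type*} [AddCommGroup M] [Module ℂ M] [LieRingModule VirasoroLike M]
  [LieModule ℂ VirasoroLike M]

/-- Let `ℓ` be an additive function on `Γ`, and let the subspace `T` be stable under the `D(m)` with
`ℓ m = 0` and killed by those with `ℓ m > 0`. If `T ⊕ N` is mapped to `N` by the `D(m)` with
`ℓ m < 0`, then the submodule generated by `T` is contained in `T + N`. -/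
theorem lieSpan_le_of_triangular (ℓ : ℤ × ℤ →+ ℤ) {T N : Submodule ℂ M}
    (h0 : ∀ m, ℓ m = 0 → ∀ v ∈ T, ⁅D m, v⁆ ∈ T) (hpos : ∀ m, 0 < ℓ m → ∀ v ∈ T, ⁅D m, v⁆ = 0)
    (hh : ∀ m, ∀ v ∈ T, ⁅h m, v⁆ ∈ T) (hneg : ∀ m, ℓ m < 0 → ∀ v ∈ T ⊔ N, ⁅D m, v⁆ ∈ N) :
    (LieSubmodule.lieSpan ℂ VirasoroLike (T : Set M) : Submodule ℂ M) ≤ T ⊔ N := by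
  -- `R` is the smallest subspace containing `T` and stable under the operators of negative degree.
  -- Stability under the rest of the algebra follows by moving operators past the negative ones.
  let c : Set (Submodule ℂ M) := {P | T ≤ P ∧ ∀ m, ℓ m < 0 → ∀ v ∈ P, ⁅D m, v⁆ ∈ P}
  let R : Submodule ℂ M := sInf c
  have hTR : T ≤ R := le_sInf fun P hP => hP.1
  have hR : ∀ m, ℓ m < 0 → ∀ v ∈ R, ⁅D m, v⁆ ∈ R := fun m hm v hv => by
    rw [Submodule.mem_sInf] at hv ⊢
    exact fun P hP => hP.2 m hm v (hv P hP)
  have hRN : R ≤ T ⊔ N := sInf_le ⟨le_sup_left, fun m hm v hv =>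
    Submodule.mem_sup_right (hneg m hm v hv)⟩
  have hTall : ∀ n, ∀ v ∈ T, ⁅D n, v⁆ ∈ R := fun n v hv => by
    rcases lt_trichotomy (ℓ n) 0 with hn | hn | hn
    · exact hR n hn v (hTR hv)
    · exact hTR (h0 n hn v hv)
    · rw [hpos n hn v hv]; exact zero_mem _
  have hRh : ∀ m, ∀ v ∈ R, ⁅h m, v⁆ ∈ R := fun m => by
    have : R ≤ R ⊓ R.comap (act (h m)) := by
      refine sInf_le ⟨fun v hv => ⟨hTR hv, hTR (hh m v hv)⟩, ?_⟩
      rintro n hn v ⟨hv, hv'⟩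
      refine ⟨hR n hn v hv, ?_⟩
      change ⁅h m, ⁅D n, v⁆⁆ ∈ R
      rw [h_lie_lie]
      exact hR n hn _ hv'
    exact fun v hv => (this hv).2
  -- `P` collects the vectors of `R` that every `D(n)` keeps in `R`. It contains `T` and is stable
  -- under negative operators, since a commutator of two `D`'s is a multiple of another one plus a
  -- central term; minimality of `R` gives `R ≤ P`.
  let P : Submodule ℂ M := R ⊓ ⨅ n, R.comap (act (D n))
  have hP : R ≤ P := by
    refine sInf_le ⟨fun v hv => ⟨hTR hv, ?_⟩, ?_⟩
    · rw [SetLike.mem_coe, Submodule.mem_iInf]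
      exact fun n => hTall n v hv
    · rintro m hm v ⟨hv, hv'⟩
      rw [SetLike.mem_coe, Submodule.mem_iInf] at hv'
      refine ⟨hR m hm v hv, ?_⟩
      rw [SetLike.mem_coe, Submodule.mem_iInf]
      intro n
      rw [Submodule.mem_comap]
      change ⁅D n, ⁅D m, v⁆⁆ ∈ R
      rw [D_lie_D_lie]
      refine add_mem (add_mem (hR m hm _ (hv' n)) (R.smul_mem _ (hv' _))) ?_
      split_ifs with hnm
      · exact hRh n v hv
      · exact zero_mem _
  have hstable : ∀ m, ∀ v ∈ R, ⁅D m, v⁆ ∈ R := fun m v hv => by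
    have := (hP hv).2
    rw [SetLike.mem_coe, Submodule.mem_iInf] at this
    exact this m
  refine le_trans ?_ hRN
  have : LieSubmodule.lieSpan ℂ VirasoroLike (T : Set M) ≤ ofStable R hstable :=
    LieSubmodule.lieSpan_le.2 hTR
  exact this

end Triangular

/-! ### An order-theoretic lemma -/

section Order

variable {G : Type*} [AddCommGroup G] [LinearOrder G] [IsOrderedAddMonoid G] [Archimedean G]
  (e : G ≃+ ℤ × ℤ)

include e in
-- Divide an element not parallel to `x` by `x`: the remainder `r` satisfies `0 < r < x` and is not
-- parallel to `x`, and the smaller of `r` and `x - r` serves.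
theorem exists_two_nsmul_le {x : G} (hx : 0 < x) :
    ∃ y, 0 < y ∧ y + y ≤ x ∧ det (e x) (e y) ≠ 0 := by
  have hex : e x ≠ 0 := fun h => hx.ne' (by simpa using h)
  obtain ⟨z', hz'⟩ := exists_det_ne_zero hex
  obtain ⟨z, rfl⟩ := e.surjective z'
  obtain ⟨k, ⟨hk1, hk2⟩, -⟩ := existsUnique_zsmul_near_of_pos hx z
  have hdet : det (e x) (e (z - k • x)) ≠ 0 := by
    rw [map_sub, map_zsmul, det_sub_right, det_zsmul_right, det_self, mul_zero, sub_zero]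
    exact hz'
  have hr0 : z - k • x ≠ 0 := fun h => hdet (by rw [h]; simp)
  have hr : 0 < z - k • x := lt_of_le_of_ne (sub_nonneg.2 hk1) (Ne.symm hr0)
  have hrx : z - k • x < x := by
    rw [add_smul, one_smul] at hk2
    exact sub_left_lt_of_lt_add hk2
  by_cases h2 : (z - k • x) + (z - k • x) ≤ x
  · exact ⟨_, hr, h2, hdet⟩
  · refine ⟨x - (z - k • x), sub_pos.2 hrx, ?_, ?_⟩
    · push Not at h2
      generalize z - k • x = r at *
      have := sub_le_sub_left h2.le (x + x)
      calc x - r + (x - r) = x + x - (r + r) := by abel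
        _ ≤ x + x - x := this
        _ = x := by abel
    · rw [map_sub, det_sub_right, det_self, zero_sub]
      exact neg_ne_zero.2 hdet

include e in
-- Two halvings give the size but may return to the direction of `n`. A third halving then leaves
-- that direction.
theorem exists_four_nsmul_le {n : G} (hn : 0 < n) :
    ∃ y, 0 < y ∧ y + y + (y + y) ≤ n ∧ det (e n) (e y) ≠ 0 := by
  obtain ⟨y1, h1, h1', -⟩ := exists_two_nsmul_le e hn
  obtain ⟨y2, h2, h2', -⟩ := exists_two_nsmul_le e h1
  have h22 : y2 + y2 + (y2 + y2) ≤ n := (add_le_add h2' h2').trans h1'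
  by_cases hd : det (e n) (e y2) = 0
  · obtain ⟨y3, h3, h3', h3''⟩ := exists_two_nsmul_le e h2
    have hle : y3 ≤ y2 := le_trans (le_add_of_nonneg_left h3.le) h3'
    refine ⟨y3, h3, le_trans (add_le_add (add_le_add hle hle) (add_le_add hle hle)) h22,
      fun hd3 => h3'' ?_⟩
    refine det_eq_zero_trans (q := e n) (fun h => hn.ne' (by simpa using h)) ?_ ?_
    · rw [det_comm, hd, neg_zero]
    · rw [det_comm, hd3, neg_zero]
  · exact ⟨y2, h2, h22, hd⟩

/-- An antitone function with values in `ℕ` that vanishes somewhere, on an archimedean ordered group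
of rank two, is constant on long intervals before its zeros. -/
theorem exists_interval_of_antitone {d : G → ℕ} (hd : Antitone d) (h0 : ∃ x, d x = 0)
    (h1 : ∃ x, d x ≠ 0) : ∃ ν n ε : G, 0 < ε ∧ 0 < n - ε ∧ det (e n) (e ε) ≠ 0 ∧ d ν ≠ 0 ∧
      d (ν - (n + n)) = d ν ∧ d (ν + (n - ε)) = 0 := by
  classical
  -- Points with a nonzero value strictly beyond them. Minimising `d` over `S`, rather than over all
  -- points with `d ≠ 0`, leaves an interval of positive length after the minimiser `μ`, and on `S`
  -- the function is constant from `μ` on.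
  let S : Set G := {x | ∃ y, x < y ∧ d y ≠ 0}
  have hSd : ∀ x ∈ S, d x ≠ 0 := by
    rintro x ⟨y, hxy, hy⟩ hx
    have := hd hxy.le
    omega
  have hSlow : ∀ x ∈ S, ∀ y, y ≤ x → y ∈ S := by
    rintro x ⟨z, hxz, hz⟩ y hy
    exact ⟨z, hy.trans_lt hxz, hz⟩
  obtain ⟨x0, hx0⟩ : ∃ x : G, 0 < x := by
    have hne : e.symm (1, 0) ≠ 0 := by simp
    rcases lt_or_gt_of_ne hne with h | h
    · exact ⟨-_, neg_pos.2 h⟩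
    · exact ⟨_, h⟩
  obtain ⟨a, ha⟩ := h1
  have hSne : (d '' S).Nonempty := ⟨_, a - x0, ⟨a, sub_lt_self _ hx0, ha⟩, rfl⟩
  obtain ⟨μ, hμ, hμmin⟩ := Nat.sInf_mem hSne
  have hmin : ∀ x ∈ S, μ ≤ x → d x = d μ := fun x hx hμx =>
    le_antisymm (hd hμx) (by rw [hμmin]; exact Nat.sInf_le ⟨x, hx, rfl⟩)
  obtain ⟨μ1, hμ1, hdμ1⟩ := hμ
  obtain ⟨y1, hy1, hy1', -⟩ := exists_two_nsmul_le e (sub_pos.2 hμ1)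
  obtain ⟨n, hn, hn', -⟩ := exists_two_nsmul_le e hy1
  obtain ⟨ε, hε, hε4, hdet⟩ := exists_four_nsmul_le e hn
  have h4n : n + n + (n + n) ≤ μ1 - μ := (add_le_add hn' hn').trans hy1'
  have h3 : μ + 3 • n ∈ S := by
    refine ⟨μ1, ?_, hdμ1⟩
    have : 3 • n < n + n + (n + n) := by
      have : n + n + (n + n) = 3 • n + n := by abel
      rw [this]; exact lt_add_of_pos_right _ hn
    exact lt_sub_iff_add_lt'.1 (this.trans_le h4n)
  have hlarge : ∃ k : ℕ, μ + (k + 4) • n ∉ S := by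
    obtain ⟨z, hz⟩ := h0
    obtain ⟨k, hk⟩ := Archimedean.arch (z - μ) hn
    refine ⟨k, ?_⟩
    rintro ⟨y, hy, hdy⟩
    have : z ≤ y := by
      refine le_trans (sub_le_iff_le_add'.1 hk) (le_trans ?_ hy.le)
      exact add_le_add_right (nsmul_le_nsmul_left hn.le (by omega)) μ
    have := hd this
    omega
  -- The least such `k` makes `μ + (k + 3) n` the last point of this progression in `S`; the offset
  -- 3 keeps two steps back from it beyond `μ`.
  have hk1 := Nat.find_spec hlarge
  have hk2 : μ + (Nat.find hlarge + 3) • n ∈ S := by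
    rcases Nat.eq_zero_or_pos (Nat.find hlarge) with h | h
    · rw [h]; simpa using h3
    · have := Nat.find_min hlarge (Nat.sub_lt h one_pos)
      rw [not_not] at this
      convert this using 3
      omega
  generalize Nat.find hlarge = k at hk1 hk2
  have hge : μ ≤ μ + (k + 3) • n := le_add_of_nonneg_right (nsmul_nonneg hn.le _)
  -- The step is enlarged to `n + 2ε`. Going back twice reaches `μ + k n + (n - 4ε) ≥ μ`, inside the
  -- constant range; going forward by `n + ε` lands strictly beyond `μ + (k + 4) n ∉ S`, where `d`
  -- vanishes.
  refine ⟨μ + (k + 3) • n, n + (ε + ε), ε, hε, ?_, ?_, hSd _ hk2, ?_, ?_⟩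
  · have : n + (ε + ε) - ε = n + ε := by abel
    rw [this]; exact add_pos hn hε
  · rwa [map_add, map_add, det_add_left, det_add_left, det_self, add_zero, add_zero]
  · rw [hmin _ hk2 hge]
    refine hmin _ (hSlow _ hk2 _ (sub_le_self _ ?_)) ?_
    · exact (add_pos (add_pos hn (add_pos hε hε)) (add_pos hn (add_pos hε hε))).le
    · have e1 : μ + (k + 3) • n - (n + (ε + ε) + (n + (ε + ε))) =
          μ + (k • n + (n - (ε + ε + (ε + ε)))) := by
        rw [add_smul]; abel
      rw [e1]
      exact le_add_of_nonneg_right (add_nonneg (nsmul_nonneg hn.le _) (sub_nonneg.2 hε4))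
  · by_contra hne
    refine hk1 ⟨_, ?_, hne⟩
    have : μ + (k + 3) • n + (n + (ε + ε) - ε) = μ + (k + 4) • n + ε := by
      simp only [add_smul]; abel
    rw [this]
    exact lt_add_of_pos_right _ hε

end Order

/-! ### Open cones -/

/-- A subsemigroup of `Γ` without `0` all of whose elements are order units. -/
structure IsOpenCone (C : Set (ℤ × ℤ)) : Prop where
  nonempty : C.Nonempty
  add_mem : ∀ a ∈ C, ∀ b ∈ C, a + b ∈ C
  zero_notMem : (0 : ℤ × ℤ) ∉ C
  exists_mem : ∀ γ, ∀ c ∈ C, ∃ k : ℕ, γ + k • c ∈ C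

theorem IsOpenCone.nsmul_mem {C : Set (ℤ × ℤ)} (hC : IsOpenCone C) {c : ℤ × ℤ} (hc : c ∈ C)
    (k : ℕ) : (k + 1) • c ∈ C := by
  induction k with
  | zero => simpa using hc
  | succ k ih => rw [add_smul, one_smul]; exact hC.add_mem _ ih _ hc

section Cones

variable {V : Type*} [AddCommGroup V] [Module ℂ V] [LieRingModule VirasoroLike V]
  [LieModule ℂ VirasoroLike V]

theorem eq_zero_of_neg_det_smul {m n : ℤ × ℤ} (hdet : det m n ≠ 0) {v : V}
    (hv : (-(det m n : ℂ)) • v = 0) : v = 0 :=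
  (smul_eq_zero.1 hv).resolve_left (neg_ne_zero.2 (Int.cast_ne_zero.2 hdet))

/-- `D(m) w = 0` for all `m` in a translate of the cone `C`. -/
def EventuallyKilled (C : Set (ℤ × ℤ)) (w : V) : Prop := ∃ c ∈ C, ∀ n ∈ C, ⁅D (c + n), w⁆ = 0

/-- The submodule of vectors that are killed by a translate of a cone. -/
def killedSubmodule {C : Set (ℤ × ℤ)} (hC : IsOpenCone C) : LieSubmodule ℂ VirasoroLike V :=
  ofStable
    { carrier := {w | EventuallyKilled C w}
      add_mem' := by
        rintro v w ⟨c, hc, hv⟩ ⟨c', hc', hw⟩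
        refine ⟨c + c', hC.add_mem _ hc _ hc', fun n hn => ?_⟩
        have e1 : c + c' + n = c + (c' + n) := by abel
        have e2 : c + c' + n = c' + (c + n) := by abel
        rw [lie_add, e1, hv _ (hC.add_mem _ hc' _ hn), ← e1, e2, hw _ (hC.add_mem _ hc _ hn),
          add_zero]
      zero_mem' := by
        obtain ⟨c, hc⟩ := hC.nonempty
        exact ⟨c, hc, fun n _ => lie_zero _⟩
      smul_mem' := by
        rintro t w ⟨c, hc, hw⟩
        exact ⟨c, hc, fun n hn => by rw [lie_smul, hw n hn, smul_zero]⟩ }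
    (by
      rintro γ w ⟨c, hc, hw⟩
      obtain ⟨k, hk⟩ := hC.exists_mem γ c hc
      have hx : (k + 1) • c ∈ C := hC.nsmul_mem hc k
      -- The extra translation by `(k + 1) c` absorbs `γ`: both `D(c + (k + 1) c + n)` and its
      -- commutator with `D(γ)`, a multiple of some `D` with index in `c + C`, kill `w`.
      refine ⟨c + (k + 1) • c, hC.add_mem _ hc _ hx, fun n hn => ?_⟩
      have e1 : c + (k + 1) • c + n = c + ((k + 1) • c + n) := by abel
      have e2 : c + (k + 1) • c + n + γ = c + (c + (γ + k • c) + n) := by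
        rw [add_smul, one_smul]; abel
      have hmem : c + (γ + k • c) + n ∈ C := hC.add_mem _ (hC.add_mem _ hc _ hk) _ hn
      have hne : c + (k + 1) • c + n + γ ≠ 0 := fun h0 =>
        hC.zero_notMem (h0 ▸ e2 ▸ hC.add_mem _ hc _ hmem)
      rw [D_lie_D_lie_of_ne hne, e2, hw _ hmem, e1, hw _ (hC.add_mem _ hx _ hn), lie_zero,
        smul_zero, add_zero])

variable {𝒱 : ℤ × ℤ → Submodule ℂ V}

theorem lieSpan_singleton_eq_top (hG : IsGradedModule V 𝒱) (hV : IsGradedIrreducible V 𝒱)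
    {n : ℤ × ℤ} {v : V} (hv : v ∈ 𝒱 n) (hv0 : v ≠ 0) :
    LieSubmodule.lieSpan ℂ VirasoroLike {v} = ⊤ := by
  refine (hV.eq_bot_or_eq_top _
    ((isGradedBy_id_iff.2 hG).isGradedSubspace_lieSpan_of_homogeneous ?_)).resolve_left ?_
  · rintro t rfl; exact ⟨n, hv⟩
  · intro hbot
    rw [LieSubmodule.lieSpan_eq_bot_iff] at hbot
    exact hv0 (hbot v rfl)

theorem eventuallyKilled_all (hG : IsGradedModule V 𝒱) (hV : IsGradedIrreducible V 𝒱)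
    {C : Set (ℤ × ℤ)} (hC : IsOpenCone C) {n : ℤ × ℤ} {v : V} (hv : v ∈ 𝒱 n) (hv0 : v ≠ 0)
    (hk : EventuallyKilled C v) (w : V) : EventuallyKilled C w := by
  have : (⊤ : LieSubmodule ℂ VirasoroLike V) ≤ killedSubmodule hC := by
    rw [← lieSpan_singleton_eq_top hG hV hv hv0, LieSubmodule.lieSpan_le]
    rintro t rfl
    exact hk
  exact this (LieSubmodule.mem_top w)

/-- A vector killed by all `D(m)` is zero in a nontrivial irreducible module. -/
theorem eq_zero_of_forall_D (hG : IsGradedModule V 𝒱) (hV : IsGradedIrreducible V 𝒱)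
    (hnt : ¬ LieModule.IsTrivial VirasoroLike V) {v : V} (hv : ∀ m, ⁅D m, v⁆ = 0) : v = 0 := by
  have hG' := isGradedBy_id_iff.2 hG
  let N : Submodule ℂ V := ⨅ m, LinearMap.ker (act (D m))
  have memN : ∀ w, w ∈ N ↔ ∀ m, ⁅D m, w⁆ = 0 := fun w => by
    simp only [N, Submodule.mem_iInf, LinearMap.mem_ker]; rfl
  have hN : ∀ m, ∀ w ∈ N, ⁅D m, w⁆ ∈ N := fun m w hw => by
    rw [(memN w).1 hw m]; exact zero_mem _
  have hgr : IsGradedSubspace 𝒱 (ofStable N hN : Submodule ℂ V) := by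
    rw [coe_ofStable, isGradedSubspace_iff hG.isInternal]
    intro i x hx
    rw [memN] at hx ⊢
    intro m
    rw [← hG'.gproj_lie, hx m, map_zero]
  rcases hV.eq_bot_or_eq_top _ hgr with hb | ht
  · have : v ∈ ofStable N hN := (memN v).2 hv
    rw [hb] at this
    exact (LieSubmodule.mem_bot v).1 this
  · refine absurd (isTrivial_of_forall_D fun m w => ?_) hnt
    have : w ∈ ofStable N hN := by rw [ht]; exact LieSubmodule.mem_top w
    exact (memN w).1 this m

/-- Far out along `γ + ℕ m` the operators kill `v`, and bracketing with `D(-m)` walks back to `γ`.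
So `v` is killed by all `D(γ)` and vanishes by irreducibility. -/
theorem lie_neg_injective (hG : IsGradedModule V 𝒱) (hV : IsGradedIrreducible V 𝒱)
    (hnt : ¬ LieModule.IsTrivial VirasoroLike V) {C : Set (ℤ × ℤ)} (hC : IsOpenCone C)
    (hk : ∀ w : V, EventuallyKilled C w) {m : ℤ × ℤ} (hm : m ∈ C) {v : V}
    (hv : ⁅D (-m), v⁆ = 0) : v = 0 := by
  have hm0 : m ≠ 0 := fun h => hC.zero_notMem (h ▸ hm)
  have key : ∀ γ, det m γ ≠ 0 → ⁅D γ, v⁆ = 0 := fun γ hγ => by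
    obtain ⟨c, hc, hcv⟩ := hk v
    obtain ⟨k, hkm⟩ := hC.exists_mem (γ - c) m hm
    have hk0 : ⁅D (γ + k • m), v⁆ = 0 := by
      have := hcv _ hkm
      rwa [show c + (γ - c + k • m) = γ + k • m by abel] at this
    clear hkm
    induction k with
    | zero => simpa using hk0
    | succ k ih =>
      refine ih ?_
      have hdet : det (-m) (γ + (k + 1) • m) ≠ 0 := by
        rw [det_neg_left, det_add_right, det_nsmul_right, det_self, mul_zero, add_zero]
        exact neg_ne_zero.2 hγ
      have hne : -m + (γ + (k + 1) • m) ≠ 0 := fun h0 => hdet (by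
        rw [neg_add_eq_zero] at h0
        rw [← h0, det_neg_left, det_self, neg_zero])
      have := D_lie_D_lie_of_ne hne v
      rw [hk0, hv, lie_zero, lie_zero, zero_add,
        show -m + (γ + (k + 1) • m) = γ + k • m by rw [add_smul, one_smul]; abel] at this
      exact eq_zero_of_neg_det_smul hdet this.symm
  refine eq_zero_of_forall_D hG hV hnt fun γ => ?_
  -- The walk back needs `det m γ ≠ 0`; an index parallel to `m` is the sum of two that are not.
  by_cases hγ0 : γ = 0
  · rw [hγ0, D_zero, zero_lie]
  by_cases hγ : det m γ = 0
  · obtain ⟨a, ha⟩ := exists_det_ne_zero hm0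
    have haγ : det a γ ≠ 0 := fun h0 => ha (by
      refine det_eq_zero_trans hγ0 hγ h0)
    have h1 := key a ha
    have h2 := key (γ - a) (by rw [det_sub_right, hγ, zero_sub]; exact neg_ne_zero.2 ha)
    have := D_lie_D_lie_of_ne (m := a) (n := γ - a) (by rwa [add_sub_cancel]) v
    rw [h1, h2, lie_zero, lie_zero, zero_add, add_sub_cancel] at this
    refine eq_zero_of_neg_det_smul ?_ this.symm
    rw [det_sub_right, det_self, sub_zero]
    exact haγ
  · exact key γ hγ

/-! ### Dimensions of homogeneous subspaces -/

/-- The operator `D(-m)` is injective on `V`. -/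
def InjNeg (V : Type*) [AddCommGroup V] [LieRingModule VirasoroLike V] (m : ℤ × ℤ) : Prop :=
  ∀ v : V, ⁅D (-m), v⁆ = 0 → v = 0

/-- The map `𝒱 λ → 𝒱 (λ - m)` given by `D(-m)`. -/
def lieNegRestrict (hG : IsGradedModule V 𝒱) (l m : ℤ × ℤ) : 𝒱 l →ₗ[ℂ] 𝒱 (l - m) :=
  (act (D (-m))).restrict fun v hv => by
    have := hG.lie_mem (-m) l v hv
    rwa [neg_add_eq_sub] at this

theorem lieNegRestrict_injective (hG : IsGradedModule V 𝒱) (l : ℤ × ℤ) {m : ℤ × ℤ}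
    (hm : InjNeg V m) : Function.Injective (lieNegRestrict hG l m) := by
  rw [← LinearMap.ker_eq_bot, LinearMap.ker_eq_bot']
  intro v hv
  exact Subtype.ext (hm v (congrArg Subtype.val hv))

theorem finrank_le_sub (hG : IsGradedModule V 𝒱) (hfin : IsQuasiFinite V 𝒱) (l : ℤ × ℤ)
    {m : ℤ × ℤ} (hm : InjNeg V m) : Module.finrank ℂ (𝒱 l) ≤ Module.finrank ℂ (𝒱 (l - m)) := by
  have := hfin (l - m)
  exact LinearMap.finrank_le_finrank_of_injective (lieNegRestrict_injective hG l hm)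

theorem exists_lie_neg_eq (hG : IsGradedModule V 𝒱) (hfin : IsQuasiFinite V 𝒱) {l m : ℤ × ℤ}
    (hm : InjNeg V m) (hd : Module.finrank ℂ (𝒱 l) = Module.finrank ℂ (𝒱 (l - m))) {w : V}
    (hw : w ∈ 𝒱 (l - m)) : ∃ v ∈ 𝒱 l, ⁅D (-m), v⁆ = w := by
  have := hfin (l - m)
  have := hfin l
  obtain ⟨v, hv⟩ := (LinearMap.injective_iff_surjective_of_finrank_eq_finrank hd).1
    (lieNegRestrict_injective hG l hm) ⟨w, hw⟩
  exact ⟨v, v.2, congrArg Subtype.val hv⟩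

theorem eq_bot_of_injNeg (hG : IsGradedModule V 𝒱) {l m : ℤ × ℤ} (hm : InjNeg V m)
    (h0 : 𝒱 (l - m) = ⊥) : 𝒱 l = ⊥ := by
  rw [Submodule.eq_bot_iff] at h0 ⊢
  intro v hv
  refine hm v (h0 _ ?_)
  have := hG.lie_mem (-m) l v hv
  rwa [neg_add_eq_sub] at this

/-- The commutator of `D(n)` and `D(-k)` is a nonzero multiple of `D(-(k - n))`, which is injective.
Both vanishing results for homogeneous subspaces rest on this. -/
theorem eq_zero_of_lie_eq_zero {n k : ℤ × ℤ} (hdet : det n k ≠ 0) (hinj : InjNeg V (k - n)) {w : V}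
    (h1 : ⁅D n, w⁆ = 0) (h2 : ⁅D n, ⁅D (-k), w⁆⁆ = 0) : w = 0 := by
  have hne : n + -k ≠ 0 := fun h0 => hdet (by
    rw [add_neg_eq_zero] at h0; rw [h0, det_self])
  have := D_lie_D_lie_of_ne hne w
  rw [h1, h2, lie_zero, zero_add] at this
  refine hinj w ?_
  rw [neg_sub, sub_eq_add_neg]
  refine eq_zero_of_neg_det_smul ?_ this.symm
  rwa [det_neg_right, neg_ne_zero]

theorem exists_uniform_killed (hfin : IsQuasiFinite V 𝒱) {C : Set (ℤ × ℤ)} (hC : IsOpenCone C)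
    (hk : ∀ w : V, EventuallyKilled C w) (l : ℤ × ℤ) :
    ∃ c ∈ C, ∀ w ∈ 𝒱 l, ∀ n ∈ C, ⁅D (c + n), w⁆ = 0 := by
  have := hfin l
  obtain ⟨s, hs⟩ := (Submodule.fg_iff_finiteDimensional (𝒱 l)).2 this
  have key : ∀ s : Finset V, ∃ c ∈ C, ∀ w ∈ s, ∀ n ∈ C, ⁅D (c + n), w⁆ = 0 := fun s => by
    classical
    induction s using Finset.induction_on with
    | empty => obtain ⟨c, hc⟩ := hC.nonempty; exact ⟨c, hc, by simp⟩
    | insert a s _ ih =>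
      obtain ⟨c, hc, h1⟩ := ih
      obtain ⟨c', hc', h2⟩ := hk a
      refine ⟨c + c', hC.add_mem _ hc _ hc', fun w hw n hn => ?_⟩
      rcases Finset.mem_insert.1 hw with rfl | hw
      · rw [show c + c' + n = c' + (c + n) by abel]; exact h2 _ (hC.add_mem _ hc _ hn)
      · rw [add_assoc]; exact h1 w hw _ (hC.add_mem _ hc' _ hn)
  obtain ⟨c, hc, h1⟩ := key s
  refine ⟨c, hc, fun w hw n hn => ?_⟩
  have : 𝒱 l ≤ LinearMap.ker (act (D (c + n))) := by
    rw [← hs, Submodule.span_le]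
    exact fun w hw => h1 w hw n hn
  exact this hw

/-- The support of `V` misses a translate of the cone. -/
theorem exists_translate_eq_bot (hG : IsGradedModule V 𝒱) (hV : IsGradedIrreducible V 𝒱)
    (hfin : IsQuasiFinite V 𝒱) (hnt : ¬ LieModule.IsTrivial VirasoroLike V) {C : Set (ℤ × ℤ)}
    (hC : IsOpenCone C) (hk : ∀ w : V, EventuallyKilled C w) :
    ∃ l, ∀ m ∈ C, 𝒱 (l + m) = ⊥ := by
  have hinj : ∀ m ∈ C, InjNeg V m := fun m hm v hv => lie_neg_injective hG hV hnt hC hk hm hv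
  obtain ⟨e, he⟩ := hC.nonempty
  -- Dimensions along `k e` are natural numbers that do not increase with `k`, so two consecutive
  -- ones agree and `D(-e)` is bijective between these spaces.
  obtain ⟨l, hl⟩ : ∃ l, Module.finrank ℂ (𝒱 l) = Module.finrank ℂ (𝒱 (l - e)) := by
    by_contra! hcon
    have hlt : ∀ k : ℕ, Module.finrank ℂ (𝒱 (k • e)) + k ≤ Module.finrank ℂ (𝒱 0) := fun k => by
      induction k with
      | zero => rw [zero_smul, add_zero]
      | succ k ih =>
        have h1 := lt_of_le_of_ne (finrank_le_sub hG hfin ((k + 1) • e) (hinj e he)) (hcon _)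
        rw [add_smul, one_smul, add_sub_cancel_right] at h1
        rw [add_smul, one_smul]
        omega
    have := hlt (Module.finrank ℂ (𝒱 0) + 1)
    omega
  obtain ⟨c, hc, hcl⟩ := exists_uniform_killed hfin hC hk l
  have he0 : e ≠ 0 := fun h => hC.zero_notMem (h ▸ he)
  obtain ⟨γ, hγ⟩ := exists_det_ne_zero he0
  obtain ⟨k, hγk⟩ := hC.exists_mem γ e he
  let x := γ + k • e
  have hx : x ∈ C := hγk
  have hxe : det e x ≠ 0 := by
    simp only [x, det_add_right, det_nsmul_right, det_self, mul_zero, add_zero]; exact hγ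
  -- Both `n` and `n - e` must lie beyond the uniform bound `c`, and `n` must not be parallel to
  -- `e`; if `y = x` fails the last condition then `y = x + x` meets it.
  obtain ⟨n, hn, hdet⟩ : ∃ n, (∃ y ∈ C, n = c + e + y) ∧ det n e ≠ 0 := by
    by_cases h0 : det (c + e + x) e = 0
    · refine ⟨c + e + (x + x), ⟨_, hC.add_mem _ hx _ hx, rfl⟩, ?_⟩
      rw [← add_assoc, det_add_left, h0, zero_add, det_comm]
      exact neg_ne_zero.2 hxe
    · exact ⟨_, ⟨x, hx, rfl⟩, h0⟩
  obtain ⟨y, hy, rfl⟩ := hn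
  set n := c + e + y with hn
  have hnC : n ∈ C := hC.add_mem _ (hC.add_mem _ hc _ he) _ hy
  have hkill1 : ∀ w ∈ 𝒱 l, ⁅D n, w⁆ = 0 := fun w hw => by
    rw [hn, add_assoc]; exact hcl w hw _ (hC.add_mem _ he _ hy)
  -- Surjectivity of `D(-e)` transfers the vanishing from `𝒱 l` to `𝒱 (l - e)`, as the commutator
  -- index `n - e = c + y` also kills `𝒱 l`.
  have hkill2 : ∀ w ∈ 𝒱 (l - e), ⁅D n, w⁆ = 0 := fun w hw => by
    obtain ⟨v, hv, rfl⟩ := exists_lie_neg_eq hG hfin (hinj e he) hl hw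
    have hne : n + -e ≠ 0 := fun h0 => hdet (by rw [add_neg_eq_zero] at h0; rw [h0, det_self])
    have hny : n + -e = c + y := by rw [hn]; abel
    rw [D_lie_D_lie_of_ne hne, hkill1 v hv, hny, hcl v hv y hy, lie_zero, smul_zero, add_zero]
  -- `D(n)` kills `w`: it commutes with the injective `D(-2n)`, and `D(-2n) w` lies in `𝒱 (l - e)`.
  -- It also kills `D(-(2n - e)) w ∈ 𝒱 l`. The commutator then forces `w = 0`.
  have hbot : 𝒱 (l - e + (n + n)) = ⊥ := by
    rw [Submodule.eq_bot_iff]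
    intro w hw
    have hnn : n + -(n + n) ≠ 0 := fun h0 => hC.zero_notMem (by
      have : n = 0 := by simpa using h0
      rwa [← this])
    refine eq_zero_of_lie_eq_zero (n := n) (k := n + n - e) ?_ ?_ ?_ (hkill1 _ ?_)
    · rw [det_sub_right, det_add_right, det_self, add_zero, zero_sub]; exact neg_ne_zero.2 hdet
    · refine hinj _ ?_
      rw [show n + n - e - n = c + y by rw [hn]; abel]
      exact hC.add_mem _ hc _ hy
    · refine hinj (n + n) (hC.add_mem _ hnC _ hnC) _ ?_
      have h1 := D_lie_D_lie_of_ne hnn w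
      rw [det_neg_right, det_add_right, det_self, add_zero, neg_zero, Int.cast_zero, neg_zero,
        zero_smul, add_zero] at h1
      rw [← h1]
      refine hkill2 _ ?_
      have := hG.lie_mem (-(n + n)) _ w hw
      rwa [show -(n + n) + (l - e + (n + n)) = l - e by abel] at this
    · have := hG.lie_mem (-(n + n - e)) _ w hw
      rwa [show -(n + n - e) + (l - e + (n + n)) = l by abel] at this
  refine ⟨l - e + (n + n), fun m hm => eq_bot_of_injNeg hG (hinj m hm) ?_⟩
  rwa [add_sub_cancel_right]

end Cones

/-! ### Coordinates with respect to a basis of `Γ` -/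

section Basis

variable (b : Module.Basis (Fin 2) ℤ (ℤ × ℤ))

theorem repr_smul_add (γ : ℤ × ℤ) : b.repr γ 0 • b 0 + b.repr γ 1 • b 1 = γ := by
  have := b.sum_repr γ
  rwa [Fin.sum_univ_two] at this

theorem repr_zsmul (k : ℤ) (γ : ℤ × ℤ) (i : Fin 2) : b.repr (k • γ) i = k * b.repr γ i := by
  rw [map_zsmul, Finsupp.smul_apply, smul_eq_mul]

theorem repr_nsmul (k : ℕ) (γ : ℤ × ℤ) (i : Fin 2) : b.repr (k • γ) i = k * b.repr γ i := by
  rw [map_nsmul, Finsupp.smul_apply, nsmul_eq_mul]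

theorem repr_add (γ γ' : ℤ × ℤ) (i : Fin 2) : b.repr (γ + γ') i = b.repr γ i + b.repr γ' i := by
  rw [map_add, Finsupp.add_apply]

theorem repr_zero_smul_add (x y : ℤ) : b.repr (x • b 0 + y • b 1) 0 = x := by
  simp [-zsmul_eq_mul, -smul_eq_mul]

theorem repr_one_smul_add (x y : ℤ) : b.repr (x • b 0 + y • b 1) 1 = y := by
  simp [-zsmul_eq_mul, -smul_eq_mul]

theorem det_eq_repr (m n : ℤ × ℤ) :
    det m n = det (b 0) (b 1) * (b.repr m 0 * b.repr n 1 - b.repr m 1 * b.repr n 0) := by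
  conv_lhs => rw [← repr_smul_add b m, ← repr_smul_add b n]
  simp only [det_add_left, det_add_right, det_zsmul_left, det_zsmul_right, det_self]
  rw [det_comm (b 1) (b 0)]
  ring

theorem isUnit_det : IsUnit (det (b 0) (b 1)) := by
  have := det_eq_repr b (1, 0) (0, 1)
  rw [show det (1, 0) (0, 1) = 1 by simp [det]] at this
  exact IsUnit.of_mul_eq_one _ this.symm

theorem det_mul_self : det (b 0) (b 1) * det (b 0) (b 1) = 1 := by
  rcases Int.isUnit_iff.1 (isUnit_det b) with h | h <;> rw [h] <;> rfl

/-- The `b₁`-coordinate on `Γ`. -/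
def coord₁ : ℤ × ℤ →+ ℤ := (b.coord 0).toAddMonoidHom

@[simp] theorem coord₁_apply (γ : ℤ × ℤ) : coord₁ b γ = b.repr γ 0 := rfl

@[simp] theorem coord₂_apply (γ : ℤ × ℤ) : coord₂ b γ = b.repr γ 1 := rfl

theorem repr_ext {γ γ' : ℤ × ℤ} (h0 : b.repr γ 0 = b.repr γ' 0) (h1 : b.repr γ 1 = b.repr γ' 1) :
    γ = γ' := by
  rw [← repr_smul_add b γ, ← repr_smul_add b γ', h0, h1]

/-- The open quadrant spanned by a basis. -/
def quadrant : Set (ℤ × ℤ) := {γ | 0 < b.repr γ 0 ∧ 0 < b.repr γ 1}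

theorem isOpenCone_quadrant : IsOpenCone (quadrant b) where
  nonempty := ⟨b 0 + b 1, by simp [quadrant]⟩
  add_mem := by
    rintro a ⟨h0, h1⟩ c ⟨h2, h3⟩
    simp only [quadrant, Set.mem_ofPred_eq, map_add, Finsupp.add_apply]
    omega
  zero_notMem := by simp [quadrant]
  exists_mem := by
    rintro γ c ⟨h0, h1⟩
    refine ⟨(b.repr γ 0).natAbs + (b.repr γ 1).natAbs + 1, ?_⟩
    simp only [quadrant, Set.mem_ofPred_eq, repr_add, repr_nsmul]
    push_cast
    constructor <;> nlinarith [neg_abs_le (b.repr γ 0), neg_abs_le (b.repr γ 1),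
      abs_nonneg (b.repr γ 0), abs_nonneg (b.repr γ 1)]

/-- Every primitive vector is the second vector of a basis. -/
theorem exists_basis_of_isCoprime {β : ℤ × ℤ} (hβ : IsCoprime β.1 β.2) :
    ∃ b : Module.Basis (Fin 2) ℤ (ℤ × ℤ), b 1 = β ∧ ∀ γ, b.repr γ 0 = det γ β := by
  obtain ⟨u, v, huv⟩ := hβ
  let f : (ℤ × ℤ) ≃ₗ[ℤ] Fin 2 → ℤ :=
    { toFun := fun γ => ![det γ β, u * γ.1 + v * γ.2]
      map_add' := fun x y => by
        ext i; fin_cases i <;> simp [det] <;> ring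
      map_smul' := fun t x => by
        ext i; fin_cases i <;> simp [det] <;> ring
      invFun := fun w => (w 0 * v + w 1 * β.1, w 1 * β.2 - w 0 * u)
      left_inv := fun γ => by
        simp only [det, Matrix.cons_val_zero, Matrix.cons_val_one]
        ext
        · simp only; linear_combination γ.1 * huv
        · simp only; linear_combination γ.2 * huv
      right_inv := fun w => by
        ext i
        fin_cases i
        · simp only [det, Fin.zero_eta, Matrix.cons_val_zero]; linear_combination w 0 * huv
        · simp only [Fin.mk_one, Matrix.cons_val_one, Matrix.cons_val_fin_one]
          linear_combination w 1 * huv }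
  refine ⟨Module.Basis.ofEquivFun f, ?_, fun γ => ?_⟩
  · rw [Module.Basis.coe_ofEquivFun]
    simp [f]
  · simp [Module.Basis.ofEquivFun, f]

end Basis

theorem exists_primitive {α : ℤ × ℤ} (hα : α ≠ 0) :
    ∃ (β : ℤ × ℤ) (g : ℤ), 0 < g ∧ α = g • β ∧ IsCoprime β.1 β.2 := by
  have hg : 0 < Int.gcd α.1 α.2 := by
    rw [Int.gcd_pos_iff]
    by_contra! hc
    exact hα (Prod.ext hc.1 hc.2)
  obtain ⟨x, y, hxy, hx, hy⟩ := Int.exists_gcd_one hg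
  exact ⟨(x, y), Int.gcd α.1 α.2, by exact_mod_cast hg, Prod.ext (by simpa [mul_comm] using hx)
    (by simpa [mul_comm] using hy), Int.isCoprime_iff_gcd_eq_one.2 hxy⟩

/-! ### Half-planes -/

section HalfPlane

/-- Take the largest `k` that keeps `x - k a` positive. Then `x - k a ≤ a`, and the hypothesis makes
`y + k c` positive. -/
theorem exists_shift_pos {a c : ℤ} (ha : 0 ≤ a) (hc : 0 ≤ c) (hac : a ≠ 0 ∨ c ≠ 0) {x y : ℤ}
    (hxy : a * c < c * x + a * y) : ∃ k : ℤ, 0 < x - k * a ∧ 0 < y + k * c := by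
  rcases ha.eq_or_lt with rfl | ha
  · have hc' : 0 < c := lt_of_le_of_ne hc (Ne.symm (by simpa using hac))
    refine ⟨|y| + 1, ?_, ?_⟩
    · have : 0 < c * x := by simpa using hxy
      simpa using pos_of_mul_pos_right this hc
    · nlinarith [neg_abs_le y, abs_nonneg y]
  · refine ⟨(x - 1) / a, ?_, ?_⟩
    · have := Int.ediv_mul_le (x - 1) ha.ne'
      omega
    · have h1 : x - 1 < ((x - 1) / a + 1) * a := Int.lt_ediv_add_one_mul_self _ ha
      have h2 : x ≤ ((x - 1) / a) * a + a := by linarith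
      have h3 : 0 < a * (y + (x - 1) / a * c) := by nlinarith
      exact pos_of_mul_pos_right h3 ha.le

variable (b : Module.Basis (Fin 2) ℤ (ℤ × ℤ))

/-- High translates of a line in a half-plane meet every translate of a quadrant in the half
plane. -/
theorem exists_add_zsmul_mem_quadrant {α : ℤ × ℤ} (hα : ∀ c ∈ quadrant b, 0 < det c α)
    (p : ℤ × ℤ) : ∃ x0 : ℤ, ∀ m, x0 < det m α → ∃ k : ℤ, m - p + k • α ∈ quadrant b := by
  set ε := det (b 0) (b 1) with hε
  have hεε : ε * ε = 1 := det_mul_self b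
  -- The sign `ε` is absorbed so that `det m α = m₁ t - m₂ s` in coordinates; positivity on the
  -- quadrant means `s ≤ 0 ≤ t`. The sign returns in the witness `k * ε`.
  set s := ε * b.repr α 0 with hs
  set t := ε * b.repr α 1 with ht
  have hdet : ∀ m, det m α = b.repr m 0 * t - b.repr m 1 * s := fun m => by
    rw [det_eq_repr b]; ring
  have hpos : ∀ x y : ℤ, 0 < x → 0 < y → 0 < x * t - y * s := fun x y hx hy => by
    have := hα (x • b 0 + y • b 1) ⟨by rwa [repr_zero_smul_add],
      by rwa [repr_one_smul_add]⟩
    rwa [hdet, repr_zero_smul_add, repr_one_smul_add] at this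
  have hs0 : s ≤ 0 := by
    by_contra! h
    have := hpos 1 (|t| + 1) one_pos (by positivity)
    nlinarith [le_abs_self t, abs_nonneg t]
  have ht0 : 0 ≤ t := by
    by_contra! h
    have := hpos (|s| + 1) 1 (by positivity) one_pos
    nlinarith [neg_abs_le s, abs_nonneg s]
  have hst : -s ≠ 0 ∨ t ≠ 0 := by
    by_contra! h
    have := hpos 1 1 one_pos one_pos
    omega
  refine ⟨-s * t + det p α, fun m hm => ?_⟩
  have hm' : -s * t < t * b.repr (m - p) 0 + -s * b.repr (m - p) 1 := by
    have := hdet (m - p)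
    rw [det_sub_left] at this
    linarith
  obtain ⟨k, hk1, hk2⟩ := exists_shift_pos (neg_nonneg.2 hs0) ht0 hst hm'
  refine ⟨k * ε, ?_⟩
  simp only [quadrant, Set.mem_ofPred_eq, repr_add, repr_zsmul]
  exact ⟨by rw [mul_assoc, ← hs]; linarith, by rw [mul_assoc, ← ht]; linarith⟩

theorem isOpenCone_halfPlane {α : ℤ × ℤ} (hα : ∃ c, 0 < det c α) :
    IsOpenCone {m | 0 < det m α} where
  nonempty := hα
  add_mem := fun a ha c hc => by
    simp only [Set.mem_ofPred_eq, det_add_left] at *; omega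
  zero_notMem := by simp
  exists_mem := fun γ c hc => by
    refine ⟨(det γ α).natAbs + 1, ?_⟩
    simp only [Set.mem_ofPred_eq, det_add_left, det_nsmul_left] at *
    push_cast
    nlinarith [neg_abs_le (det γ α), abs_nonneg (det γ α)]

/-- The cone `C + ℕ α`. -/
def coneAdd (C : Set (ℤ × ℤ)) (α : ℤ × ℤ) : Set (ℤ × ℤ) := {m | ∃ c ∈ C, ∃ k : ℕ, m = c + k • α}

theorem isOpenCone_coneAdd {C : Set (ℤ × ℤ)} (hC : IsOpenCone C) {α : ℤ × ℤ}
    (hα : ∀ c ∈ C, det c α ≠ 0) : IsOpenCone (coneAdd C α) where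
  nonempty := by
    obtain ⟨c, hc⟩ := hC.nonempty
    exact ⟨c, c, hc, 0, by simp⟩
  add_mem := by
    rintro _ ⟨c, hc, k, rfl⟩ _ ⟨c', hc', k', rfl⟩
    exact ⟨c + c', hC.add_mem _ hc _ hc', k + k', by rw [add_smul]; abel⟩
  zero_notMem := by
    rintro ⟨c, hc, k, hk⟩
    refine hα c hc ?_
    have : det 0 α = det (c + k • α) α := congrArg (fun m => det m α) hk
    rw [det_add_left, det_nsmul_left, det_self, mul_zero, add_zero, det_zero_left] at this
    exact this.symm
  exists_mem := by
    rintro γ _ ⟨c, hc, j, rfl⟩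
    obtain ⟨k, hk⟩ := hC.exists_mem γ c hc
    exact ⟨k, _, hk, k * j, by rw [smul_add, mul_smul]; abel⟩

variable {V : Type*} [AddCommGroup V] [Module ℂ V] [LieRingModule VirasoroLike V]
  [LieModule ℂ VirasoroLike V] {𝒱 : ℤ × ℤ → Submodule ℂ V}

/-- Bracketing with `D(α)` moves the index by `α`, with coefficient nonzero because no element of
`C` is parallel to `α`. -/
theorem eventuallyKilled_coneAdd {C : Set (ℤ × ℤ)} (hC : IsOpenCone C) {α : ℤ × ℤ}
    (hα : ∀ c ∈ C, det c α ≠ 0) {v : V} (hv : EventuallyKilled C v) (hαv : ⁅D α, v⁆ = 0) :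
    EventuallyKilled (coneAdd C α) v := by
  obtain ⟨c, hc, hcv⟩ := hv
  refine ⟨c, ⟨c, hc, 0, by simp⟩, ?_⟩
  rintro _ ⟨n, hn, k, rfl⟩
  induction k with
  | zero => simpa using hcv n hn
  | succ k ih =>
    have hdet : det α (c + (n + k • α)) ≠ 0 := by
      rw [← add_assoc, det_add_right, det_nsmul_right, det_self, mul_zero, add_zero, det_comm]
      exact neg_ne_zero.2 (hα _ (hC.add_mem _ hc _ hn))
    have hne : α + (c + (n + k • α)) ≠ 0 := fun h0 => hdet (by
      rw [← neg_eq_iff_add_eq_zero] at h0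
      rw [← h0, det_neg_right, det_self, neg_zero])
    have := D_lie_D_lie_of_ne hne v
    rw [hαv, ih, lie_zero, lie_zero, zero_add] at this
    have h2 := eq_zero_of_neg_det_smul hdet this.symm
    rwa [show α + (c + (n + k • α)) = c + (n + (k + 1) • α) by
      rw [add_smul, one_smul]; abel] at h2

theorem exists_of_eventuallyKilled_coneAdd {C : Set (ℤ × ℤ)} (hC : IsOpenCone C) {α : ℤ × ℤ}
    {v : V} (hv : EventuallyKilled (coneAdd C α) v) :
    ∃ c ∈ C, ∀ n ∈ C, ∀ k : ℕ, ⁅D (c + n + k • α), v⁆ = 0 := by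
  obtain ⟨_, ⟨c, hc, j, rfl⟩, hcv⟩ := hv
  obtain ⟨k, hk⟩ := hC.exists_mem (-(j • α)) c hc
  refine ⟨c + k • c, ?_, fun n hn i => ?_⟩
  · have := hC.nsmul_mem hc k
    rwa [add_smul, one_smul, add_comm] at this
  · have := hcv _ ⟨_, hC.add_mem _ hk _ hn, i, rfl⟩
    rwa [show c + j • α + (-(j • α) + k • c + n + i • α) = c + k • c + n + i • α by abel] at this

/-- The support of `V` is bounded in some half-plane. -/
def IsHalfPlaneBounded (𝒱 : ℤ × ℤ → Submodule ℂ V) (α : ℤ × ℤ) : Prop :=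
  ∃ x0 : ℤ, ∀ γ, x0 < det γ α → 𝒱 γ = ⊥

theorem exists_homogeneous_of_not_injNeg (hG : IsGradedModule V 𝒱) {m : ℤ × ℤ}
    (hm : ¬ InjNeg V m) : ∃ n, ∃ v ∈ 𝒱 n, v ≠ 0 ∧ ⁅D (-m), v⁆ = 0 := by
  simp only [InjNeg, not_forall] at hm
  obtain ⟨v, hv, hv0⟩ := hm
  have hG' := isGradedBy_id_iff.2 hG
  by_contra! hcon
  refine hv0 (eq_zero_of_gproj hG.isInternal fun i => ?_)
  by_contra hi
  refine hcon i _ (gproj_mem hG.isInternal i v) hi ?_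
  rw [← hG'.gproj_lie, hv, map_zero]

variable {b}

/-- Vectors in the kernels of `D(-α)` and `D(α)` enlarge the cone of eventual vanishing by `-α` and
by `α`. Together these cones exhaust a translate of the half-plane, which is itself an open cone. -/
theorem isHalfPlaneBounded_of_not_injNeg (hG : IsGradedModule V 𝒱) (hV : IsGradedIrreducible V 𝒱)
    (hfin : IsQuasiFinite V 𝒱) (hnt : ¬ LieModule.IsTrivial VirasoroLike V)
    (hk : ∀ w : V, EventuallyKilled (quadrant b) w) {α : ℤ × ℤ}
    (hα : ∀ c ∈ quadrant b, 0 < det c α) (h1 : ¬ InjNeg V α) (h2 : ¬ InjNeg V (-α)) :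
    IsHalfPlaneBounded 𝒱 α := by
  have hC := isOpenCone_quadrant b
  have hα1 : ∀ c ∈ quadrant b, det c α ≠ 0 := fun c hc => (hα c hc).ne'
  have hα2 : ∀ c ∈ quadrant b, det c (-α) ≠ 0 := fun c hc => by
    rw [det_neg_right]; exact neg_ne_zero.2 (hα1 c hc)
  obtain ⟨n1, v1, hv1, hv10, hv1k⟩ := exists_homogeneous_of_not_injNeg hG h1
  obtain ⟨n2, v2, hv2, hv20, hv2k⟩ := exists_homogeneous_of_not_injNeg hG h2
  rw [neg_neg] at hv2k
  have e1 := eventuallyKilled_all hG hV (isOpenCone_coneAdd hC hα2) hv1 hv10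
    (eventuallyKilled_coneAdd hC hα2 (hk v1) hv1k)
  have e2 := eventuallyKilled_all hG hV (isOpenCone_coneAdd hC hα1) hv2 hv20
    (eventuallyKilled_coneAdd hC hα1 (hk v2) hv2k)
  obtain ⟨q, hq⟩ := hC.nonempty
  have hH : IsOpenCone {m | 0 < det m α} := isOpenCone_halfPlane ⟨q, hα q hq⟩
  have e3 : ∀ w : V, EventuallyKilled {m | 0 < det m α} w := fun w => by
    obtain ⟨c1, hc1, hw1⟩ := exists_of_eventuallyKilled_coneAdd hC (e1 w)
    obtain ⟨c2, hc2, hw2⟩ := exists_of_eventuallyKilled_coneAdd hC (e2 w)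
    obtain ⟨x0, hx0⟩ := exists_add_zsmul_mem_quadrant b hα (c1 + c2)
    have hqα : 0 < det q α := hα q hq
    refine ⟨(x0.natAbs + 1) • q, ?_, fun n hn => ?_⟩
    · simp only [Set.mem_ofPred_eq, det_nsmul_left]; positivity
    · simp only [Set.mem_ofPred_eq] at hn
      -- Far enough into the half-plane, `m` is `c1 + c2` plus an element of the quadrant minus `k
      -- α`; the sign of `k` decides which of the two enlarged cones applies.
      obtain ⟨k, hk⟩ := hx0 ((x0.natAbs + 1) • q + n) (by
        rw [det_add_left, det_nsmul_left]
        push_cast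
        nlinarith [le_abs_self x0, abs_nonneg x0])
      generalize (x0.natAbs + 1) • q + n = m at hk ⊢
      rcases le_total 0 k with hk0 | hk0
      · obtain ⟨j, rfl⟩ := Int.eq_ofNat_of_zero_le hk0
        have := hw1 _ (hC.add_mem _ hc2 _ hk) j
        rwa [show c1 + (c2 + (m - (c1 + c2) + (j : ℤ) • α)) + j • -α = m by
          rw [natCast_zsmul, smul_neg]; abel] at this
      · obtain ⟨j, hj⟩ := Int.eq_ofNat_of_zero_le (neg_nonneg.2 hk0)
        obtain rfl : k = -(j : ℤ) := by omega
        have := hw2 _ (hC.add_mem _ hc1 _ hk) j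
        rwa [show c2 + (c1 + (m - (c1 + c2) + (-(j : ℤ)) • α)) + j • α = m by
          rw [neg_smul, natCast_zsmul]; abel] at this
  obtain ⟨l, hl⟩ := exists_translate_eq_bot hG hV hfin hnt hH e3
  refine ⟨det l α, fun γ hγ => ?_⟩
  have := hl (γ - l) (by simp only [Set.mem_ofPred_eq, det_sub_left]; omega)
  rwa [add_sub_cancel] at this

/-- If the support is stable under translations by `± α` then it is bounded in a half-plane. -/
theorem eq_bot_of_add_zsmul {α : ℤ × ℤ} (h1 : ∀ l, 𝒱 (l - α) = ⊥ → 𝒱 l = ⊥)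
    (h2 : ∀ l, 𝒱 (l + α) = ⊥ → 𝒱 l = ⊥) (k : ℤ) (l : ℤ × ℤ) (hl : 𝒱 (l + k • α) = ⊥) :
    𝒱 l = ⊥ := by
  induction k with
  | zero => simpa using hl
  | succ k ih =>
    refine ih (h2 _ ?_)
    rwa [add_assoc, ← add_one_zsmul]
  | pred k ih =>
    refine ih (h1 _ ?_)
    rwa [add_sub_assoc, show (-(k : ℤ)) • α - α = (-(k : ℤ) - 1) • α by rw [sub_smul, one_smul]]

/-- Translating the empty quadrant along `ℤ α` sweeps out a half-plane. -/
theorem isHalfPlaneBounded_of_stable (hG : IsGradedModule V 𝒱) (hV : IsGradedIrreducible V 𝒱)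
    (hfin : IsQuasiFinite V 𝒱) (hnt : ¬ LieModule.IsTrivial VirasoroLike V)
    (hk : ∀ w : V, EventuallyKilled (quadrant b) w) {α : ℤ × ℤ}
    (hα : ∀ c ∈ quadrant b, 0 < det c α) (h1 : ∀ l, 𝒱 (l - α) = ⊥ → 𝒱 l = ⊥)
    (h2 : ∀ l, 𝒱 (l + α) = ⊥ → 𝒱 l = ⊥) : IsHalfPlaneBounded 𝒱 α := by
  obtain ⟨l, hl⟩ := exists_translate_eq_bot hG hV hfin hnt (isOpenCone_quadrant b) hk
  obtain ⟨x0, hx0⟩ := exists_add_zsmul_mem_quadrant b hα l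
  refine ⟨x0, fun γ hγ => ?_⟩
  obtain ⟨k, hk⟩ := hx0 γ hγ
  refine eq_bot_of_add_zsmul h1 h2 k γ ?_
  have := hl _ hk
  rwa [show l + (γ - l + k • α) = γ + k • α by abel] at this

/-- The sign pattern of the two coordinates decides: equal strict signs put `α` or `-α` in the
quadrant, all others leave the quadrant on one side of the line through `α`. -/
theorem quadrant_trichotomy (b : Module.Basis (Fin 2) ℤ (ℤ × ℤ)) {α : ℤ × ℤ} (hα : α ≠ 0) :
    (α ∈ quadrant b ∨ -α ∈ quadrant b) ∨
      ((∀ c ∈ quadrant b, 0 < det c α) ∨ ∀ c ∈ quadrant b, 0 < det c (-α)) := by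
  have key : ∀ β : ℤ × ℤ, β ≠ 0 → b.repr β 0 ≤ 0 → 0 ≤ b.repr β 1 → ∀ c ∈ quadrant b,
      0 < b.repr c 0 * b.repr β 1 - b.repr c 1 * b.repr β 0 := by
    rintro β hβ h0 h1 c ⟨hc0, hc1⟩
    have : b.repr β 0 ≠ 0 ∨ b.repr β 1 ≠ 0 := by
      by_contra! hc
      exact hβ (repr_ext b (by simpa using hc.1) (by simpa using hc.2))
    rcases this with h | h
    · have : b.repr β 0 < 0 := lt_of_le_of_ne h0 h
      nlinarith
    · have : 0 < b.repr β 1 := lt_of_le_of_ne h1 (Ne.symm h)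
      nlinarith
  have key2 : ∀ β : ℤ × ℤ, β ≠ 0 → b.repr β 0 ≤ 0 → 0 ≤ b.repr β 1 →
      ((∀ c ∈ quadrant b, 0 < det c β) ∨ ∀ c ∈ quadrant b, 0 < det c (-β)) := by
    intro β hβ h0 h1
    rcases Int.isUnit_iff.1 (isUnit_det b) with hε | hε
    · left; intro c hc
      rw [det_eq_repr b, hε, one_mul]; exact key β hβ h0 h1 c hc
    · right; intro c hc
      rw [det_neg_right, det_eq_repr b, hε]; simpa using key β hβ h0 h1 c hc
  rcases lt_trichotomy (b.repr α 0) 0 with h0 | h0 | h0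
  · rcases lt_or_ge (b.repr α 1) 0 with h1 | h1
    · left; right; simp only [quadrant, Set.mem_ofPred_eq, map_neg, Finsupp.neg_apply]; omega
    · exact Or.inr (key2 α hα h0.le h1)
  · rcases le_total 0 (b.repr α 1) with h1 | h1
    · exact Or.inr (key2 α hα h0.le h1)
    · have := key2 (-α) (neg_ne_zero.2 hα) (by simp [h0]) (by simpa using h1)
      rw [neg_neg] at this
      exact Or.inr this.symm
  · rcases lt_or_ge 0 (b.repr α 1) with h1 | h1
    · left; left; exact ⟨h0, h1⟩
    · have := key2 (-α) (neg_ne_zero.2 hα) (by simpa using h0.le) (by simpa using h1)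
      rw [neg_neg] at this
      exact Or.inr this.symm

/-- If `α` or `-α` were in the open quadrant, its multiples would carry any degree into the empty
translate, so the support would be empty. Otherwise the sweeping argument applies. -/
theorem exists_isHalfPlaneBounded_of_stable (hG : IsGradedModule V 𝒱)
    (hV : IsGradedIrreducible V 𝒱)
    (hfin : IsQuasiFinite V 𝒱) (hnt : ¬ LieModule.IsTrivial VirasoroLike V)
    (hk : ∀ w : V, EventuallyKilled (quadrant b) w) (hne : ∃ l, 𝒱 l ≠ ⊥) {α : ℤ × ℤ} (hα0 : α ≠ 0)
    (h1 : ∀ l, 𝒱 (l - α) = ⊥ → 𝒱 l = ⊥) (h2 : ∀ l, 𝒱 (l + α) = ⊥ → 𝒱 l = ⊥) :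
    ∃ β ≠ 0, IsHalfPlaneBounded 𝒱 β := by
  have h1' : ∀ l, 𝒱 (l - -α) = ⊥ → 𝒱 l = ⊥ := fun l => by rw [sub_neg_eq_add]; exact h2 l
  have h2' : ∀ l, 𝒱 (l + -α) = ⊥ → 𝒱 l = ⊥ := fun l => by rw [← sub_eq_add_neg]; exact h1 l
  have key : ∀ β, β ∈ quadrant b → (∀ l, 𝒱 (l - β) = ⊥ → 𝒱 l = ⊥) →
      (∀ l, 𝒱 (l + β) = ⊥ → 𝒱 l = ⊥) → False := fun β hβ g1 g2 => by
    obtain ⟨l, hl⟩ := exists_translate_eq_bot hG hV hfin hnt (isOpenCone_quadrant b) hk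
    obtain ⟨l', hl'⟩ := hne
    obtain ⟨k, hk⟩ := (isOpenCone_quadrant b).exists_mem (l' - l) β hβ
    refine hl' (eq_bot_of_add_zsmul g1 g2 k l' ?_)
    have := hl _ hk
    rwa [show l + (l' - l + k • β) = l' + (k : ℤ) • β by rw [natCast_zsmul]; abel] at this
  rcases quadrant_trichotomy b hα0 with (h | h) | (h | h)
  · exact (key _ h h1 h2).elim
  · exact (key _ h h1' h2').elim
  · exact ⟨α, hα0, isHalfPlaneBounded_of_stable hG hV hfin hnt hk h h1 h2⟩
  · exact ⟨-α, neg_ne_zero.2 hα0, isHalfPlaneBounded_of_stable hG hV hfin hnt hk h h1' h2'⟩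

theorem injNeg_or_injNeg_neg (hG : IsGradedModule V 𝒱) (hV : IsGradedIrreducible V 𝒱)
    (hfin : IsQuasiFinite V 𝒱) (hnt : ¬ LieModule.IsTrivial VirasoroLike V)
    (hk : ∀ w : V, EventuallyKilled (quadrant b) w)
    (hno : ¬ ∃ β ≠ 0, IsHalfPlaneBounded 𝒱 β) {α : ℤ × ℤ} (hα0 : α ≠ 0) :
    InjNeg V α ∨ InjNeg V (-α) := by
  by_contra! hcon
  have hinj : ∀ m ∈ quadrant b, InjNeg V m := fun m hm v hv =>
    lie_neg_injective hG hV hnt (isOpenCone_quadrant b) hk hm hv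
  rcases quadrant_trichotomy b hα0 with (h | h) | (h | h)
  · exact hcon.1 (hinj _ h)
  · exact hcon.2 (hinj _ h)
  · exact hno ⟨α, hα0, isHalfPlaneBounded_of_not_injNeg hG hV hfin hnt hk h hcon.1 hcon.2⟩
  · exact hno ⟨-α, neg_ne_zero.2 hα0, isHalfPlaneBounded_of_not_injNeg hG hV hfin hnt hk h hcon.2
      (by rw [neg_neg]; exact hcon.1)⟩

end HalfPlane

/-- A copy of `Γ` without its product order, to carry other orders. -/
def Lattice₂ : Type := ℤ × ℤ

instance : AddCommGroup Lattice₂ := inferInstanceAs (AddCommGroup (ℤ × ℤ))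

/-- The identity map from the copy of `Γ` to `Γ`. -/
def Lattice₂.equiv : Lattice₂ ≃+ ℤ × ℤ := AddEquiv.refl (ℤ × ℤ)

/-- Translation of the order lemma into the language of positive cones, where the order on `Γ` is
produced from injectivity. -/
theorem exists_interval_of_cone (C : AddGroupCone Lattice₂) (htot : ∀ a, a ∈ C ∨ -a ∈ C)
    (harch : ∀ x ∈ C, x ≠ 0 → ∀ y, ∃ k : ℕ, k • x - y ∈ C) {d : Lattice₂ → ℕ}
    (hd : ∀ a c, c - a ∈ C → d c ≤ d a) (h0 : ∃ x, d x = 0) (h1 : ∃ x, d x ≠ 0) :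
    ∃ ν n ε : Lattice₂, n - ε ∈ C ∧ n - ε ≠ 0 ∧ ε ∈ C ∧ ε ≠ 0 ∧
      det (Lattice₂.equiv n) (Lattice₂.equiv ε) ≠ 0 ∧ d ν ≠ 0 ∧
      d (ν - (n + n)) = d ν ∧ d (ν + (n - ε)) = 0 := by
  classical
  have : HasMemOrNegMem C := ⟨htot⟩
  let _ : LinearOrder Lattice₂ := LinearOrder.mkOfAddGroupCone C
  have : IsOrderedAddMonoid Lattice₂ := IsOrderedAddMonoid.mkOfCone C
  have hle : ∀ a c : Lattice₂, a ≤ c ↔ c - a ∈ C := fun a c => Iff.rfl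
  have hpos : ∀ a : Lattice₂, 0 < a ↔ a ∈ C ∧ a ≠ 0 := fun a => by
    rw [lt_iff_le_and_ne, hle, sub_zero, ne_comm]
  have : Archimedean Lattice₂ := ⟨fun x y hy => by
    obtain ⟨h1, h2⟩ := (hpos y).1 hy
    obtain ⟨k, hk⟩ := harch y h1 h2 x
    exact ⟨k, hk⟩⟩
  obtain ⟨ν, n, ε, hε, hn, hdet, h2, h3, h4⟩ := exists_interval_of_antitone Lattice₂.equiv
    (d := d) (fun a c h => hd a c h) h0 h1
  exact ⟨ν, n, ε, ((hpos _).1 hn).1, ((hpos _).1 hn).2, ((hpos _).1 hε).1, ((hpos _).1 hε).2,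
    hdet, h2, h3, h4⟩

/-! ### Boundedness of the support in a half-plane and existence of a top layer. -/

section HalfPlane

variable {V : Type*} [AddCommGroup V] [Module ℂ V] [LieRingModule VirasoroLike V]
  [LieModule ℂ VirasoroLike V] {𝒱 : ℤ × ℤ → Submodule ℂ V}
  {b : Module.Basis (Fin 2) ℤ (ℤ × ℤ)}

theorem exists_ne_bot (hG : IsGradedModule V 𝒱) (hV : IsGradedIrreducible V 𝒱) :
    ∃ l, 𝒱 l ≠ ⊥ := by
  by_contra! hc
  have h1 := hG.isInternal.submodule_iSup_eq_top
  have := hV.nontrivial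
  rw [show 𝒱 = fun _ => ⊥ from funext hc, iSup_bot] at h1
  exact bot_ne_top h1

theorem finrank_eq_zero_iff (hfin : IsQuasiFinite V 𝒱) (l : ℤ × ℤ) :
    Module.finrank ℂ (𝒱 l) = 0 ↔ 𝒱 l = ⊥ := by
  have := hfin l
  exact Submodule.finrank_eq_zero

theorem isHalfPlaneBounded_of_forall {P : ℤ × ℤ → Prop} (hP : ∀ α, P α → ∀ l, 𝒱 (l - α) = ⊥ → 𝒱 l = ⊥)
    (hbot : ∃ l, 𝒱 l = ⊥) {x : ℤ × ℤ} (hxy : ∀ μ, 0 < det μ x → P μ) : IsHalfPlaneBounded 𝒱 x := by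
  obtain ⟨l, hl⟩ := hbot
  refine ⟨det l x, fun γ hγ => hP (γ - l) (hxy _ (by rw [det_sub_left]; omega)) _ ?_⟩
  rwa [sub_sub_cancel]

/-- The support of an irreducible quasi-finite generalized highest weight module is bounded in a
half-plane. -/
theorem exists_isHalfPlaneBounded (hG : IsGradedModule V 𝒱) (hV : IsGradedIrreducible V 𝒱)
    (hfin : IsQuasiFinite V 𝒱) (hnt : ¬ LieModule.IsTrivial VirasoroLike V)
    (hk : ∀ w : V, EventuallyKilled (quadrant b) w) : ∃ β ≠ 0, IsHalfPlaneBounded 𝒱 β := by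
  by_contra hno
  have hne := exists_ne_bot hG hV
  have htot : ∀ {α : ℤ × ℤ}, α ≠ 0 → InjNeg V α ∨ InjNeg V (-α) := fun hα =>
    injNeg_or_injNeg_neg hG hV hfin hnt hk hno hα
  have hsub : ∀ {α : ℤ × ℤ}, InjNeg V α → ∀ l, 𝒱 (l - α) = ⊥ → 𝒱 l = ⊥ := fun hα l hl =>
    eq_bot_of_injNeg hG hα hl
  have hstable : ∀ {α : ℤ × ℤ}, α ≠ 0 → (∀ l, 𝒱 (l - α) = ⊥ → 𝒱 l = ⊥) →
      (∀ l, 𝒱 (l + α) = ⊥ → 𝒱 l = ⊥) → False := fun hα h1 h2 =>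
    hno (exists_isHalfPlaneBounded_of_stable hG hV hfin hnt hk hne hα h1 h2)
  -- Without a bounding half-plane, the `α` with `D(-α)` injective are the positive elements of a
  -- total order on `Γ`.
  let C : AddGroupCone Lattice₂ :=
    { carrier := {α | α = 0 ∨ InjNeg V (Lattice₂.equiv α)}
      zero_mem' := Or.inl rfl
      add_mem' := by
        rintro α β (rfl | hα) (rfl | hβ)
        · left; exact add_zero 0
        · right; rwa [zero_add]
        · right; rwa [add_zero]
        · by_contra hc
          simp only [Set.mem_ofPred_eq, not_or] at hc
          have h0 : Lattice₂.equiv (α + β) ≠ 0 := hc.1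
          have h1 := (htot h0).resolve_left hc.2
          have hα0 : Lattice₂.equiv α ≠ 0 := fun h => by
            have : α = 0 := by simpa using h
            rw [this, zero_add] at hc
            exact hc.2 hβ
          -- If the sum failed, `D(α + β)` would be injective; descending by `β` and then moving by
          -- `α + β` makes emptiness pass from `l + α` to `l`, so the support would be stable under
          -- `± α`.
          refine hstable hα0 (hsub hα) fun l hl => ?_
          refine hsub hβ _ (hsub h1 _ ?_)
          rw [map_add]
          rwa [show l - Lattice₂.equiv β - -(Lattice₂.equiv α + Lattice₂.equiv β) =
            l + Lattice₂.equiv α by abel]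
      eq_zero_of_mem_of_neg_mem' := by
        rintro α (h1 | h1) (h2 | h2)
        · exact h1
        · exact h1
        · simpa using h2
        · by_contra h0
          have h0' : Lattice₂.equiv α ≠ 0 := by simpa using h0
          refine hstable h0' (hsub h1) fun l hl => hsub h2 l ?_
          rwa [map_neg, sub_neg_eq_add] }
  have memC : ∀ α, α ∈ C ↔ α = 0 ∨ InjNeg V (Lattice₂.equiv α) := fun α => Iff.rfl
  have hbot : ∃ l, 𝒱 l = ⊥ := by
    obtain ⟨l, hl⟩ := exists_translate_eq_bot hG hV hfin hnt (isOpenCone_quadrant b) hk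
    obtain ⟨q, hq⟩ := (isOpenCone_quadrant b).nonempty
    exact ⟨_, hl q hq⟩
  have htot' : ∀ α, α ∈ C ∨ -α ∈ C := fun α => by
    by_cases h0 : α = 0
    · left; rw [h0]; exact zero_mem C
    · rcases htot (α := Lattice₂.equiv α) (by simpa using h0) with h1 | h1
      · exact Or.inl (Or.inr h1)
      · refine Or.inr (Or.inr ?_); rwa [map_neg]
  have hdimC : ∀ α ∈ C, ∀ l, 𝒱 (l - Lattice₂.equiv α) = ⊥ → 𝒱 l = ⊥ := by
    rintro α (rfl | hα) l hl
    · simpa using hl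
    · exact hsub hα l hl
  -- If `y` exceeded all multiples of `x`, every `μ` on the side of the line `ℤ x` containing `y`
  -- would be positive. As some homogeneous subspace vanishes, that half-plane would bound the
  -- support.
  have harch : ∀ x ∈ C, x ≠ 0 → ∀ y, ∃ k : ℕ, k • x - y ∈ C := by
    intro x hx hx0 y
    by_contra! hcon
    have hgt : ∀ k : ℕ, y - k • x ∈ C := fun k => by
      rw [← neg_sub]; exact (htot' _).resolve_left (hcon k)
    have hgt' : ∀ k : ℤ, y - k • x ∈ C := fun k => by
      have h1 := hgt k.natAbs
      have h2 : ((k.natAbs : ℤ) - k) • x ∈ C := by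
        obtain ⟨j, hj⟩ := Int.eq_ofNat_of_zero_le (show 0 ≤ (k.natAbs : ℤ) - k by omega)
        rw [hj, natCast_zsmul]; exact nsmul_mem hx j
      have := add_mem h1 h2
      rwa [sub_smul, natCast_zsmul, sub_add_sub_cancel] at this
    set Y := Lattice₂.equiv y with hY
    set X := Lattice₂.equiv x with hX
    have hX0 : X ≠ 0 := by simpa [hX] using hx0
    have hdiv : ∀ (j : ℤ) (z : Lattice₂), 0 < j → j • z ∈ C → z ∈ C := fun j z hj hz => by
      rcases htot' z with hz' | hz'
      · exact hz'
      · obtain ⟨i, rfl⟩ := Int.eq_ofNat_of_zero_le hj.le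
        rw [natCast_zsmul] at hz
        have h1 : i • -z ∈ C := nsmul_mem hz' i
        rw [smul_neg] at h1
        have h2 : i • z = 0 := AddGroupConeClass.eq_zero_of_mem_of_neg_mem hz h1
        have h3 : i • Lattice₂.equiv z = 0 := by rw [← map_nsmul, h2, map_zero]
        rcases smul_eq_zero.1 h3 with h4 | h4
        · omega
        · have : z = 0 := by simpa using h4
          rw [this]; exact zero_mem C
    -- Cramer's rule in rank two.
    have hid : ∀ p : Lattice₂, det Y X • p =
        det (Lattice₂.equiv p) X • y + det Y (Lattice₂.equiv p) • x := fun p => by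
      apply Lattice₂.equiv.injective
      rw [map_add, map_zsmul, map_zsmul, map_zsmul, ← hX, ← hY]
      generalize Lattice₂.equiv p = q
      ext <;> simp [det] <;> ring
    -- A positive multiple of `y` outweighs any multiple of `x`, and positivity of `j μ` passes to
    -- `μ`.
    have key : ∀ (j F c : ℤ) (μ : Lattice₂), 0 < j → 0 < F → j • μ = F • y + c • x → μ ∈ C := by
      intro j F c μ hj hF hμ
      refine hdiv j μ hj ?_
      obtain ⟨i, rfl⟩ := Int.eq_ofNat_of_zero_le hF.le
      have h2 : i • (y - |c| • x) ∈ C := nsmul_mem (hgt' _) i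
      have h3 : 0 ≤ c + i * |c| := by
        have : (1 : ℤ) ≤ i := by omega
        nlinarith [neg_abs_le c, abs_nonneg c]
      obtain ⟨t, ht⟩ := Int.eq_ofNat_of_zero_le h3
      have h4 : t • x ∈ C := nsmul_mem hx t
      have h5 := add_mem h2 h4
      rw [hμ]
      have e2 : i • (y - |c| • x) + t • x = (i : ℤ) • y + c • x := by
        rw [← natCast_zsmul, ← natCast_zsmul, ← ht, smul_sub, add_smul, mul_smul]; abel
      rwa [e2] at h5
    by_cases hYX : det Y X = 0
    · obtain ⟨p', hp⟩ := exists_det_ne_zero hX0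
      obtain ⟨p, rfl⟩ := Lattice₂.equiv.surjective p'
      have h1 := hid p
      rw [hYX, zero_smul] at h1
      set i := det (Lattice₂.equiv p) X with hi
      have hi0 : i ≠ 0 := fun h => hp (by rw [det_comm, ← hi, h, neg_zero])
      set c := det Y (Lattice₂.equiv p)
      have hz : ∀ j : ℤ, 0 < j → (-j) • x ∉ C := fun j hj hjC => by
        obtain ⟨t, rfl⟩ := Int.eq_ofNat_of_zero_le hj.le
        have h3 : -((t : ℤ) • x) ∈ C := by rwa [neg_smul] at hjC
        have h4 : (t : ℤ) • x ∈ C := by rw [natCast_zsmul]; exact nsmul_mem hx t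
        have h5 := AddGroupConeClass.eq_zero_of_mem_of_neg_mem h4 h3
        have h6 : (t : ℤ) • X = 0 := by rw [hX, ← map_zsmul, h5, map_zero]
        rcases smul_eq_zero.1 h6 with h7 | h7
        · omega
        · exact hX0 h7
      -- If `y` is parallel to `x`, a positive multiple of `y` is a multiple of `x`, which some
      -- multiple of `x` exceeds.
      have hfalse : ∀ i c : ℤ, 0 < i → i • y = c • x → False := fun i c hi hic => by
        obtain ⟨t, rfl⟩ := Int.eq_ofNat_of_zero_le hi.le
        have h2 : t • (y - (|c| + 1) • x) ∈ C := nsmul_mem (hgt' _) t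
        rw [← natCast_zsmul, smul_sub, hic, ← mul_smul, ← sub_smul] at h2
        refine hz (t * (|c| + 1) - c) ?_ (by rwa [neg_sub])
        nlinarith [le_abs_self c, abs_nonneg c]
      rcases lt_or_gt_of_ne hi0 with h0 | h0
      · refine hfalse (-i) c (by omega) ?_
        rw [neg_smul, neg_eq_iff_add_eq_zero, ← h1]
      · refine hfalse i (-c) h0 ?_
        rw [neg_smul, eq_neg_iff_add_eq_zero, ← h1]
    · rcases lt_or_gt_of_ne hYX with hneg | hpos
      · refine hno ⟨-X, neg_ne_zero.2 hX0, isHalfPlaneBounded_of_forall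
          (P := fun μ => Lattice₂.equiv.symm μ ∈ C) (fun α hα l hl => hdimC _ hα l (by simpa using hl))
          hbot fun μ hμ => ?_⟩
        have h1 := hid (Lattice₂.equiv.symm μ)
        rw [AddEquiv.apply_symm_apply] at h1
        rw [det_neg_right] at hμ
        refine key (-det Y X) (-det μ X) (-det Y μ) _ (by omega) hμ ?_
        simp only [neg_smul, h1]; abel
      · refine hno ⟨X, hX0, isHalfPlaneBounded_of_forall
          (P := fun μ => Lattice₂.equiv.symm μ ∈ C) (fun α hα l hl => hdimC _ hα l (by simpa using hl))
          hbot fun μ hμ => ?_⟩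
        have h1 := hid (Lattice₂.equiv.symm μ)
        rw [AddEquiv.apply_symm_apply] at h1
        exact key _ _ _ _ hpos hμ h1
  -- Along this order the dimension is antitone, vanishes somewhere and is nonzero somewhere.
  obtain ⟨ν', n', ε', hn1, hn2, hε1, hε2, hdet, hν, hν2, hνn⟩ := exists_interval_of_cone C htot' harch
    (d := fun α => Module.finrank ℂ (𝒱 (Lattice₂.equiv α)))
    (fun a c hac => by
      rcases hac with hac | hac
      · rw [sub_eq_zero.1 hac]
      · have := finrank_le_sub hG hfin (Lattice₂.equiv c) hac
        rwa [← map_sub, sub_sub_cancel] at this)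
    (by
      obtain ⟨l, hl⟩ := hbot
      exact ⟨Lattice₂.equiv.symm l, (finrank_eq_zero_iff hfin _).2 (by simpa using hl)⟩)
    (by
      obtain ⟨l, hl⟩ := hne
      exact ⟨Lattice₂.equiv.symm l, fun h0 => hl (by
        simpa using (finrank_eq_zero_iff hfin _).1 h0)⟩)
  have hnC : n' ∈ C := by simpa using add_mem hn1 hε1
  have hnnC : n' + n' ∈ C := add_mem hnC hnC
  have hi1 := ((memC _).1 hn1).resolve_left hn2
  rw [map_sub] at hi1
  rw [map_sub, map_add] at hν2
  rw [map_add, map_sub] at hνn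
  have hε := hdimC _ hε1
  have hi2 : InjNeg V (Lattice₂.equiv n' + Lattice₂.equiv n') := by
    rcases (memC _).1 hnnC with h0 | h0
    · have h0' : Lattice₂.equiv n' + Lattice₂.equiv n' = 0 := by rw [← map_add, h0, map_zero]
      have : Lattice₂.equiv n' = 0 := by
        rw [← two_nsmul] at h0'
        exact (smul_eq_zero.1 h0').resolve_left two_ne_zero
      rw [this] at hdet
      exact absurd (det_zero_left _) hdet
    · rwa [map_add] at h0
  rw [Ne, finrank_eq_zero_iff hfin] at hν
  rw [finrank_eq_zero_iff hfin] at hνn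
  generalize Lattice₂.equiv n' = n at *
  generalize Lattice₂.equiv ε' = ε at *
  generalize Lattice₂.equiv ν' = ν at *
  have hbot1 : 𝒱 (ν + n) = ⊥ := hε _ (by rwa [add_sub_assoc])
  -- It suffices to annihilate `𝒱 (ν - ε)`. For `w` there, `D(n) w` lies in the zero space of degree
  -- `ν + (n - ε)`. Moreover `D(-(2n - ε)) w` lies in `𝒱 (ν - 2n)`, which equals `D(-2n) 𝒱 ν` by
  -- equality of dimensions; `D(n)` kills it, since it commutes with `D(-2n)` and `𝒱 (ν + n) = 0`.
  refine hν (hε _ ?_)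
  rw [Submodule.eq_bot_iff]
  intro w hw
  have hn0 : n + -(n + n) ≠ 0 := fun h0 => by
    have : n = 0 := by simpa using h0
    rw [this] at hdet
    exact hdet (det_zero_left _)
  refine eq_zero_of_lie_eq_zero (n := n) (k := n + n - ε) ?_ ?_ ?_ ?_
  · rw [det_sub_right, det_add_right, det_self, add_zero, zero_sub]; exact neg_ne_zero.2 hdet
  · rwa [show n + n - ε - n = n - ε by abel]
  · have h1 := hG.lie_mem n _ w hw
    rw [show n + (ν - ε) = ν + (n - ε) by abel, hνn] at h1
    exact (Submodule.mem_bot ℂ).1 h1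
  · have h1 := hG.lie_mem (-(n + n - ε)) _ w hw
    rw [show -(n + n - ε) + (ν - ε) = ν - (n + n) by abel] at h1
    obtain ⟨v, hv, hvw⟩ := exists_lie_neg_eq hG hfin hi2 hν2.symm h1
    rw [← hvw, D_lie_D_lie_of_ne hn0]
    have h2 := hG.lie_mem n _ v hv
    rw [add_comm, hbot1] at h2
    rw [(Submodule.mem_bot ℂ).1 h2, lie_zero, zero_add, det_neg_right, det_add_right, det_self]
    simp

/-- An irreducible quasi-finite generalized highest weight module has a top layer. -/
theorem exists_top_layer (hG : IsGradedModule V 𝒱) (hV : IsGradedIrreducible V 𝒱)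
    (hfin : IsQuasiFinite V 𝒱) (hnt : ¬ LieModule.IsTrivial VirasoroLike V)
    (hghw : IsGeneralizedHighestWeight V 𝒱) : ∃ (b : Module.Basis (Fin 2) ℤ (ℤ × ℤ)) (γ₀ : ℤ × ℤ),
      𝒱 γ₀ ≠ ⊥ ∧ ∀ γ, b.repr γ₀ 0 < b.repr γ 0 → 𝒱 γ = ⊥ := by
  obtain ⟨b', n, v, hv, hv0, hkill⟩ := hghw
  have hk := eventuallyKilled_all hG hV (isOpenCone_quadrant b') hv hv0 (by
    obtain ⟨q, hq⟩ := (isOpenCone_quadrant b').nonempty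
    refine ⟨q, hq, fun m hm => ?_⟩
    obtain ⟨h0, h1⟩ := (isOpenCone_quadrant b').add_mem _ hq _ hm
    obtain ⟨k, hk⟩ := Int.eq_ofNat_of_zero_le h0.le
    obtain ⟨l, hl⟩ := Int.eq_ofNat_of_zero_le h1.le
    have := hkill k l
    rwa [← hk, ← hl, repr_smul_add] at this)
  obtain ⟨α, hα, x0, hx0⟩ := exists_isHalfPlaneBounded hG hV hfin hnt hk
  -- Completing the primitive direction to a basis turns `det γ β` into the first coordinate, which
  -- is an integer bounded above on the support and so attains its maximum.
  obtain ⟨β, g, hg, rfl, hβ⟩ := exists_primitive hα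
  obtain ⟨b, rfl, hb⟩ := exists_basis_of_isCoprime hβ
  refine ⟨b, ?_⟩
  obtain ⟨l, hl⟩ := exists_ne_bot hG hV
  have hbdd : ∀ z, (∃ γ, 𝒱 γ ≠ ⊥ ∧ b.repr γ 0 = z) → z ≤ |x0| := by
    rintro z ⟨γ, hγ, rfl⟩
    by_contra! hc
    refine hγ (hx0 γ ?_)
    rw [det_zsmul_right, ← hb]
    nlinarith [le_abs_self x0, abs_nonneg x0]
  obtain ⟨z, ⟨γ, hγ, rfl⟩, hz⟩ := Int.exists_greatest_of_bdd ⟨_, hbdd⟩ ⟨_, l, hl, rfl⟩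
  refine ⟨γ, hγ, fun γ' hγ' => ?_⟩
  by_contra hc
  exact absurd (hz _ ⟨γ', hc, rfl⟩) (not_le.2 hγ')

end HalfPlane

/-! ### Layers of graded modules -/

section Layers

variable {ι : Type*} [DecidableEq ι] [AddCommGroup ι] {φ : ℤ × ℤ →+ ι}
  {M : Type*} [AddCommGroup M] [Module ℂ M] [LieRingModule VirasoroLike M]
  [LieModule ℂ VirasoroLike M] {𝒢 : ι → Submodule ℂ M}

/-- The sum of the homogeneous subspaces with index of degree less than `n`. -/
def lowPart (hI : DirectSum.IsInternal 𝒢) (d : ι →+ ℤ) (n : ℤ) : Submodule ℂ M :=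
  ⨅ i, ⨅ (_ : n ≤ d i), LinearMap.ker (gproj hI i)

/-- The sum of the homogeneous subspaces with index of degree `n`. -/
def layer (hI : DirectSum.IsInternal 𝒢) (d : ι →+ ℤ) (n : ℤ) : Submodule ℂ M :=
  ⨅ i, ⨅ (_ : d i ≠ n), LinearMap.ker (gproj hI i)

theorem mem_lowPart {hI : DirectSum.IsInternal 𝒢} {d : ι →+ ℤ} {n : ℤ} {x : M} :
    x ∈ lowPart hI d n ↔ ∀ i, n ≤ d i → gproj hI i x = 0 := by
  simp only [lowPart, Submodule.mem_iInf, LinearMap.mem_ker]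

theorem mem_layer {hI : DirectSum.IsInternal 𝒢} {d : ι →+ ℤ} {n : ℤ} {x : M} :
    x ∈ layer hI d n ↔ ∀ i, d i ≠ n → gproj hI i x = 0 := by
  simp only [layer, Submodule.mem_iInf, LinearMap.mem_ker]

theorem mem_layer_of_mem (hI : DirectSum.IsInternal 𝒢) {d : ι →+ ℤ} {i : ι} {x : M}
    (hx : x ∈ 𝒢 i) : x ∈ layer hI d (d i) :=
  mem_layer.2 fun j hj => gproj_of_mem_ne hI (by rintro rfl; exact hj rfl) hx

theorem eq_zero_of_mem_layer_of_mem_lowPart {hI : DirectSum.IsInternal 𝒢} {d : ι →+ ℤ} {n : ℤ}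
    {x : M} (h1 : x ∈ layer hI d n) (h2 : x ∈ lowPart hI d n) : x = 0 := by
  refine eq_zero_of_gproj hI fun i => ?_
  by_cases hi : d i = n
  · exact mem_lowPart.1 h2 i hi.ge
  · exact mem_layer.1 h1 i hi

theorem IsGradedBy.lie_mem_lowPart (hG : IsGradedBy φ 𝒢) {d : ι →+ ℤ} {n n' : ℤ} {m : ℤ × ℤ}
    (hm : d (φ m) + n ≤ n') {x : M} (hx : x ∈ lowPart hG.isInternal d n) :
    ⁅D m, x⁆ ∈ lowPart hG.isInternal d n' := by
  rw [mem_lowPart] at hx ⊢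
  intro i hi
  rw [hG.gproj_lie', hx _ (by rw [map_sub]; omega), lie_zero]

theorem IsGradedBy.lie_mem_layer (hG : IsGradedBy φ 𝒢) {d : ι →+ ℤ} {n n' : ℤ} {m : ℤ × ℤ}
    (hm : d (φ m) + n = n') {x : M} (hx : x ∈ layer hG.isInternal d n) :
    ⁅D m, x⁆ ∈ layer hG.isInternal d n' := by
  rw [mem_layer] at hx ⊢
  intro i hi
  rw [hG.gproj_lie', hx _ (by rw [map_sub]; omega), lie_zero]

theorem layer_le_lowPart {hI : DirectSum.IsInternal 𝒢} {d : ι →+ ℤ} {n n' : ℤ} (h : n < n') :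
    layer hI d n ≤ lowPart hI d n' := fun x hx => by
  rw [mem_layer] at hx
  rw [mem_lowPart]
  exact fun i hi => hx i (by omega)

theorem IsGradedBy.h_lie_mem_layer (hG : IsGradedBy φ 𝒢) {d : ι →+ ℤ} {n : ℤ} (m : ℤ × ℤ)
    {x : M} (hx : x ∈ layer hG.isInternal d n) : ⁅h m, x⁆ ∈ layer hG.isInternal d n := by
  rw [h_lie_eq]
  refine sub_mem (hG.lie_mem_layer (n := d (φ (-m)) + n) ?_ (hG.lie_mem_layer rfl hx))
    (hG.lie_mem_layer (n := d (φ m) + n) ?_ (hG.lie_mem_layer rfl hx)) <;>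
  · rw [map_neg, map_neg]; ring

/-- A submodule generated by a subspace of the layer `n` that is stable under the `D(m)` and `h(m)`
of degree `0` and killed by those of positive degree is contained in the sum of this subspace and
the lower layers. -/
theorem IsGradedBy.lieSpan_le (hG : IsGradedBy φ 𝒢) {d : ι →+ ℤ} {n : ℤ} {T : Submodule ℂ M}
    (hT : T ≤ layer hG.isInternal d n)
    (h0 : ∀ m, d (φ m) = 0 → ∀ v ∈ T, ⁅D m, v⁆ ∈ T)
    (hpos : ∀ m, 0 < d (φ m) → ∀ v ∈ T, ⁅D m, v⁆ = 0)
    (hh : ∀ m, ∀ v ∈ T, ⁅h m, v⁆ ∈ T) :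
    (LieSubmodule.lieSpan ℂ VirasoroLike (T : Set M) : Submodule ℂ M) ≤
      T ⊔ lowPart hG.isInternal d n := by
  refine lieSpan_le_of_triangular (d.comp φ) h0 hpos hh fun m hm v hv => ?_
  obtain ⟨t, ht, x, hx, rfl⟩ := Submodule.mem_sup.1 hv
  rw [AddMonoidHom.comp_apply] at hm
  rw [lie_add]
  refine add_mem ?_ (hG.lie_mem_lowPart (by omega) hx)
  exact layer_le_lowPart (by omega) (hG.lie_mem_layer rfl (hT ht))

/-- A stable top space `T` is recovered from the submodule it generates, because the rest of that
submodule lies strictly lower. -/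
theorem IsGradedBy.mem_of_mem_lieSpan (hG : IsGradedBy φ 𝒢) {d : ι →+ ℤ} {n : ℤ}
    {T : Submodule ℂ M} (hT : T ≤ layer hG.isInternal d n)
    (h0 : ∀ m, d (φ m) = 0 → ∀ v ∈ T, ⁅D m, v⁆ ∈ T)
    (hpos : ∀ m, 0 < d (φ m) → ∀ v ∈ T, ⁅D m, v⁆ = 0)
    (hh : ∀ m, ∀ v ∈ T, ⁅h m, v⁆ ∈ T) {x : M} (hx : x ∈ layer hG.isInternal d n)
    (hx' : x ∈ LieSubmodule.lieSpan ℂ VirasoroLike (T : Set M)) : x ∈ T := by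
  obtain ⟨t, ht, y, hy, rfl⟩ := Submodule.mem_sup.1 (hG.lieSpan_le hT h0 hpos hh hx')
  have : y = 0 := eq_zero_of_mem_layer_of_mem_lowPart (by
    simpa using sub_mem hx (hT ht)) hy
  rwa [this, add_zero]

/-- In an irreducible graded module, homogeneous vectors below the top layer that are killed by the
`D(m)` of positive degree vanish. -/
theorem IsGradedBy.eq_zero_of_killed (hG : IsGradedBy φ 𝒢)
    (hirr : ∀ N : LieSubmodule ℂ VirasoroLike M, IsGradedSubspace 𝒢 (N : Submodule ℂ M) →
      N = ⊥ ∨ N = ⊤) {d : ι →+ ℤ} {i j : ι} (hij : d i < d j) (hj : 𝒢 j ≠ ⊥) {w : M}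
    (hw : w ∈ 𝒢 i) (hk : ∀ m, 0 < d (φ m) → ⁅D m, w⁆ = 0) : w = 0 := by
  by_contra hw0
  let K : Submodule ℂ M := ⨅ m, ⨅ (_ : 0 < d (φ m)), LinearMap.ker (act (D m))
  have memK : ∀ x, x ∈ K ↔ ∀ m, 0 < d (φ m) → ⁅D m, x⁆ = 0 := fun x => by
    simp only [K, Submodule.mem_iInf, LinearMap.mem_ker]; rfl
  -- `T` is stable under the operators of degree `0` and killed by the positive ones, so it
  -- generates nothing above its own layer; yet it contains `w`, which generates everything,
  -- including degree `j`.
  let T : Submodule ℂ M := layer hG.isInternal d (d i) ⊓ K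
  have hwT : w ∈ T := ⟨mem_layer_of_mem _ hw, (memK w).2 hk⟩
  have htop : LieSubmodule.lieSpan ℂ VirasoroLike {w} = ⊤ := by
    refine (hirr _ (hG.isGradedSubspace_lieSpan_of_homogeneous ?_)).resolve_left ?_
    · rintro t rfl; exact ⟨i, hw⟩
    · intro hbot
      rw [LieSubmodule.lieSpan_eq_bot_iff] at hbot
      exact hw0 (hbot w rfl)
  have hle := hG.lieSpan_le (d := d) (n := d i) (T := T) inf_le_left
    (fun m hm v hv => by
      refine ⟨hG.lie_mem_layer (by omega) hv.1, (memK _).2 fun n hn => ?_⟩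
      have hmn : n + m ≠ 0 := fun h0 => by
        have := congrArg (fun x => d (φ x)) h0
        simp only [map_add, map_zero] at this
        omega
      rw [D_lie_D_lie_of_ne hmn, (memK v).1 hv.2 n hn, (memK v).1 hv.2 (n + m) (by
        rw [map_add, map_add]; omega), lie_zero, smul_zero, add_zero])
    (fun m hm v hv => (memK v).1 hv.2 m hm)
    (fun m v hv => ⟨hG.h_lie_mem_layer m hv.1, (memK _).2 fun n hn => by
      rw [← h_lie_lie, (memK v).1 hv.2 n hn, lie_zero]⟩)
  refine hj ((Submodule.eq_bot_iff _).2 fun x hx => ?_)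
  have hx' : x ∈ T ⊔ lowPart hG.isInternal d (d i) := by
    refine hle ?_
    have : (⊤ : LieSubmodule ℂ VirasoroLike M) ≤ LieSubmodule.lieSpan ℂ VirasoroLike T := by
      rw [← htop]
      exact LieSubmodule.lieSpan_mono (by rintro _ rfl; exact hwT)
    exact this (LieSubmodule.mem_top x)
  obtain ⟨t, ht, y, hy, rfl⟩ := Submodule.mem_sup.1 hx'
  refine eq_zero_of_mem_layer_of_mem_lowPart (mem_layer_of_mem hG.isInternal (d := d) hx) ?_
  refine add_mem (layer_le_lowPart hij ht.1) (mem_lowPart.2 fun k hk => mem_lowPart.1 hy k ?_)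
  omega

end Layers

/-! ### The top layer of an irreducible graded module -/

section TopLayer

variable {V : Type*} [AddCommGroup V] [Module ℂ V] [LieRingModule VirasoroLike V]
  [LieModule ℂ VirasoroLike V] {𝒱 : ℤ × ℤ → Submodule ℂ V}

/-- The `h(m)` act as scalars on an irreducible quasi-finite module. -/
theorem exists_central_character (hG : IsGradedModule V 𝒱) (hV : IsGradedIrreducible V 𝒱)
    (hfin : IsQuasiFinite V 𝒱) : ∃ χ : ℤ × ℤ → ℂ, ∀ m (v : V), ⁅h m, v⁆ = χ m • v := by
  have hG' := isGradedBy_id_iff.2 hG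
  obtain ⟨l, hl⟩ := exists_ne_bot hG hV
  have key : ∀ m, ∃ c : ℂ, ∀ v : V, ⁅h m, v⁆ = c • v := fun m => by
    have := hfin l
    have : Nontrivial (𝒱 l) := Submodule.nontrivial_iff_ne_bot.2 hl
    obtain ⟨c, hc⟩ := Module.End.exists_eigenvalue
      ((act (h m)).restrict (p := 𝒱 l) (q := 𝒱 l) fun v hv => hG'.h_lie_mem m hv)
    obtain ⟨⟨v, hv⟩, hvc, hv0⟩ := hc.exists_hasEigenvector
    rw [Module.End.mem_eigenspace_iff] at hvc
    have hvc' : ⁅h m, v⁆ = c • v := congrArg Subtype.val hvc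
    have hv0' : v ≠ 0 := fun h => hv0 (Subtype.ext h)
    refine ⟨c, fun w => ?_⟩
    let N : Submodule ℂ V := LinearMap.ker (act (h m) - c • LinearMap.id)
    have memN : ∀ w, w ∈ N ↔ ⁅h m, w⁆ = c • w := fun w => by
      simp only [N, LinearMap.mem_ker, LinearMap.sub_apply, LinearMap.smul_apply,
        LinearMap.id_apply, sub_eq_zero]; rfl
    have hN : ∀ n, ∀ w ∈ N, ⁅D n, w⁆ ∈ N := fun n w hw => by
      rw [memN] at hw ⊢
      rw [h_lie_lie, hw, lie_smul]
    have hle : LieSubmodule.lieSpan ℂ VirasoroLike {v} ≤ ofStable N hN := by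
      rw [LieSubmodule.lieSpan_le]
      rintro _ rfl
      exact (memN _).2 hvc'
    rw [lieSpan_singleton_eq_top hG hV hv hv0'] at hle
    exact (memN w).1 (hle (LieSubmodule.mem_top w))
  choose χ hχ using key
  exact ⟨χ, hχ⟩

variable {χ : ℤ × ℤ → ℂ} (b : Module.Basis (Fin 2) ℤ (ℤ × ℤ))

/-- Apart from the central term, the result depends on `q` and `j` only through `q + j`. This makes
relations in the layer below comparable after raising. -/
theorem raise_lower (hχ : ∀ m (v : V), ⁅h m, v⁆ = χ m • v) (q j : ℤ) {t : V}
    (ht : ⁅D (b 0 + q • b 1), t⁆ = 0) :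
    ⁅D (b 0 + q • b 1), ⁅D (-b 0 + j • b 1), t⁆⁆ =
      (-(det (b 0) (b 1) : ℂ) * ((q + j : ℤ) : ℂ)) • ⁅D ((q + j) • b 1), t⁆ +
        (if q + j = 0 then χ (b 0 + q • b 1) • t else 0) := by
  have e1 : b 0 + q • b 1 + (-b 0 + j • b 1) = (q + j) • b 1 := by rw [add_smul]; abel
  have e2 : det (b 0 + q • b 1) (-b 0 + j • b 1) = det (b 0) (b 1) * (q + j) := by
    simp only [det_add_left, det_add_right, det_neg_right, det_zsmul_left, det_zsmul_right,
      det_self]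
    rw [det_comm (b 1) (b 0)]; ring
  have e3 : (q + j) • b 1 = 0 ↔ q + j = 0 := by
    rw [smul_eq_zero]
    exact or_iff_left (b.ne_zero 1)
  rw [D_lie_D_lie, ht, lie_zero, zero_add, e1, e2]
  simp only [e3, hχ]
  push_cast
  rw [neg_mul]

theorem central_add (hχ : ∀ m (v : V), ⁅h m, v⁆ = χ m • v) [Nontrivial V] (m n : ℤ × ℤ) :
    χ (m + n) = χ m + χ n := by
  obtain ⟨v, hv⟩ := exists_ne (0 : V)
  have h1 := hχ (m + n) v
  rw [h_add, add_lie, hχ, hχ, ← add_smul] at h1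
  exact (smul_left_injective ℂ hv h1).symm

theorem central_zsmul (hχ : ∀ m (v : V), ⁅h m, v⁆ = χ m • v) [Nontrivial V] (k : ℤ) (m : ℤ × ℤ) :
    χ (k • m) = k * χ m := by
  obtain ⟨v, hv⟩ := exists_ne (0 : V)
  have h1 := hχ (k • m) v
  rw [h_zsmul, smul_lie, hχ, ← mul_smul] at h1
  exact (smul_left_injective ℂ hv h1).symm

variable {b} {γ₀ : ℤ × ℤ}

/-- The central element `h(b₂)` acts as zero. -/
theorem central_eq_zero (hG : IsGradedModule V 𝒱) (hfin : IsQuasiFinite V 𝒱)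
    (hχ : ∀ m (v : V), ⁅h m, v⁆ = χ m • v)
    (htop : ∀ γ, b.repr γ₀ 0 < b.repr γ 0 → 𝒱 γ = ⊥) {u : V} (hu : u ∈ 𝒱 γ₀) (hu0 : u ≠ 0) :
    χ (b 1) = 0 := by
  have : Nontrivial V := ⟨u, 0, hu0⟩
  by_contra hc
  -- `D((n + 1) b₂)` and `D(-(n + 1) b₂)` cannot both kill `u`, as their commutator acts by `(n + 1)
  -- χ(b₂) ≠ 0`. So infinitely many degrees of the top layer occur.
  have h1 : ∀ n : ℕ, ∃ i : ℤ, i.natAbs = n + 1 ∧ 𝒱 (γ₀ + i • b 1) ≠ ⊥ := fun n => by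
    by_contra! hcon
    have e1 := hcon (n + 1) (by omega)
    have e2 := hcon (-(n + 1)) (by omega)
    have e3 := h_lie_eq (((n : ℤ) + 1) • b 1) u
    have f1 := hG.lie_mem (((n : ℤ) + 1) • b 1) _ u hu
    have f2 := hG.lie_mem (-(((n : ℤ) + 1) • b 1)) _ u hu
    rw [add_comm, e1, Submodule.mem_bot] at f1
    rw [← neg_smul, add_comm, e2, Submodule.mem_bot] at f2
    rw [← neg_smul, f1, f2, lie_zero, lie_zero, sub_zero, hχ, central_zsmul hχ] at e3
    rcases smul_eq_zero.1 e3 with h0 | h0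
    · rcases mul_eq_zero.1 h0 with h2 | h2
      · have : (n : ℤ) + 1 = 0 := by exact_mod_cast h2
        omega
      · exact hc h2
    · exact hu0 h0
  choose i hi hne using h1
  have hinj : Function.Injective i := fun n m hnm => by
    have h1 := hi n
    have h2 := hi m
    rw [hnm] at h1
    omega
  have h2 : ∀ n, ∃ t ∈ 𝒱 (γ₀ + i n • b 1), t ≠ 0 := fun n => (Submodule.ne_bot_iff _).1 (hne n)
  choose t ht ht0 using h2
  have hkill : ∀ (n : ℕ) (q : ℤ), ⁅D (b 0 + q • b 1), t n⁆ = 0 := fun n q => by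
    have := hG.lie_mem (b 0 + q • b 1) _ _ (ht n)
    rw [htop _ (by simp [-zsmul_eq_mul, -smul_eq_mul])] at this
    exact (Submodule.mem_bot ℂ).1 this
  have := hfin (γ₀ - b 0)
  have := hfin (γ₀ - b 0 + b 1)
  -- Each top vector is lowered into two fixed neighbouring degrees. Infinitely many independent
  -- vectors in their finite dimensional product give the contradiction.
  let f : ℕ → 𝒱 (γ₀ - b 0) × 𝒱 (γ₀ - b 0 + b 1) := fun n =>
    (⟨⁅D (-b 0 + (-i n) • b 1), t n⁆, by
      have := hG.lie_mem (-b 0 + (-i n) • b 1) _ _ (ht n)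
      rwa [show -b 0 + (-i n) • b 1 + (γ₀ + i n • b 1) = γ₀ - b 0 by rw [neg_smul]; abel] at this⟩,
     ⟨⁅D (-b 0 + (1 - i n) • b 1), t n⁆, by
      have := hG.lie_mem (-b 0 + (1 - i n) • b 1) _ _ (ht n)
      rwa [show -b 0 + (1 - i n) • b 1 + (γ₀ + i n • b 1) = γ₀ - b 0 + b 1 by
        rw [sub_smul, one_smul]; abel] at this⟩)
  have hli : LinearIndependent ℂ f := by
    rw [linearIndependent_iff']
    intro s y hy n0 hn0
    have g1 : ∑ n ∈ s, y n • ⁅D (-b 0 + (-i n) • b 1), t n⁆ = 0 := by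
      have := congrArg (fun x => ((LinearMap.fst ℂ _ _ x : 𝒱 (γ₀ - b 0)) : V)) hy
      simpa [f] using this
    have g2 : ∑ n ∈ s, y n • ⁅D (-b 0 + (1 - i n) • b 1), t n⁆ = 0 := by
      have := congrArg (fun x => ((LinearMap.snd ℂ _ _ x : 𝒱 (γ₀ - b 0 + b 1)) : V)) hy
      simpa [f] using this
    -- Raising the two components by `i n0` and by `i n0 - 1` gives the same total shift, so in the
    -- difference the `D(k b₂)` terms cancel. Only the central terms at `n0` survive, with
    -- difference `χ(b₂)`.
    have g1' := congrArg (act (D (b 0 + i n0 • b 1))) g1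
    have g2' := congrArg (act (D (b 0 + (i n0 - 1) • b 1))) g2
    rw [map_sum, LinearMap.map_zero] at g1' g2'
    have g3 := sub_eq_zero.2 (g1'.trans g2'.symm)
    rw [← Finset.sum_sub_distrib, Finset.sum_eq_single n0] at g3
    · simp only [map_smul, LieModule.toEnd_apply_apply] at g3
      rw [raise_lower b hχ _ _ (hkill _ _), raise_lower b hχ _ _ (hkill _ _),
        show i n0 - 1 + (1 - i n0) = 0 by ring, add_neg_cancel, if_pos rfl, if_pos rfl,
        central_add hχ, central_add hχ, central_zsmul hχ, central_zsmul hχ, ← smul_sub,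
        add_sub_add_left_eq_sub, ← sub_smul] at g3
      rcases smul_eq_zero.1 g3 with h0 | h0
      · exact h0
      · rcases smul_eq_zero.1 h0 with h3 | h3
        · refine absurd ?_ hc
          push_cast at h3
          linear_combination h3
        · exact absurd h3 (ht0 n0)
    · intro n _ hn
      have hne : i n0 - i n ≠ 0 := sub_ne_zero.2 fun h => hn (hinj h).symm
      simp only [map_smul, LieModule.toEnd_apply_apply]
      rw [raise_lower b hχ _ _ (hkill _ _), raise_lower b hχ _ _ (hkill _ _),
        show i n0 - 1 + (1 - i n) = i n0 - i n by ring, ← sub_eq_add_neg, if_neg hne, if_neg hne, sub_self]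
    · exact fun h => absurd hn0 h
  have := hli.finite
  exact not_finite ℕ

end TopLayer

/-! ### The commutative action of the `D(k b₂)` on the top layer. -/

section TopLayer

variable {V : Type*} [AddCommGroup V] [Module ℂ V] [LieRingModule VirasoroLike V]
  [LieModule ℂ VirasoroLike V]

/-- The data of an irreducible graded module with top layer `⨁ 𝒱 (γ₀ + k b₂)`, on which the `h(m)`
act as the scalars `χ m`, with `χ b₂ = 0`. -/
structure HasTopLayer (𝒱 : ℤ × ℤ → Submodule ℂ V) (b : Module.Basis (Fin 2) ℤ (ℤ × ℤ))
    (γ₀ : ℤ × ℤ) (χ : ℤ × ℤ → ℂ) : Prop where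
  graded : IsGradedModule V 𝒱
  irreducible : IsGradedIrreducible V 𝒱
  central : ∀ m (v : V), ⁅h m, v⁆ = χ m • v
  top : ∀ γ, b.repr γ₀ 0 < b.repr γ 0 → 𝒱 γ = ⊥
  level : χ (b 1) = 0

/-- The product of the operators `D(k b₂)` for `k` in a list. -/
def heis (b : Module.Basis (Fin 2) ℤ (ℤ × ℤ)) : List ℤ → V →ₗ[ℂ] V
  | [] => LinearMap.id
  | k :: l => act (D (k • b 1)) ∘ₗ heis b l

variable {𝒱 : ℤ × ℤ → Submodule ℂ V} {b : Module.Basis (Fin 2) ℤ (ℤ × ℤ)} {γ₀ : ℤ × ℤ}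
  {χ : ℤ × ℤ → ℂ}

@[simp] theorem heis_nil (v : V) : heis b [] v = v := rfl

@[simp] theorem heis_cons (k : ℤ) (l : List ℤ) (v : V) :
    heis b (k :: l) v = ⁅D (k • b 1), heis b l v⁆ := rfl

theorem heis_append (l l' : List ℤ) (v : V) : heis b (l ++ l') v = heis b l (heis b l' v) := by
  induction l with
  | nil => rfl
  | cons k l ih => simp [ih]

theorem heis_mem (hG : IsGradedModule V 𝒱) (l : List ℤ) {γ : ℤ × ℤ} {v : V} (hv : v ∈ 𝒱 γ) :
    heis b l v ∈ 𝒱 (γ + l.sum • b 1) := by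
  induction l with
  | nil => simpa using hv
  | cons k l ih =>
    have := hG.lie_mem (k • b 1) _ _ ih
    rwa [show k • b 1 + (γ + l.sum • b 1) = γ + (k :: l).sum • b 1 by
      rw [List.sum_cons, add_smul]; abel] at this

variable (H : HasTopLayer 𝒱 b γ₀ χ)
include H

theorem HasTopLayer.nontrivial : Nontrivial V := H.irreducible.nontrivial

theorem HasTopLayer.D_comm (j k : ℤ) (v : V) :
    ⁅D (j • b 1), ⁅D (k • b 1), v⁆⁆ = ⁅D (k • b 1), ⁅D (j • b 1), v⁆⁆ := by
  have := H.nontrivial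
  rw [D_lie_D_lie, H.central, central_zsmul H.central, H.level, det_zsmul_left, det_zsmul_right,
    det_self]
  simp

theorem HasTopLayer.D_heis (j : ℤ) (l : List ℤ) (v : V) :
    ⁅D (j • b 1), heis b l v⁆ = heis b l ⁅D (j • b 1), v⁆ := by
  induction l with
  | nil => rfl
  | cons k l ih => rw [heis_cons, H.D_comm, ih, heis_cons]

theorem HasTopLayer.heis_comm (l l' : List ℤ) (v : V) :
    heis b l (heis b l' v) = heis b l' (heis b l v) := by
  induction l with
  | nil => rfl
  | cons k l ih => rw [heis_cons, ih, H.D_heis, heis_cons]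

/-- The top layer is generated by each of its nonzero homogeneous vectors under the `D(k b₂)`. -/
theorem HasTopLayer.mem_span_heis {γ : ℤ × ℤ} (hγ : b.repr γ 0 = b.repr γ₀ 0) {t : V}
    (ht : t ∈ 𝒱 γ) (ht0 : t ≠ 0) {k : ℤ} {v : V} (hv : v ∈ 𝒱 (γ + k • b 1)) :
    v ∈ Submodule.span ℂ {w | ∃ l : List ℤ, l.sum = k ∧ w = heis b l t} := by
  have hG' := isGradedBy_id_iff.2 H.graded
  let T : Submodule ℂ V := Submodule.span ℂ (Set.range fun l : List ℤ => heis b l t)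
  have hlay : ∀ j : ℤ, ∀ x ∈ 𝒱 (γ + j • b 1),
      x ∈ layer hG'.isInternal (coord₁ b) (b.repr γ₀ 0) := fun j x hx => by
    have := mem_layer_of_mem hG'.isInternal (d := coord₁ b) hx
    simpa [hγ, -zsmul_eq_mul, -smul_eq_mul] using this
  have hT : T ≤ layer hG'.isInternal (coord₁ b) (b.repr γ₀ 0) := by
    refine Submodule.span_le.2 ?_
    rintro _ ⟨l, rfl⟩
    exact hlay _ _ (heis_mem H.graded l ht)
  have h0 : ∀ m, coord₁ b (AddMonoidHom.id _ m) = 0 → ∀ w ∈ T, ⁅D m, w⁆ ∈ T := fun m hm w hw => by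
    have hm' : b.repr m 0 = 0 := hm
    have e : m = b.repr m 1 • b 1 := by
      conv_lhs => rw [← repr_smul_add b m, hm', zero_smul, zero_add]
    have : T ≤ T.comap (act (D m)) := by
      refine Submodule.span_le.2 ?_
      rintro _ ⟨l, rfl⟩
      rw [e]
      exact Submodule.subset_span ⟨b.repr m 1 :: l, rfl⟩
    exact this hw
  have hpos : ∀ m, 0 < coord₁ b (AddMonoidHom.id _ m) → ∀ w ∈ T, ⁅D m, w⁆ = 0 :=
    fun m hm w hw => by
      have hm' : 0 < b.repr m 0 := hm
      have : T ≤ LinearMap.ker (act (D m)) := by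
        refine Submodule.span_le.2 ?_
        rintro _ ⟨l, rfl⟩
        have := H.graded.lie_mem m _ _ (heis_mem (b := b) H.graded l ht)
        rw [H.top _ (by
          simp only [repr_add, repr_zsmul, hγ]
          simp [hm', -zsmul_eq_mul, -smul_eq_mul]), Submodule.mem_bot] at this
        exact this
      exact this hw
  have hx := hG'.mem_of_mem_lieSpan hT h0 hpos
    (fun m w hw => by rw [H.central]; exact T.smul_mem _ hw) (hlay k v hv) (by
      have : (⊤ : LieSubmodule ℂ VirasoroLike V) ≤ LieSubmodule.lieSpan ℂ VirasoroLike T := by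
        rw [← lieSpan_singleton_eq_top H.graded H.irreducible ht ht0]
        refine LieSubmodule.lieSpan_mono ?_
        rintro _ rfl
        exact Submodule.subset_span ⟨[], rfl⟩
      exact this (LieSubmodule.mem_top v))
  -- Projecting to the degree of `v` discards the products whose total shift is not `k`.
  rw [← gproj_of_mem hG'.isInternal hv]
  have : T ≤ (Submodule.span ℂ {w | ∃ l : List ℤ, l.sum = k ∧ w = heis b l t}).comap
      (gproj hG'.isInternal (γ + k • b 1)) := by
    refine Submodule.span_le.2 ?_
    rintro _ ⟨l, rfl⟩
    rw [SetLike.mem_coe, Submodule.mem_comap]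
    by_cases hl : l.sum = k
    · subst hl
      rw [gproj_of_mem _ (heis_mem H.graded l ht)]
      exact Submodule.subset_span ⟨l, rfl, rfl⟩
    · rw [gproj_of_mem_ne hG'.isInternal (fun h => hl ?_) (heis_mem H.graded l ht)]
      · exact zero_mem _
      · have := add_left_cancel h
        exact smul_left_injective ℤ (b.ne_zero 1) this
  exact this hx

theorem HasTopLayer.repr_eq (k : ℤ) : b.repr (γ₀ + k • b 1) 0 = b.repr γ₀ 0 := by
  simp [-zsmul_eq_mul, -smul_eq_mul]

theorem HasTopLayer.mem_span_heis' {j : ℤ} {t : V} (ht : t ∈ 𝒱 (γ₀ + j • b 1)) (ht0 : t ≠ 0)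
    {k : ℤ} {v : V} (hv : v ∈ 𝒱 (γ₀ + k • b 1)) :
    v ∈ Submodule.span ℂ {w | ∃ l : List ℤ, l.sum = k - j ∧ w = heis b l t} :=
  H.mem_span_heis (H.repr_eq j) ht ht0 (by
    rwa [show γ₀ + j • b 1 + (k - j) • b 1 = γ₀ + k • b 1 by rw [sub_smul]; abel])

/-- A scalar relation that holds at a nonzero homogeneous vector of the top layer holds on the whole
top layer. -/
theorem HasTopLayer.heis_eq_smul {j : ℤ} {t : V} (ht : t ∈ 𝒱 (γ₀ + j • b 1)) (ht0 : t ≠ 0)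
    {l : List ℤ} {c : ℂ} (hl : heis b l t = c • t) {k : ℤ} {v : V} (hv : v ∈ 𝒱 (γ₀ + k • b 1)) :
    heis b l v = c • v := by
  have : Submodule.span ℂ {w | ∃ l : List ℤ, l.sum = k - j ∧ w = heis b l t} ≤
      LinearMap.ker (heis b l - c • LinearMap.id) := by
    refine Submodule.span_le.2 ?_
    rintro _ ⟨l', -, rfl⟩
    rw [SetLike.mem_coe, LinearMap.mem_ker, LinearMap.sub_apply, LinearMap.smul_apply,
      LinearMap.id_apply, H.heis_comm, hl, map_smul, sub_self]
  have := this (H.mem_span_heis' ht ht0 hv)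
  rwa [LinearMap.mem_ker, LinearMap.sub_apply, LinearMap.smul_apply, LinearMap.id_apply,
    sub_eq_zero] at this

theorem HasTopLayer.heis_eq_zero {j : ℤ} {t : V} (ht : t ∈ 𝒱 (γ₀ + j • b 1)) (ht0 : t ≠ 0)
    {l : List ℤ} (hl : heis b l t = 0) {k : ℤ} {v : V} (hv : v ∈ 𝒱 (γ₀ + k • b 1)) :
    heis b l v = 0 := by
  simpa using H.heis_eq_smul (c := 0) ht ht0 (by simpa using hl) hv

/-- A product of total shift `0` has an eigenvector in a finite dimensional homogeneous subspace; it
commutes with the products that generate the top layer from this vector. -/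
theorem HasTopLayer.exists_scalar (hfin : IsQuasiFinite V 𝒱) {j : ℤ} {t : V}
    (ht : t ∈ 𝒱 (γ₀ + j • b 1)) (ht0 : t ≠ 0) {l : List ℤ} (hl : l.sum = 0) :
    ∃ c : ℂ, ∀ k : ℤ, ∀ v ∈ 𝒱 (γ₀ + k • b 1), heis b l v = c • v := by
  have := hfin (γ₀ + j • b 1)
  have : Nontrivial (𝒱 (γ₀ + j • b 1)) := ⟨⟨t, ht⟩, 0, fun h => ht0 (congrArg Subtype.val h)⟩
  obtain ⟨c, hc⟩ := Module.End.exists_eigenvalue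
    ((heis b l).restrict (p := 𝒱 (γ₀ + j • b 1)) (q := 𝒱 (γ₀ + j • b 1)) fun v hv => by
      have := heis_mem (b := b) H.graded l hv
      rwa [hl, zero_smul, add_zero] at this)
  obtain ⟨⟨v, hv⟩, hvc, hv0⟩ := hc.exists_hasEigenvector
  rw [Module.End.mem_eigenspace_iff] at hvc
  have hvc' : heis b l v = c • v := congrArg Subtype.val hvc
  have hv0' : v ≠ 0 := fun h => hv0 (Subtype.ext h)
  exact ⟨c, fun k w hw => H.heis_eq_smul hv hv0' hvc' hw⟩

/-- Homogeneous subspaces of the top layer are at most one-dimensional: vectors of equal degree are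
linked by products of total shift `0`, which are scalars. -/
theorem HasTopLayer.exists_eq_smul (hfin : IsQuasiFinite V 𝒱) {k : ℤ} {t : V}
    (ht : t ∈ 𝒱 (γ₀ + k • b 1)) (ht0 : t ≠ 0) {v : V} (hv : v ∈ 𝒱 (γ₀ + k • b 1)) :
    ∃ c : ℂ, v = c • t := by
  have : Submodule.span ℂ {w | ∃ l : List ℤ, l.sum = k - k ∧ w = heis b l t} ≤
      Submodule.span ℂ {t} := by
    refine Submodule.span_le.2 ?_
    rintro _ ⟨l, hl, rfl⟩
    rw [sub_self] at hl
    obtain ⟨c, hc⟩ := H.exists_scalar hfin ht ht0 hl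
    rw [hc k t ht]
    exact Submodule.smul_mem _ _ (Submodule.mem_span_singleton_self t)
  obtain ⟨c, hc⟩ := Submodule.mem_span_singleton.1 (this (H.mem_span_heis' ht ht0 hv))
  exact ⟨c, hc.symm⟩

/-- The top layer has a basis on which the `D(k b₂)` act as multiples of shifts. -/
theorem HasTopLayer.exists_shift_basis (hfin : IsQuasiFinite V 𝒱) {u : V} (hu : u ∈ 𝒱 γ₀)
    (hu0 : u ≠ 0) : ∃ (s : ℕ) (ψ : ℤ → ℂ) (t : ℤ → V), (∀ k, t k ∈ 𝒱 (γ₀ + k • b 1)) ∧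
      (∀ k, t k ≠ 0 ↔ (s : ℤ) ∣ k) ∧ (∀ j k, ⁅D (j • b 1), t k⁆ = ψ j • t (k + j)) ∧
      (∀ k, 𝒱 (γ₀ + k • b 1) ≤ Submodule.span ℂ {t k}) ∧ (∀ k, ψ k ≠ 0 → (s : ℤ) ∣ k) ∧
      ∀ k, (s : ℤ) ∣ k → k ∈ AddSubmonoid.closure {k | ψ k ≠ 0} := by
  classical
  have hu' : u ∈ 𝒱 (γ₀ + (0 : ℤ) • b 1) := by simpa using hu
  have hmem : ∀ l, heis b l u ∈ 𝒱 (γ₀ + l.sum • b 1) := fun l => heis_mem H.graded l hu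
  set G : Set ℤ := {k | ⁅D (k • b 1), u⁆ ≠ 0} with hGdef
  -- A product killing one nonzero homogeneous top vector kills the whole top layer, so products
  -- nonzero at `u` compose to a product nonzero at `u`. Hence the degrees that occur form the
  -- monoid generated by `G`.
  have hnz : ∀ l l', heis b l u ≠ 0 → heis b l' u ≠ 0 → heis b l (heis b l' u) ≠ 0 :=
    fun l l' h1 h2 h3 => h1 (H.heis_eq_zero (hmem l') h2 h3 hu')
  have h1 : ∀ k ∈ AddSubmonoid.closure G, ∃ l : List ℤ, l.sum = k ∧ heis b l u ≠ 0 := fun k hk => by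
    induction hk using AddSubmonoid.closure_induction with
    | mem k hk => exact ⟨[k], by simp, hk⟩
    | zero => exact ⟨[], rfl, hu0⟩
    | add j k _ _ hj hk =>
      obtain ⟨l, rfl, hl⟩ := hj
      obtain ⟨l', rfl, hl'⟩ := hk
      exact ⟨l ++ l', List.sum_append, by rw [heis_append]; exact hnz l l' hl hl'⟩
  have h2 : ∀ l : List ℤ, heis b l u ≠ 0 → l.sum ∈ AddSubmonoid.closure G := fun l => by
    induction l with
    | nil => exact fun _ => by simp
    | cons k l ih =>
      intro hl
      have hl' : heis b l u ≠ 0 := fun h => hl (by rw [heis_cons, h, lie_zero])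
      have hk : k ∈ G := fun h => hl (H.heis_eq_zero (l := [k]) hu' hu0 h (hmem l))
      rw [List.sum_cons]
      exact add_mem (AddSubmonoid.subset_closure hk) (ih hl')
  have hex : ∀ j : ℤ, ∀ t ∈ 𝒱 (γ₀ + j • b 1), t ≠ 0 → ∀ k, ∀ v ∈ 𝒱 (γ₀ + k • b 1), v ≠ 0 →
      ∃ l : List ℤ, l.sum = k - j ∧ heis b l t ≠ 0 := fun j t ht ht0 k v hv hv0 => by
    by_contra! hcon
    refine hv0 ?_
    have hle : Submodule.span ℂ {w | ∃ l : List ℤ, l.sum = k - j ∧ w = heis b l t} ≤ ⊥ := by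
      refine Submodule.span_le.2 ?_
      rintro _ ⟨l, hl, rfl⟩
      exact hcon l hl
    exact (Submodule.mem_bot ℂ).1 (hle (H.mem_span_heis' ht ht0 hv))
  have h3 : ∀ k : ℤ, ∀ v ∈ 𝒱 (γ₀ + k • b 1), v ≠ 0 → k ∈ AddSubmonoid.closure G :=
    fun k v hv hv0 => by
      obtain ⟨l, hl, hl0⟩ := hex 0 u hu' hu0 k v hv hv0
      rw [sub_zero] at hl
      exact hl ▸ h2 l hl0
  -- Irreducibility provides a way back from any nonzero top vector to the degree of `u`, so this
  -- monoid is a subgroup of `ℤ`, hence cyclic.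
  have h4 : ∀ k ∈ AddSubmonoid.closure G, -k ∈ AddSubmonoid.closure G := fun k hk => by
    obtain ⟨l, rfl, hl⟩ := h1 k hk
    obtain ⟨l', hl', hl0⟩ := hex _ _ (hmem l) hl 0 u hu' hu0
    rw [zero_sub] at hl'
    exact hl' ▸ h2 l' fun h => hl0 (H.heis_eq_zero hu' hu0 h (hmem l))
  let A : AddSubgroup ℤ := { AddSubmonoid.closure G with neg_mem' := fun {k} hk => h4 k hk }
  obtain ⟨a, ha⟩ := Int.subgroup_cyclic A
  have hA : ∀ k : ℤ, k ∈ AddSubmonoid.closure G ↔ ((a.natAbs : ℕ) : ℤ) ∣ k := fun k => by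
    rw [Int.natAbs_dvd]
    change k ∈ A ↔ _
    rw [ha, ← AddSubgroup.zmultiples_eq_closure, Int.mem_zmultiples_iff]
  generalize a.natAbs = s at hA
  obtain ⟨l₁, hl₁, hl₁0⟩ := h1 s ((hA s).2 dvd_rfl)
  obtain ⟨l₂, hl₂, hl₂0⟩ := hex _ _ (hmem l₁) hl₁0 0 u hu' hu0
  obtain ⟨c, hc⟩ := H.exists_eq_smul hfin hu' hu0 (v := heis b l₂ (heis b l₁ u)) (by
    have := heis_mem (b := b) H.graded l₂ (hmem l₁)
    rwa [hl₂, add_assoc, ← add_smul, show l₁.sum + (0 - l₁.sum) = 0 by ring] at this)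
  have hc0 : c ≠ 0 := fun h => hl₂0 (by rw [hc, h, zero_smul])
  -- `X` shifts the top layer by the period `s`, and `Y` is its inverse there, normalised by the
  -- scalar `c` by which the round trip acts.
  set X : Module.End ℂ V := heis b l₁ with hX
  set Y : Module.End ℂ V := c⁻¹ • heis b l₂ with hY
  have hYX : ∀ k : ℤ, ∀ v ∈ 𝒱 (γ₀ + k • b 1), Y (X v) = v := fun k v hv => by
    have := H.heis_eq_smul (l := l₂ ++ l₁) (c := c) hu' hu0 (by rw [heis_append, ← hc]) hv
    rw [heis_append] at this
    rw [hY, LinearMap.smul_apply, this, inv_smul_smul₀ hc0]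
  have hXY : ∀ k : ℤ, ∀ v ∈ 𝒱 (γ₀ + k • b 1), X (Y v) = v := fun k v hv => by
    refine Eq.trans ?_ (hYX k v hv)
    simp only [hX, hY, LinearMap.smul_apply, map_smul]
    rw [H.heis_comm]
  have hXm : ∀ k : ℤ, ∀ v ∈ 𝒱 (γ₀ + k • b 1), X v ∈ 𝒱 (γ₀ + (k + s) • b 1) := fun k v hv => by
    have := heis_mem (b := b) H.graded l₁ hv
    rwa [hl₁, add_assoc, ← add_smul] at this
  have hYm : ∀ k : ℤ, ∀ v ∈ 𝒱 (γ₀ + k • b 1), Y v ∈ 𝒱 (γ₀ + (k - s) • b 1) := fun k v hv => by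
    have := heis_mem (b := b) H.graded l₂ hv
    rw [hl₂, hl₁, add_assoc, ← add_smul, show k + (0 - (s : ℤ)) = k - s by ring] at this
    exact Submodule.smul_mem _ _ this
  let e : ℤ → V := fun p => Int.rec (fun n => (X ^ n) u) (fun n => (Y ^ (n + 1)) u) p
  have he0 : e 0 = u := rfl
  have heY : ∀ n : ℕ, (Y ^ n) u ∈ 𝒱 (γ₀ + (-(s * n) : ℤ) • b 1) := fun n => by
    induction n with
    | zero => simpa using hu
    | succ n ih =>
      rw [pow_succ', Module.End.mul_apply]
      have := hYm _ _ ih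
      rwa [show (-(s * n) - s : ℤ) = -(s * ((n + 1 : ℕ) : ℤ)) by push_cast; ring] at this
  have heX : ∀ n : ℕ, (X ^ n) u ∈ 𝒱 (γ₀ + (s * n : ℤ) • b 1) := fun n => by
    induction n with
    | zero => simpa using hu
    | succ n ih =>
      rw [pow_succ', Module.End.mul_apply]
      have := hXm _ _ ih
      rwa [show (s * n + s : ℤ) = s * ((n + 1 : ℕ) : ℤ) by push_cast; ring] at this
  have hem : ∀ p : ℤ, e p ∈ 𝒱 (γ₀ + (s * p) • b 1) := fun p => by
    cases p with
    | ofNat n => exact heX n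
    | negSucc n =>
      have := heY (n + 1)
      rwa [show (-(s * ((n + 1 : ℕ) : ℤ)) : ℤ) = s * Int.negSucc n by
        rw [Int.negSucc_eq]; push_cast; ring] at this
  have heS : ∀ p : ℤ, X (e p) = e (p + 1) := fun p => by
    cases p with
    | ofNat n =>
      change X ((X ^ n) u) = (X ^ (n + 1)) u
      rw [pow_succ', Module.End.mul_apply]
    | negSucc n =>
      change X ((Y ^ (n + 1)) u) = _
      rw [pow_succ', Module.End.mul_apply, hXY _ _ (heY n)]
      cases n with
      | zero => rfl
      | succ n => rfl
  have hen : ∀ p : ℤ, e p ≠ 0 := fun p => by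
    induction p using Int.induction_on with
    | zero => exact hu0
    | succ p ih =>
      rw [← heS]
      exact fun h => ih (by rw [← hYX _ _ (hem p), h, map_zero])
    | pred p ih =>
      intro h
      refine ih ?_
      have := heS (-(p : ℤ) - 1)
      rw [h, map_zero, sub_add_cancel] at this
      exact this.symm
  -- For `j ∉ G` the scalar is set to `0`, so the value of the integer division `j / s` does not
  -- matter when `s ∤ j`.
  have hψ : ∀ j : ℤ, ∃ z : ℂ, ⁅D (j • b 1), u⁆ = z • e (j / s) ∧ (z ≠ 0 ↔ j ∈ G) := fun j => by
    by_cases hj : j ∈ G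
    · have hd := (hA j).1 (AddSubmonoid.subset_closure hj)
      have hm := hem (j / s)
      rw [Int.mul_ediv_cancel' hd] at hm
      have hm' := H.graded.lie_mem (j • b 1) _ _ hu
      rw [add_comm] at hm'
      obtain ⟨z, hz⟩ := H.exists_eq_smul hfin hm (hen _) hm'
      exact ⟨z, hz, iff_of_true (fun h => hj (by rw [hz, h, zero_smul])) hj⟩
    · exact ⟨0, by rw [zero_smul]; exact not_not.1 hj, iff_of_false (fun h => h rfl) hj⟩
  choose ψ hψ1 hψ2 using hψ
  have hG : {k | ψ k ≠ 0} = G := Set.ext hψ2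
  have hψd : ∀ j, ψ j ≠ 0 → (s : ℤ) ∣ j := fun j hj =>
    (hA j).1 (AddSubmonoid.subset_closure ((hψ2 j).1 hj))
  -- Commuting with the invertible shift `X` carries the formula from `u` to all `e p`, in both
  -- directions.
  have hact : ∀ j p : ℤ, ⁅D (j • b 1), e p⁆ = ψ j • e (p + j / s) := fun j p => by
    have hcomm : ∀ v : V, ⁅D (j • b 1), X v⁆ = X ⁅D (j • b 1), v⁆ := fun v => H.D_heis j l₁ v
    induction p using Int.induction_on with
    | zero => rw [zero_add]; exact hψ1 j
    | succ p ih =>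
      rw [← heS, hcomm, ih, map_smul, heS]
      congr 2; ring
    | pred p ih =>
      have h5 := heS (-(p : ℤ) - 1)
      rw [sub_add_cancel] at h5
      have h6 := H.graded.lie_mem (j • b 1) _ _ (hem (-(p : ℤ) - 1))
      rw [show j • b 1 + (γ₀ + (s * (-(p : ℤ) - 1)) • b 1) =
        γ₀ + (j + s * (-(p : ℤ) - 1)) • b 1 by rw [add_smul]; abel] at h6
      rw [← hYX _ _ h6, ← hcomm, h5, ih,
        show -(p : ℤ) + j / s = (-(p : ℤ) - 1 + j / s) + 1 by ring, ← heS, map_smul, hYX _ _ (hem _)]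
  refine ⟨s, ψ, fun k => if (s : ℤ) ∣ k then e (k / s) else 0, fun k => ?_, fun k => ?_,
    fun j k => ?_, fun k v hv => ?_, hψd, fun k hk => by rw [hG]; exact (hA k).2 hk⟩
  · dsimp only
    split_ifs with hk
    · simpa only [Int.mul_ediv_cancel' hk] using hem (k / s)
    · exact zero_mem _
  · dsimp only
    split_ifs with hk
    · exact iff_of_true (hen _) hk
    · exact iff_of_false (fun h => h rfl) hk
  · dsimp only
    by_cases hj : ψ j = 0
    · rw [hj, zero_smul]
      split_ifs with hk
      · rw [hact, hj, zero_smul]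
      · rw [lie_zero]
    · have hd := hψd j hj
      by_cases hk : (s : ℤ) ∣ k
      · rw [if_pos hk, if_pos (dvd_add hk hd), hact, Int.add_ediv_of_dvd_left hk]
      · rw [if_neg hk, if_neg fun h => hk ((dvd_add_left hd).1 h), lie_zero, smul_zero]
  · by_cases hv0 : v = 0
    · rw [hv0]; exact zero_mem _
    · have hd := (hA k).1 (h3 k v hv hv0)
      have hm := hem (k / s)
      rw [Int.mul_ediv_cancel' hd] at hm
      obtain ⟨z, hz⟩ := H.exists_eq_smul hfin hm (hen _) hv
      dsimp only
      rw [if_pos hd, hz]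
      exact Submodule.smul_mem _ _ (Submodule.mem_span_singleton_self _)

end TopLayer

/-! ### Linear recurrences and exponential polynomials. -/

section Recurrence

open Polynomial

variable {M : Type*} [AddCommGroup M] [Module ℂ M]

/-- The shift operator on bi-infinite sequences. -/
def shift : Module.End ℂ (ℤ → M) := LinearMap.funLeft ℂ M (· + 1)

@[simp] theorem shift_apply (g : ℤ → M) (k : ℤ) : shift g k = g (k + 1) := rfl

theorem shift_pow_apply (n : ℕ) (g : ℤ → M) (k : ℤ) : (shift ^ n) g k = g (k + n) := by
  induction n generalizing k with
  | zero => simp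
  | succ n ih =>
    rw [pow_succ', Module.End.mul_apply, shift_apply, ih]
    congr 1; push_cast; ring

theorem aeval_shift_apply (P : ℂ[X]) (g : ℤ → M) (k : ℤ) :
    aeval shift P g k = ∑ i ∈ Finset.range (P.natDegree + 1), P.coeff i • g (k + i) := by
  rw [aeval_eq_sum_range, LinearMap.sum_apply, Finset.sum_apply]
  exact Finset.sum_congr rfl fun i _ => by
    rw [LinearMap.smul_apply, Pi.smul_apply, shift_pow_apply]

/-- The sequences annihilated by a nonzero polynomial in the shift. -/
def recurrent : Submodule ℂ (ℤ → M) where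
  carrier := {g | ∃ P : ℂ[X], P ≠ 0 ∧ aeval shift P g = 0}
  zero_mem' := ⟨1, one_ne_zero, map_zero _⟩
  add_mem' := by
    rintro f g ⟨P, hP, hf⟩ ⟨Q, hQ, hg⟩
    refine ⟨P * Q, mul_ne_zero hP hQ, ?_⟩
    rw [LinearMap.map_add, map_mul, Module.End.mul_apply _ _ g, hg, map_zero, add_zero,
      ← map_mul, mul_comm, map_mul, Module.End.mul_apply, hf, map_zero]
  smul_mem' := by
    rintro c f ⟨P, hP, hf⟩
    exact ⟨P, hP, by rw [map_smul, hf, smul_zero]⟩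

theorem mem_recurrent_of_sub {α : ℂ} {g : ℤ → M} (hg : shift g - α • g ∈ recurrent) :
    g ∈ recurrent := by
  obtain ⟨P, hP, h⟩ := hg
  refine ⟨P * (X - C α), mul_ne_zero hP (X_sub_C_ne_zero α), ?_⟩
  rw [map_mul, Module.End.mul_apply, map_sub, aeval_X, aeval_C, LinearMap.sub_apply,
    Module.algebraMap_end_apply, h]

/-- Exponential polynomials are recurrent. -/
theorem expPoly_mem_recurrent (p : ℂ[X]) {α : ℂ} (hα : α ≠ 0) :
    (fun k : ℤ => p.eval (k : ℂ) * α ^ k) ∈ recurrent := by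
  have hmon : ∀ n : ℕ, (fun k : ℤ => (k : ℂ) ^ n * α ^ k) ∈ recurrent := fun n => by
    induction n using Nat.strong_induction_on with
    | _ n ih =>
      refine mem_recurrent_of_sub (α := α) ?_
      -- Applying the shift minus `α` cancels the leading term of the binomial expansion and leaves
      -- lower powers of `k`.
      have : shift (fun k : ℤ => (k : ℂ) ^ n * α ^ k) - α • (fun k : ℤ => (k : ℂ) ^ n * α ^ k) =
          ∑ i ∈ Finset.range n, (α * n.choose i) • (fun k : ℤ => (k : ℂ) ^ i * α ^ k) := by
        funext k
        simp only [Pi.sub_apply, shift_apply, Pi.smul_apply, Finset.sum_apply, smul_eq_mul]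
        rw [zpow_add_one₀ hα, Int.cast_add, Int.cast_one, add_pow, Finset.sum_range_succ]
        simp only [one_pow, mul_one, Nat.choose_self, Nat.cast_one, add_mul, Finset.sum_mul]
        rw [show ∀ a b c : ℂ, a + b - c = a + (b - c) from fun a b c => by ring,
          show (k : ℂ) ^ n * (α ^ k * α) - α * ((k : ℂ) ^ n * α ^ k) = 0 by ring, add_zero]
        exact Finset.sum_congr rfl fun i _ => by ring
      rw [this]
      exact sum_mem fun i hi => Submodule.smul_mem _ _ (ih i (Finset.mem_range.1 hi))
  have : (fun k : ℤ => p.eval (k : ℂ) * α ^ k) =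
      ∑ i ∈ Finset.range (p.natDegree + 1), p.coeff i • (fun k : ℤ => (k : ℂ) ^ i * α ^ k) := by
    funext k
    simp only [Finset.sum_apply, Pi.smul_apply, smul_eq_mul]
    rw [eval_eq_sum_range, Finset.sum_mul]
    exact Finset.sum_congr rfl fun i _ => by ring
  rw [this]
  exact sum_mem fun i _ => Submodule.smul_mem _ _ (hmon i)

/-- The sequence `k (k - 1) ⋯ (k - n + 1) α ^ k`. -/
def fallingExp (n : ℕ) (α : ℂ) (k : ℤ) : ℂ := (descPochhammer ℂ n).eval (k : ℂ) * α ^ k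

theorem shift_fallingExp_zero {α : ℂ} (hα : α ≠ 0) :
    shift (fallingExp 0 α) = α • fallingExp 0 α := by
  funext k
  simp [fallingExp, zpow_add_one₀ hα, mul_comm]

/-- Falling factorials are used because the shift minus `α` lowers the index by exactly one on them,
with a nonzero factor. -/
theorem shift_fallingExp_succ (n : ℕ) {α : ℂ} (hα : α ≠ 0) :
    shift (fallingExp (n + 1) α) =
      α • fallingExp (n + 1) α + (α * (n + 1)) • fallingExp n α := by
  funext k
  simp only [fallingExp, shift_apply, Pi.add_apply, Pi.smul_apply, smul_eq_mul]
  rw [zpow_add_one₀ hα, descPochhammer_succ_left, ← descPochhammer_succ_left,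
    show (descPochhammer ℂ (n + 1)).eval ((k : ℂ)) = (descPochhammer ℂ n).eval (k : ℂ) * (k - n) by
      rw [descPochhammer_succ_right]; simp, descPochhammer_succ_left]
  simp only [eval_mul, eval_X, eval_comp, eval_sub, eval_one, Int.cast_add, Int.cast_one,
    add_sub_cancel_right]
  ring

/-- The span of the exponential polynomials. -/
def expPoly : Submodule ℂ (ℤ → ℂ) :=
  Submodule.span ℂ {g | ∃ n : ℕ, ∃ α : ℂ, α ≠ 0 ∧ g = fallingExp n α}

theorem fallingExp_mem (n : ℕ) {α : ℂ} (hα : α ≠ 0) : fallingExp n α ∈ expPoly :=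
  Submodule.subset_span ⟨n, α, hα, rfl⟩

/-- The equation is solvable on each basis sequence: for base `α` raise the index by one and divide;
for another base the operator is triangular with nonzero diagonal entry `β - α`. -/
theorem exists_shift_sub_eq {α : ℂ} (hα : α ≠ 0) {g : ℤ → ℂ} (hg : g ∈ expPoly) :
    ∃ f ∈ expPoly, shift f - α • f = g := by
  suffices h : expPoly ≤ expPoly.map (shift - α • LinearMap.id) by
    obtain ⟨f, hf, rfl⟩ := h hg
    exact ⟨f, hf, rfl⟩
  refine Submodule.span_le.2 ?_
  rintro _ ⟨n, β, hβ, rfl⟩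
  by_cases hαβ : β = α
  · subst hαβ
    refine ⟨(β * (n + 1))⁻¹ • fallingExp (n + 1) β, Submodule.smul_mem _ _ (fallingExp_mem _ hβ), ?_⟩
    rw [map_smul, LinearMap.sub_apply, shift_fallingExp_succ n hβ, LinearMap.smul_apply,
      LinearMap.id_apply, add_sub_cancel_left,
      inv_smul_smul₀ (mul_ne_zero hβ (Nat.cast_add_one_ne_zero n))]
  · have hne : β - α ≠ 0 := sub_ne_zero.2 hαβ
    induction n with
    | zero =>
      refine ⟨(β - α)⁻¹ • fallingExp 0 β, Submodule.smul_mem _ _ (fallingExp_mem _ hβ), ?_⟩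
      rw [map_smul, LinearMap.sub_apply, shift_fallingExp_zero hβ, LinearMap.smul_apply,
        LinearMap.id_apply, ← sub_smul, inv_smul_smul₀ hne]
    | succ n ih =>
      obtain ⟨f, hf, hfe⟩ := ih
      refine ⟨(β - α)⁻¹ • (fallingExp (n + 1) β - (β * (n + 1)) • f),
        Submodule.smul_mem _ _ (sub_mem (fallingExp_mem _ hβ) (Submodule.smul_mem _ _ hf)), ?_⟩
      rw [map_smul, map_sub, map_smul, hfe, LinearMap.sub_apply, shift_fallingExp_succ n hβ,
        LinearMap.smul_apply, LinearMap.id_apply, inv_smul_eq_iff₀ hne]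
      module

theorem eq_of_shift_eq {α : ℂ} (hα : α ≠ 0) {g : ℤ → ℂ} (hg : shift g = α • g) :
    g = g 0 • fallingExp 0 α := by
  have h : ∀ k, g (k + 1) = α * g k := fun k => congrFun hg k
  funext k
  simp only [fallingExp, descPochhammer_zero, eval_one, one_mul, Pi.smul_apply, smul_eq_mul]
  induction k using Int.induction_on with
  | zero => simp
  | succ k ih => rw [h, ih, zpow_add_one₀ hα]; ring
  | pred k ih =>
    have := h (-(k : ℤ) - 1)
    rw [sub_add_cancel, ih] at this
    rw [zpow_sub_one₀ hα]
    field_simp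
    rw [this]; ring

/-- Recurrent sequences are exponential polynomials. -/
theorem recurrent_le_expPoly : recurrent ≤ expPoly := by
  rintro g ⟨P, hP, hg⟩
  obtain ⟨n, hn⟩ : ∃ n, P.natDegree = n := ⟨_, rfl⟩
  induction n generalizing P g with
  | zero =>
    rw [eq_C_of_natDegree_eq_zero hn] at hg hP
    rw [aeval_C, Module.algebraMap_end_apply] at hg
    rw [(smul_eq_zero.1 hg).resolve_left fun h => hP (by rw [h, C_0])]
    exact zero_mem _
  | succ n ih =>
    obtain ⟨α, hα⟩ := IsAlgClosed.exists_root P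
      (fun h => by rw [degree_eq_natDegree hP, hn] at h; exact absurd h (by norm_cast))
    obtain ⟨Q, rfl⟩ := dvd_iff_isRoot.2 hα
    have hQ : Q ≠ 0 := right_ne_zero_of_mul hP
    have hQn : Q.natDegree = n := by
      rw [natDegree_mul (X_sub_C_ne_zero α) hQ, natDegree_X_sub_C] at hn
      omega
    -- A root `0` can be dropped because the shift is invertible. For a nonzero root, a solution
    -- within `expPoly` differs from `g` by an element of the kernel of the shift minus `α`, a
    -- geometric sequence.
    by_cases hα0 : α = 0
    · subst hα0
      refine ih Q hQ ?_ hQn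
      rw [C_0, sub_zero, map_mul, aeval_X, Module.End.mul_apply] at hg
      funext k
      simpa using congrFun hg (k - 1)
    · rw [mul_comm, map_mul, Module.End.mul_apply, map_sub, aeval_X, aeval_C,
        LinearMap.sub_apply, Module.algebraMap_end_apply] at hg
      obtain ⟨f, hf, hfe⟩ := exists_shift_sub_eq hα0 (ih Q hQ hg hQn)
      have := eq_of_shift_eq hα0 (g := g - f) (by
        rw [map_sub, smul_sub, sub_eq_sub_iff_sub_eq_sub, hfe])
      rw [← sub_add_cancel g f, this]
      exact add_mem (Submodule.smul_mem _ _ (fallingExp_mem 0 hα0)) hf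

theorem exists_of_mem_expPoly {g : ℤ → ℂ} (hg : g ∈ expPoly) :
    ∃ (r : ℕ) (p : Fin r → ℂ[X]) (α : Fin r → ℂ), (∀ j, α j ≠ 0) ∧
      ∀ k : ℤ, g k = ∑ j, (p j).eval (k : ℂ) * α j ^ k := by
  obtain ⟨r, c, f, rfl⟩ := Submodule.mem_span_set'.1 hg
  choose n α hα hf using fun j => (f j).2
  refine ⟨r, fun j => C (c j) * descPochhammer ℂ (n j), α, hα, fun k => ?_⟩
  rw [Finset.sum_apply]
  refine Finset.sum_congr rfl fun j _ => ?_
  rw [Pi.smul_apply, hf, eval_mul, eval_C, fallingExp, smul_eq_mul, mul_assoc]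

/-- A sequence that satisfies a nontrivial linear relation among its translates is recurrent. -/
theorem mem_recurrent_of_sum {g : ℤ → ℂ} {ι : Type*} {F : Finset ι} {a : ι → ℤ} {c : ι → ℂ}
    (ha : Set.InjOn a F) {i₀ : ι} (hi₀ : i₀ ∈ F) (hc : c i₀ ≠ 0)
    (hg : ∀ q, ∑ i ∈ F, c i * g (q - a i) = 0) : g ∈ recurrent := by
  classical
  obtain ⟨N, hN⟩ : ∃ N : ℤ, ∀ i ∈ F, a i ≤ N :=
    ⟨F.sup' ⟨i₀, hi₀⟩ a, fun i hi => Finset.le_sup' a hi⟩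
  -- The upper bound `N` of the translations makes all exponents nonnegative; distinct translations
  -- give distinct exponents, so the coefficient `c i₀` survives.
  refine ⟨∑ i ∈ F, C (c i) * X ^ (N - a i).toNat, fun h => hc ?_, ?_⟩
  · have := congrArg (fun P => P.coeff (N - a i₀).toNat) h
    simp only [finsetSum_coeff, coeff_C_mul, coeff_X_pow, coeff_zero] at this
    rwa [Finset.sum_eq_single_of_mem i₀ hi₀ fun i hi hne => ?_, if_pos rfl, mul_one] at this
    rw [if_neg, mul_zero]
    intro h
    refine hne (ha hi hi₀ ?_)
    have := hN i hi
    have := hN i₀ hi₀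
    omega
  · funext q
    rw [map_sum, LinearMap.sum_apply, Finset.sum_apply, Pi.zero_apply, ← hg (q + N)]
    refine Finset.sum_congr rfl fun i hi => ?_
    rw [map_mul, aeval_C, map_pow, aeval_X, Module.End.mul_apply, Module.algebraMap_end_apply,
      Pi.smul_apply, shift_pow_apply, smul_eq_mul, Int.toNat_of_nonneg (sub_nonneg.2 (hN i hi)),
      add_sub_assoc]

end Recurrence

/-! ### The action on the top layer is exp-polynomial. -/

section TopLayer

variable {V : Type*} [AddCommGroup V] [Module ℂ V] [LieRingModule VirasoroLike V]
  [LieModule ℂ VirasoroLike V] {𝒱 : ℤ × ℤ → Submodule ℂ V}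
  {b : Module.Basis (Fin 2) ℤ (ℤ × ℤ)} {γ₀ : ℤ × ℤ} {χ : ℤ × ℤ → ℂ}

theorem det_sq (b : Module.Basis (Fin 2) ℤ (ℤ × ℤ)) :
    (det (b 0) (b 1) : ℂ) * (det (b 0) (b 1) : ℂ) = 1 := by
  exact_mod_cast det_mul_self b

variable (H : HasTopLayer 𝒱 b γ₀ χ)
include H

theorem HasTopLayer.lie_eq_zero {γ : ℤ × ℤ} {v : V} (hv : v ∈ 𝒱 γ) {m : ℤ × ℤ}
    (hm : b.repr γ₀ 0 < b.repr m 0 + b.repr γ 0) : ⁅D m, v⁆ = 0 := by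
  have := H.graded.lie_mem m _ _ hv
  rwa [H.top _ (by rwa [repr_add]), Submodule.mem_bot] at this

theorem HasTopLayer.central_eq (m : ℤ × ℤ) : χ m = b.repr m 0 * χ (b 0) := by
  have := H.nontrivial
  conv_lhs => rw [← repr_smul_add b m]
  rw [central_add H.central, central_zsmul H.central, central_zsmul H.central, H.level, mul_zero,
    add_zero]

theorem HasTopLayer.raise_lower {γ : ℤ × ℤ} (hγ : b.repr γ 0 = b.repr γ₀ 0) {t : V}
    (ht : t ∈ 𝒱 γ) (q j : ℤ) :
    ⁅D (b 0 + q • b 1), ⁅D (-b 0 + j • b 1), t⁆⁆ =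
      (-(det (b 0) (b 1) : ℂ) * ((q + j : ℤ) : ℂ)) • ⁅D ((q + j) • b 1), t⁆ +
        (if q + j = 0 then χ (b 0) • t else 0) := by
  rw [VirasoroLike.raise_lower b H.central q j (H.lie_eq_zero ht (by
    rw [hγ]; simp [-zsmul_eq_mul, -smul_eq_mul])), H.central_eq (b 0 + q • b 1)]
  simp [-zsmul_eq_mul, -smul_eq_mul]

/-- If the `D(k b₂)` and `h(b₁)` kill a top vector, the module is trivial. -/
theorem HasTopLayer.central_ne_zero (hnt : ¬ LieModule.IsTrivial VirasoroLike V) {u : V}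
    (hu : u ∈ 𝒱 γ₀) (hu0 : u ≠ 0) (hk : ∀ k : ℤ, ⁅D (k • b 1), u⁆ = 0) : χ (b 0) ≠ 0 := by
  intro hχ0
  have hχ : ∀ m, χ m = 0 := fun m => by rw [H.central_eq, hχ0, mul_zero]
  have hG' := isGradedBy_id_iff.2 H.graded
  have h0 : ∀ m : ℤ × ℤ, b.repr m 0 = 0 → ⁅D m, u⁆ = 0 := fun m hm => by
    rw [← repr_smul_add b m, hm, zero_smul, zero_add, hk]
  -- Induction on the depth: a positive `D(p)` sends `D(m) u` to a multiple of `D(p + m) u`, which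
  -- vanishes either by positivity or by induction. So `D(m) u` is killed by all positive operators
  -- below the top layer, and is zero.
  have key : ∀ n : ℕ, ∀ m : ℤ × ℤ, b.repr m 0 = -n → ⁅D m, u⁆ = 0 := fun n => by
    induction n using Nat.strong_induction_on with
    | _ n ih =>
      intro m hm
      rcases Nat.eq_zero_or_pos n with rfl | hn
      · exact h0 m (by simpa using hm)
      refine hG'.eq_zero_of_killed H.irreducible.eq_bot_or_eq_top (d := coord₁ b) (i := m + γ₀)
        (j := γ₀) ?_ (fun hbot => hu0 ?_) (H.graded.lie_mem _ _ _ hu) fun p hp => ?_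
      · rw [coord₁_apply, coord₁_apply, repr_add, hm]; omega
      · rwa [hbot, Submodule.mem_bot] at hu
      · have hp' : 0 < b.repr p 0 := hp
        rw [D_lie_D_lie, H.lie_eq_zero hu (by omega), lie_zero, zero_add, H.central, hχ, zero_smul,
          ite_self, add_zero]
        convert smul_zero _
        rcases lt_or_ge (0 : ℤ) (b.repr (p + m) 0) with h | h
        · exact H.lie_eq_zero hu (by omega)
        · obtain ⟨n', hn'⟩ : ∃ n' : ℕ, b.repr (p + m) 0 = -n' :=
            ⟨(-b.repr (p + m) 0).toNat, by omega⟩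
          refine ih n' ?_ _ hn'
          rw [repr_add, hm] at hn'
          omega
  refine hu0 (eq_zero_of_forall_D H.graded H.irreducible hnt fun m => ?_)
  rcases lt_or_ge (0 : ℤ) (b.repr m 0) with h | h
  · exact H.lie_eq_zero hu (by omega)
  · exact key (-b.repr m 0).toNat m (by omega)

/-- In a nontrivial quasi-finite module some `D(k b₂)` acts nontrivially on the top layer. -/
theorem HasTopLayer.exists_lie_ne_zero (hfin : IsQuasiFinite V 𝒱)
    (hnt : ¬ LieModule.IsTrivial VirasoroLike V) {u : V} (hu : u ∈ 𝒱 γ₀) (hu0 : u ≠ 0) :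
    ∃ k : ℤ, ⁅D (k • b 1), u⁆ ≠ 0 := by
  by_contra! hk
  have he := H.central_ne_zero hnt hu hu0 hk
  have hε := det_sq b
  set e := χ (b 0) with hedef
  set ε := det (b 0) (b 1) with hεdef
  let y : ℤ → V := fun j => ⁅D (-b 0 + j • b 1), u⁆
  have hy : ∀ q j : ℤ, ⁅D (b 0 + q • b 1), y j⁆ = if q + j = 0 then e • u else 0 := fun q j => by
    change ⁅D (b 0 + q • b 1), ⁅D (-b 0 + j • b 1), u⁆⁆ = _
    rw [H.raise_lower rfl hu, hk, smul_zero, zero_add]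
  have hy0 : ∀ j, y j ≠ 0 := fun j h => by
    have := hy (-j) j
    rw [h, lie_zero, if_pos (neg_add_cancel j), eq_comm] at this
    exact (smul_ne_zero he hu0) this
  -- Everything here takes place two layers down. If all `D(k b₂)` killed `u`, raising would test
  -- the vectors `D(-b₁ + j b₂) y(-j)` by a quadratic polynomial in `l` plus delta terms with
  -- coefficient `e = χ(b₁) ≠ 0`.
  have hw : ∀ l j : ℤ, ⁅D (b 0 + l • b 1), ⁅D (-b 0 + j • b 1), y (-j)⁆⁆ =
      (((l + j : ℤ) : ℂ) ^ 2 + (if l + j = 0 then e else 0) + if l = j then e else 0) • y l :=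
    fun l j => by
      have e1 : b 0 + l • b 1 + (-b 0 + j • b 1) = (l + j) • b 1 := by rw [add_smul]; abel
      have e2 : det (b 0 + l • b 1) (-b 0 + j • b 1) = ε * (l + j) := by
        simp only [det_add_left, det_add_right, det_neg_right, det_zsmul_left, det_zsmul_right,
          det_self, ← hεdef]
        rw [det_comm (b 1) (b 0), ← hεdef]; ring
      have e3 : (l + j) • b 1 = 0 ↔ l + j = 0 := by
        rw [smul_eq_zero]
        exact or_iff_left (b.ne_zero 1)
      have e4 : ⁅D ((l + j) • b 1), y (-j)⁆ = (-(ε : ℂ) * (l + j)) • y l := by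
        change ⁅D ((l + j) • b 1), ⁅D (-b 0 + (-j) • b 1), u⁆⁆ = _
        have e5 : (l + j) • b 1 + (-b 0 + (-j) • b 1) = -b 0 + l • b 1 := by
          rw [add_smul, neg_smul]; abel
        have e6 : det ((l + j) • b 1) (-b 0 + (-j) • b 1) = ε * (l + j) := by
          simp only [det_add_right, det_neg_right, det_zsmul_left, det_zsmul_right, det_self]
          rw [det_comm (b 1) (b 0), ← hεdef]; ring
        rw [D_lie_D_lie_of_ne, hk, lie_zero, zero_add, e5, e6]
        · push_cast
          rw [neg_mul]
        · rw [e5]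
          intro h
          have := congrArg (fun m => b.repr m 0) h
          simp [-zsmul_eq_mul, -smul_eq_mul] at this
      rw [D_lie_D_lie, hy, e1, e2, e4]
      simp only [e3, H.central]
      rw [H.central_eq (b 0 + l • b 1)]
      have e7 : b.repr (b 0 + l • b 1) 0 = 1 := by simp [-zsmul_eq_mul, -smul_eq_mul]
      rw [e7, Int.cast_one, one_mul, ← hedef, smul_smul]
      have e8 : (-((ε * (l + j) : ℤ) : ℂ)) * (-(ε : ℂ) * (l + j)) = ((l + j : ℤ) : ℂ) ^ 2 := by
        push_cast
        linear_combination ((l : ℂ) + j) ^ 2 * hε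
      rw [e8]
      have e9 : (if l + -j = 0 then e • u else 0) = (if l = j then e • u else 0) := by
        simp only [← sub_eq_add_neg, sub_eq_zero]
      rw [e9]
      have e10 : ⁅D (-b 0 + j • b 1), if l = j then e • u else 0⁆ = if l = j then e • y l else 0 := by
        split_ifs with h
        · rw [lie_smul, h]
        · rw [lie_zero]
      have e11 : (if l + j = 0 then e • y (-j) else 0) = if l + j = 0 then e • y l else 0 := by
        split_ifs with h
        · rw [show -j = l by omega]
        · rfl
      rw [e10, e11, add_smul, add_smul, ite_smul, ite_smul, zero_smul]
      abel
  have hmem : ∀ j : ℤ, ⁅D (-b 0 + j • b 1), y (-j)⁆ ∈ 𝒱 (γ₀ + (-2 : ℤ) • b 0) := fun j => by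
    have := H.graded.lie_mem (-b 0 + j • b 1) _ _ (H.graded.lie_mem (-b 0 + (-j) • b 1) _ _ hu)
    rwa [show -b 0 + j • b 1 + (-b 0 + (-j) • b 1 + γ₀) = γ₀ + (-2 : ℤ) • b 0 by
      rw [neg_smul, neg_smul, two_smul]; abel] at this
  -- Only the positive indices `j + 1` are used, so that at `l = j₀ + 1` the delta at `l = -(j + 1)`
  -- is absent.
  have hLI : LinearIndependent ℂ (fun j : ℕ => (⟨_, hmem (j + 1)⟩ : 𝒱 (γ₀ + (-2 : ℤ) • b 0))) := by
    rw [linearIndependent_iff']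
    intro F a hF j₀ hj₀
    have hF' : ∑ j ∈ F, a j • ⁅D (-b 0 + (j + 1 : ℤ) • b 1), y (-(j + 1 : ℤ))⁆ = 0 := by
      have := congrArg Subtype.val hF
      simpa only [Submodule.coe_sum, Submodule.coe_smul, ZeroMemClass.coe_zero] using this
    have hl : ∀ l : ℤ, ∑ j ∈ F, a j * (((l + (j + 1) : ℤ) : ℂ) ^ 2 +
        (if l + (j + 1) = 0 then e else 0) + if l = j + 1 then e else 0) = 0 := fun l => by
      have h1 := congrArg (fun v => ⁅D (b 0 + l • b 1), v⁆) hF'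
      simp only [lie_zero, lie_sum, lie_smul, hw, smul_smul] at h1
      rw [← Finset.sum_smul] at h1
      exact (smul_eq_zero.1 h1).resolve_right (hy0 l)
    let Q : Polynomial ℂ := ∑ j ∈ F, Polynomial.C (a j) * (Polynomial.X + Polynomial.C (j + 1 : ℂ)) ^ 2
    have hQe : ∀ z : ℂ, Q.eval z = ∑ j ∈ F, a j * (z + (j + 1)) ^ 2 := fun z => by
      simp [Q, Polynomial.eval_finsetSum]
    -- For large `l` both deltas vanish, so the quadratic part of a relation has infinitely many
    -- zeros. At `l = j₀ + 1` there remains `a j₀ * e = 0`.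
    have hQ : Q = 0 := by
      refine Polynomial.eq_zero_of_infinite_isRoot Q (Set.infinite_of_injective_forall_mem
        (f := fun n : ℕ => ((n + (F.sup id + 2) : ℕ) : ℂ)) (fun m n h => ?_) fun n => ?_)
      · have := Nat.cast_injective (R := ℂ) h
        omega
      · change Q.eval _ = 0
        rw [hQe, ← hl ((n + (F.sup id + 2) : ℕ) : ℤ)]
        refine Finset.sum_congr rfl fun j hj => ?_
        have : j ≤ F.sup id := Finset.le_sup (f := id) hj
        rw [if_neg (by omega), if_neg (by omega), add_zero, add_zero]
        push_cast
        ring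
    have h2 := hl (j₀ + 1)
    have h3 := hQe ((j₀ + 1 : ℤ) : ℂ)
    rw [hQ, Polynomial.eval_zero] at h3
    have h4 : ∑ j ∈ F, a j * (if ((j₀ : ℤ) + 1) = j + 1 then e else 0) = 0 := by
      refine Eq.trans ?_ ((congrArg₂ (· - ·) h2 h3.symm).trans (sub_zero (0 : ℂ)))
      rw [← Finset.sum_sub_distrib]
      refine Finset.sum_congr rfl fun j _ => ?_
      rw [if_neg (show ¬ ((j₀ : ℤ) + 1 + (j + 1) = 0) by omega)]
      push_cast
      ring
    rw [Finset.sum_eq_single_of_mem j₀ hj₀ fun j _ hj => by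
      rw [if_neg (by omega), mul_zero], if_pos rfl] at h4
    exact (mul_eq_zero.1 h4).resolve_right he
  have := hfin (γ₀ + (-2 : ℤ) • b 0)
  exact not_finite_iff_infinite.2 inferInstance hLI.finite_of_isNoetherian

/-- The linear functional on `L₀` given by the action on the top layer is exp-polynomial. -/
theorem HasTopLayer.exists_expPolynomial (hfin : IsQuasiFinite V 𝒱)
    (hnt : ¬ LieModule.IsTrivial VirasoroLike V) {u : V} (hu : u ∈ 𝒱 γ₀) (hu0 : u ≠ 0) :
    ∃ (ψ : gradedPiece b 0 →ₗ[ℂ] ℂ) (s : ℕ) (t : ℤ → V), IsExpPolynomial b ψ ∧ 0 < s ∧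
      (∀ k, t k ∈ 𝒱 (γ₀ + k • b 1)) ∧ (∀ k, t k ≠ 0 ↔ (s : ℤ) ∣ k) ∧
      (∀ j k, ⁅D (j • b 1), t k⁆ = ψ (D₀ b j) • t (k + j)) ∧
      (∀ m (v : V), ⁅h m, v⁆ = ψ (h₀ b m) • v) ∧
      (∀ k, 𝒱 (γ₀ + k • b 1) ≤ Submodule.span ℂ {t k}) ∧
      (∀ k, ψ (D₀ b k) ≠ 0 → (s : ℤ) ∣ k) ∧
      ∀ k, (s : ℤ) ∣ k → k ∈ AddSubmonoid.closure {k | ψ (D₀ b k) ≠ 0} := by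
  have := H.nontrivial
  obtain ⟨s, ψ, t, htm, ht0, hact, hspan, hψd, hψc⟩ := H.exists_shift_basis hfin hu hu0
  have hψ0 : ψ 0 = 0 := by
    have := hact 0 0
    rw [zero_smul, D_zero, zero_lie, eq_comm, smul_eq_zero, add_zero] at this
    exact this.resolve_right ((ht0 0).2 (dvd_zero _))
  -- If `s = 0`, only `D(0) = 0` could act with a nonzero scalar, against the nontrivial action just
  -- established.
  have hs : 0 < s := by
    rcases Nat.eq_zero_or_pos s with rfl | hs
    · obtain ⟨k, hk⟩ := H.exists_lie_ne_zero hfin hnt hu hu0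
      refine absurd ?_ hk
      obtain ⟨c, rfl⟩ := Submodule.mem_span_singleton.1
        (hspan 0 (by rwa [zero_smul, add_zero] : u ∈ 𝒱 (γ₀ + (0 : ℤ) • b 1)))
      rw [lie_smul, hact]
      by_cases h : ψ k = 0
      · rw [h, zero_smul, smul_zero]
      · have := hψd k h
        rw [Nat.cast_zero, zero_dvd_iff] at this
        rw [this, hψ0, zero_smul, smul_zero]
    · exact hs
  let F : ℤ × ℤ → ℂ := fun m => if b.repr m 0 = 0 then ψ (b.repr m 1) else 0
  let Ψ : gradedPiece b 0 →ₗ[ℂ] ℂ := (lift F (χ (1, 0)) (χ (0, 1))).domRestrict (gradedPiece b 0)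
  have hF : ∀ k : ℤ, F (k • b 1) = ψ k := fun k => by
    simp [F, -zsmul_eq_mul, -smul_eq_mul]
  have hD : ∀ k, Ψ (D₀ b k) = ψ k := fun k => by
    change lift F _ _ (D (k • b 1)) = _
    rw [lift_D _ _ _ (by simpa [hψ0] using hF 0), hF]
  have hh : ∀ m, Ψ (h₀ b m) = χ m := fun m => by
    obtain ⟨v, hv⟩ := exists_ne (0 : V)
    refine smul_left_injective ℂ hv ?_
    change lift F _ _ (h m) • v = χ m • v
    rw [← H.central, h, map_add, map_smul, map_smul, lift_c₁, lift_c₂, add_lie, smul_lie, smul_lie,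
      c₁_eq_h, c₂_eq_h, H.central, H.central, add_smul, smul_smul, smul_smul, smul_eq_mul,
      smul_eq_mul]
  refine ⟨Ψ, s, t, ⟨?_, ?_, ?_⟩, hs, htm, ht0, fun j k => by rw [hD, hact], fun m v => by
    rw [hh, H.central], hspan, fun k hk => hψd k (by rwa [hD] at hk), fun k hk => ?_⟩
  · rintro h0
    have h1 : ∀ k, ψ k = 0 := fun k => by rw [← hD, h0, LinearMap.zero_apply]
    have := hψc s dvd_rfl
    simp only [h1, ne_eq, not_true_eq_false, Set.ofPred_false, AddSubmonoid.closure_empty,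
      AddSubmonoid.mem_bot] at this
    omega
  · rw [hh, H.level]
  -- The value at `0` is chosen so that raising a lowered top vector gives `-det(b₁, b₂) g(q + j)`
  -- uniformly, the central term included; this uses `det(b₁, b₂) ^ 2 = 1`.
  · let g : ℤ → ℂ := fun k => if k = 0 then -(det (b 0) (b 1) : ℂ) * χ (b 0) else k * ψ k
    have hε := det_sq b
    have hrec : g ∈ recurrent := by
      have hfd := hfin (γ₀ + -b 0)
      have hmem : ∀ k : ℤ, ⁅D (-b 0 + (-(s * k)) • b 1), t (s * k)⁆ ∈ 𝒱 (γ₀ + -b 0) := fun k => by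
        have := H.graded.lie_mem (-b 0 + (-(s * k)) • b 1) _ _ (htm (s * k))
        rwa [show -b 0 + (-(s * k)) • b 1 + (γ₀ + (s * k) • b 1) = γ₀ + -b 0 by
          rw [neg_smul]; abel] at this
      -- All these vectors have degree `γ₀ - b₁`, so they are dependent; raising a relation by `b₁ +
      -- q b₂` gives a recurrence for `g` at `q`.
      have hdep : ¬ LinearIndependent ℂ (fun k : ℤ => (⟨_, hmem k⟩ : 𝒱 (γ₀ + -b 0))) := fun hLI =>
        not_finite_iff_infinite.2 inferInstance hLI.finite_of_isNoetherian
      rw [not_linearIndependent_iff] at hdep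
      obtain ⟨A, c, hc, i₀, hi₀, hci₀⟩ := hdep
      have hc' : ∑ k ∈ A, c k • ⁅D (-b 0 + (-(s * k)) • b 1), t (s * k)⁆ = 0 := by
        have := congrArg Subtype.val hc
        simpa only [Submodule.coe_sum, Submodule.coe_smul, ZeroMemClass.coe_zero] using this
      refine mem_recurrent_of_sum (F := A) (a := fun k => s * k) (c := c) (fun j _ k _ hjk => ?_)
        hi₀ hci₀ fun q => ?_
      · exact mul_left_cancel₀ (by exact_mod_cast hs.ne') hjk
      · by_cases hq : (s : ℤ) ∣ q
        · have h1 := congrArg (fun v => ⁅D (b 0 + q • b 1), v⁆) hc'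
          simp only [lie_zero, lie_sum, lie_smul] at h1
          have h2 : ∀ k : ℤ, ⁅D (b 0 + q • b 1), ⁅D (-b 0 + (-(s * k)) • b 1), t (s * k)⁆⁆ =
              (-(det (b 0) (b 1) : ℂ) * g (q - s * k)) • t q := fun k => by
            rw [H.raise_lower (H.repr_eq _) (htm _), hact, ← sub_eq_add_neg, smul_smul,
              add_sub_cancel]
            by_cases h0 : q - s * k = 0
            · rw [if_pos h0, h0, hψ0, mul_zero, zero_smul, zero_add, ← sub_eq_zero.1 h0]
              congr 1
              simp only [g, if_true]
              linear_combination (-χ (b 0)) * hε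
            · rw [if_neg h0, add_zero]
              simp only [g, if_neg h0, mul_assoc]
          simp only [h2, smul_smul] at h1
          rw [← Finset.sum_smul, smul_eq_zero] at h1
          have h3 := h1.resolve_right ((ht0 q).2 hq)
          have hε0 : (-(det (b 0) (b 1) : ℂ)) ≠ 0 := neg_ne_zero.2 (left_ne_zero_of_mul_eq_one hε)
          refine (mul_eq_zero.1 ?_).resolve_left hε0
          rw [Finset.mul_sum, ← h3]
          exact Finset.sum_congr rfl fun k _ => by ring
        -- For `q` outside the multiples of the period the vector `t q` is zero and gives no
        -- information, but then each term vanishes by itself.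
        · refine Finset.sum_eq_zero fun k _ => ?_
          have h1 : q - s * k ≠ 0 := fun h => hq ⟨k, by linarith⟩
          have h2 : ψ (q - s * k) = 0 := by
            by_contra h
            exact hq ((dvd_sub_left (dvd_mul_right _ _)).1 (hψd _ h))
          simp only [g, if_neg h1, h2, mul_zero]
    obtain ⟨r, p, α, hα, hg⟩ := exists_of_mem_expPoly (recurrent_le_expPoly hrec)
    refine ⟨r, p, α, hα, fun k hk => ?_, ?_⟩
    · rw [hD, ← hg]
      simp only [g, if_neg hk]
      rw [mul_div_cancel_left₀ _ (Int.cast_ne_zero.2 hk)]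
    · have h1 : ∑ j, (p j).coeff 0 = g 0 := by
        rw [hg]
        exact Finset.sum_congr rfl fun j _ => by
          rw [Int.cast_zero, zpow_zero, mul_one, Polynomial.coeff_zero_eq_eval_zero]
      rw [hh, h1]
      simp only [g, if_true]
      linear_combination (-χ (b 0)) * hε
  · have : {k | Ψ (D₀ b k) ≠ 0} = {k | ψ k ≠ 0} := by simp only [hD]
    rw [this]
    exact hψc k hk

end TopLayer

/-! ### Loop modules -/

section Loop

variable (δ : ℤ × ℤ →+ ℤ) (M : Type*) [AddCommGroup M] [Module ℂ M]

/-- The coefficient at `t ^ k`. -/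
def loopCoeff (k : ℤ) : LoopModule δ M →ₗ[ℂ] M :=
  (TensorProduct.rid ℂ M).toLinearMap ∘ₗ
    TensorProduct.map LinearMap.id (Finsupp.lapply k ∘ₗ (AddMonoidAlgebra.coeffLinearEquiv ℂ).toLinearMap)

theorem loopCoeff_loopMk (k l : ℤ) (v : M) :
    loopCoeff δ M k (loopMk δ M l v) = if l = k then v else 0 := by
  change (TensorProduct.rid ℂ M) (v ⊗ₜ[ℂ] (LaurentPolynomial.T l : ℂ[T;T⁻¹]).coeff k) = _
  rw [LaurentPolynomial.T_apply, TensorProduct.rid_tmul]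
  split_ifs <;> simp

variable {δ M}

theorem loop_induction {p : LoopModule δ M → Prop} (h0 : p 0)
    (hadd : ∀ x y, p x → p y → p (x + y)) (h : ∀ k v, p (loopMk δ M k v)) (x : LoopModule δ M) :
    p x := by
  refine TensorProduct.induction_on (motive := p) x h0 (fun v f => ?_) hadd
  induction f using LaurentPolynomial.induction_on' with
  | add f g hf hg => rw [TensorProduct.tmul_add]; exact hadd _ _ hf hg
  | C_mul_T n a =>
    rw [← LaurentPolynomial.smul_eq_C_mul, ← TensorProduct.smul_tmul]
    exact h n (a • v)

theorem loopMk_injective (k : ℤ) : Function.Injective (loopMk δ M k) := fun x y h => by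
  simpa [loopCoeff_loopMk] using congrArg (loopCoeff δ M k) h

variable [LieRingModule VirasoroLike M] [LieModule ℂ VirasoroLike M]

theorem h_lie_loopMk (m : ℤ × ℤ) (k : ℤ) (v : M) :
    ⁅h m, loopMk δ M k v⁆ = loopMk δ M k ⁅h m, v⁆ := by
  rw [h_lie_eq, lie_loopMk, lie_loopMk, lie_loopMk, lie_loopMk, map_neg, add_assoc, add_assoc,
    neg_add_cancel, add_neg_cancel, add_zero, ← map_sub, ← h_lie_eq]

end Loop

/-! ### The universal property of the induced module -/

section Verma

theorem U_eq_top {S : Subalgebra ℂ U} (hS : ∀ x, ι x ∈ S) (u : U) : u ∈ S := by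
  obtain ⟨t, rfl⟩ : ∃ t, UniversalEnvelopingAlgebra.mkAlgHom ℂ VirasoroLike t = u :=
    RingCon.mkₐ_surjective (α := ℂ) _ u
  induction t using TensorAlgebra.induction with
  | algebraMap r => rw [AlgHom.commutes]; exact S.algebraMap_mem r
  | ι x => exact hS x
  | mul x y hx hy => rw [map_mul]; exact S.mul_mem hx hy
  | add x y hx hy => rw [map_add]; exact S.add_mem hx hy

variable (b : Module.Basis (Fin 2) ℤ (ℤ × ℤ)) (ψ : gradedPiece b 0 →ₗ[ℂ] ℂ)

theorem D_mem_gradedPiece (m : ℤ × ℤ) : D m ∈ gradedPiece b (b.repr m 0) :=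
  Submodule.mem_sup_left (Submodule.subset_span ⟨b.repr m 1, congrArg D (repr_smul_add b m)⟩)

theorem vermaGen_lie_pos {m : ℤ × ℤ} (hm : 0 < b.repr m 0) : ⁅D m, vermaGen b ψ⁆ = 0 := by
  change (vermaIdeal b ψ).mkQ (ι (D m) • (1 : U)) = 0
  rw [smul_eq_mul, mul_one, Submodule.mkQ_apply, Submodule.Quotient.mk_eq_zero]
  exact Submodule.subset_span (Or.inl ⟨_, hm, _, D_mem_gradedPiece b m, rfl⟩)

theorem vermaGen_lie_zero (x : gradedPiece b 0) :
    ⁅(x : VirasoroLike), vermaGen b ψ⁆ = ψ x • vermaGen b ψ := by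
  rw [← sub_eq_zero, ← algebraMap_smul U (ψ x) (vermaGen b ψ)]
  change ι (x : VirasoroLike) • vermaGen b ψ - _ = 0
  rw [← sub_smul]
  change (vermaIdeal b ψ).mkQ ((ι (x : VirasoroLike) - algebraMap ℂ U (ψ x)) • (1 : U)) = 0
  rw [smul_eq_mul, mul_one, Submodule.mkQ_apply, Submodule.Quotient.mk_eq_zero]
  exact Submodule.subset_span (Or.inr ⟨x, rfl⟩)

theorem lieSpan_vermaGen : LieSubmodule.lieSpan ℂ VirasoroLike {vermaGen b ψ} = ⊤ := by
  rw [eq_top_iff]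
  intro v _
  obtain ⟨u, rfl⟩ := Submodule.mkQ_surjective (vermaIdeal b ψ) v
  let N := LieSubmodule.lieSpan ℂ VirasoroLike {vermaGen b ψ}
  let S : Subalgebra ℂ U :=
    { carrier := {u | ∀ v ∈ N, u • v ∈ N}
      mul_mem' := fun {x y} hx hy v hv => by rw [mul_smul]; exact hx _ (hy _ hv)
      add_mem' := fun {x y} hx hy v hv => by rw [add_smul]; exact add_mem (hx _ hv) (hy _ hv)
      algebraMap_mem' := fun r v hv => by
        rw [algebraMap_smul]; exact N.smul_mem _ hv }
  have hS : ∀ u, u ∈ S := U_eq_top fun x v hv => N.lie_mem hv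
  have := hS u (vermaGen b ψ) (LieSubmodule.subset_lieSpan rfl)
  change (vermaIdeal b ψ).mkQ (u • (1 : U)) ∈ N at this
  rwa [smul_eq_mul, mul_one] at this

variable {b ψ} {M : Type*} [AddCommGroup M] [Module ℂ M] [LieRingModule VirasoroLike M]
  [LieModule ℂ VirasoroLike M]

/-- A vector that is killed by `L₊` and on which `L₀` acts by `ψ` is the image of the generator of
the induced module. -/
theorem exists_verma_hom {w : M} (hpos : ∀ m, 0 < b.repr m 0 → ⁅D m, w⁆ = 0)
    (hD : ∀ k, ⁅D (k • b 1), w⁆ = ψ (D₀ b k) • w) (hh : ∀ m, ⁅h m, w⁆ = ψ (h₀ b m) • w) :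
    ∃ f : Verma b ψ →ₗ[ℂ] M, (∀ (x : VirasoroLike) v, f ⁅x, v⁆ = ⁅x, f v⁆) ∧ f (vermaGen b ψ) = w := by
  let ρ : U →ₐ[ℂ] Module.End ℂ M :=
    UniversalEnvelopingAlgebra.lift ℂ (LieModule.toEnd ℂ VirasoroLike M)
  have hρ : ∀ x v, ρ (ι x) v = ⁅x, v⁆ := fun x v => by
    simp only [ρ, ι]
    rw [UniversalEnvelopingAlgebra.lift_ι_apply]
    rfl
  let I : Submodule U U :=
    { carrier := {u | ρ u w = 0}
      zero_mem' := by simp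
      add_mem' := fun {x y} hx hy => by
        rw [Set.mem_ofPred_eq] at hx hy ⊢
        rw [map_add, LinearMap.add_apply, hx, hy, add_zero]
      smul_mem' := fun u x hx => by
        rw [Set.mem_ofPred_eq] at hx ⊢
        rw [smul_eq_mul, map_mul, Module.End.mul_apply, hx, map_zero] }
  have hposx : ∀ j : ℤ, 0 < j → ∀ x ∈ gradedPiece b j, ⁅x, w⁆ = 0 := fun j hj x hx => by
    rw [gradedPiece, if_neg hj.ne', sup_bot_eq] at hx
    have : Submodule.span ℂ (Set.range fun m : ℤ => D (j • b 0 + m • b 1)) ≤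
        LinearMap.ker ((LieModule.toEnd ℂ VirasoroLike M : VirasoroLike →ₗ[ℂ] Module.End ℂ M).flip w) := by
      refine Submodule.span_le.2 ?_
      rintro _ ⟨m, rfl⟩
      exact hpos _ (by simpa [-zsmul_eq_mul, -smul_eq_mul] using hj)
    exact this hx
  have hzerox : ∀ x : gradedPiece b 0, ⁅(x : VirasoroLike), w⁆ = ψ x • w := fun ⟨x, hx⟩ => by
    let A : Submodule ℂ VirasoroLike := (LinearMap.ker
      (((LieModule.toEnd ℂ VirasoroLike M : VirasoroLike →ₗ[ℂ] Module.End ℂ M).flip w).domRestrict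
        (gradedPiece b 0) - (LinearMap.toSpanSingleton ℂ M w) ∘ₗ ψ)).map (gradedPiece b 0).subtype
    have hA : ∀ (y : VirasoroLike) (hy : y ∈ gradedPiece b 0), ⁅y, w⁆ = ψ ⟨y, hy⟩ • w → y ∈ A :=
      fun y hy h => ⟨⟨y, hy⟩, by
        rw [SetLike.mem_coe, LinearMap.mem_ker, LinearMap.sub_apply, sub_eq_zero]
        exact h, rfl⟩
    have hle : gradedPiece b 0 ≤ A := by
      rw [gradedPiece, if_pos rfl, sup_le_iff, Submodule.span_le, Submodule.span_le]
      constructor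
      · rintro _ ⟨m, rfl⟩
        have e : (0 : ℤ) • b 0 + m • b 1 = m • b 1 := by rw [zero_smul, zero_add]
        dsimp only
        rw [e]
        exact hA _ (D_mem_gradedPiece_zero b m) (hD m)
      · rintro _ (rfl | rfl)
        · rw [c₁_eq_h]; exact hA _ (h_mem_gradedPiece_zero b _) (hh _)
        · rw [c₂_eq_h]; exact hA _ (h_mem_gradedPiece_zero b _) (hh _)
    obtain ⟨y, hy, hyx⟩ := hle hx
    have : y = ⟨x, hx⟩ := Subtype.ext hyx
    subst this
    rw [SetLike.mem_coe, LinearMap.mem_ker, LinearMap.sub_apply, sub_eq_zero] at hy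
    exact hy
  have hI : vermaIdeal b ψ ≤ I := by
    refine Submodule.span_le.2 ?_
    rintro _ (⟨j, hj, x, hx, rfl⟩ | ⟨x, rfl⟩)
    · change ρ (ι x) w = 0
      rw [hρ, hposx j hj x hx]
    · change ρ (ι (x : VirasoroLike) - algebraMap ℂ U (ψ x)) w = 0
      rw [map_sub, LinearMap.sub_apply, hρ, hzerox, AlgHom.commutes, Module.algebraMap_end_apply,
        sub_self]
  let f₀ : U →ₗ[ℂ] M := (LinearMap.applyₗ w) ∘ₗ ρ.toLinearMap
  let f : Verma b ψ →ₗ[ℂ] M :=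
    (((vermaIdeal b ψ).restrictScalars ℂ).liftQ f₀ fun u hu => hI hu) ∘ₗ
      (Submodule.Quotient.restrictScalarsEquiv ℂ (vermaIdeal b ψ)).symm.toLinearMap
  have hf : ∀ u : U, f ((vermaIdeal b ψ).mkQ u) = ρ u w := fun u => rfl
  refine ⟨f, fun x v => ?_, ?_⟩
  · obtain ⟨u, rfl⟩ := Submodule.mkQ_surjective (vermaIdeal b ψ) v
    change f ((vermaIdeal b ψ).mkQ (ι x * u)) = _
    rw [hf, hf, map_mul, Module.End.mul_apply, hρ]
  · change f ((vermaIdeal b ψ).mkQ 1) = w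
    rw [hf, map_one, Module.End.one_apply]

theorem lie_vermaGrade {j n : ℤ} {x : VirasoroLike} (hx : x ∈ gradedPiece b j) {v : Verma b ψ}
    (hv : v ∈ vermaGrade b ψ n) : ⁅x, v⁆ ∈ vermaGrade b ψ (j + n) := by
  have : vermaGrade b ψ n ≤ (vermaGrade b ψ (j + n)).comap (act x) := by
    refine Submodule.span_le.2 ?_
    rintro _ ⟨l, hl, rfl, rfl⟩
    refine Submodule.subset_span ⟨(j, x) :: l, ?_, by simp, ?_⟩
    · simpa using ⟨hx, fun a c h => hl (a, c) h⟩
    · rw [List.map_cons, List.prod_cons, mul_smul]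
      rfl
  exact this hv

theorem vermaGen_mem : vermaGen b ψ ∈ vermaGrade b ψ 0 :=
  Submodule.subset_span ⟨[], by simp, by simp, by simp⟩

theorem lie_loopMk_of_mem {δ : ℤ × ℤ →+ ℤ} {j k : ℤ} {x : VirasoroLike}
    (hδ : ∀ m, δ m = b.repr m 0) (hx : x ∈ gradedPiece b j) (v : M) :
    ⁅x, loopMk δ M k v⁆ = loopMk δ M (k + j) ⁅x, v⁆ := by
  let A : Submodule ℂ VirasoroLike := LinearMap.ker
    ((LieModule.toEnd ℂ VirasoroLike (LoopModule δ M) :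
        VirasoroLike →ₗ[ℂ] Module.End ℂ (LoopModule δ M)).flip (loopMk δ M k v) -
      loopMk δ M (k + j) ∘ₗ
        (LieModule.toEnd ℂ VirasoroLike M : VirasoroLike →ₗ[ℂ] Module.End ℂ M).flip v)
  have hA : ∀ x, x ∈ A ↔ ⁅x, loopMk δ M k v⁆ = loopMk δ M (k + j) ⁅x, v⁆ := fun x => by
    rw [LinearMap.mem_ker, LinearMap.sub_apply, sub_eq_zero]
    rfl
  have hle : gradedPiece b j ≤ A := by
    rw [gradedPiece, sup_le_iff, Submodule.span_le]
    constructor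
    · rintro _ ⟨m, rfl⟩
      rw [SetLike.mem_coe, hA, lie_loopMk, hδ]
      simp [-zsmul_eq_mul, -smul_eq_mul]
    · split_ifs with h0
      · subst h0
        rw [Submodule.span_le]
        rintro _ (rfl | rfl)
        · rw [SetLike.mem_coe, hA, c₁_eq_h, h_lie_loopMk, add_zero]
        · rw [SetLike.mem_coe, hA, c₂_eq_h, h_lie_loopMk, add_zero]
      · exact bot_le
  exact (hA x).1 (hle hx)

/-- Directness of the sum comes from the universal property: the map into the loop module along the
`b₁`-coordinate with `v₀ ↦ v₀ ⊗ 1` sends `v` of degree `n` to `v ⊗ t ^ n`, and reading coefficients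
gives the projections. -/
theorem vermaGrade_isGradedBy : IsGradedBy (coord₁ b) (vermaGrade b ψ) := by
  have hlie : ∀ m i, ∀ v ∈ vermaGrade b ψ i, ⁅D m, v⁆ ∈ vermaGrade b ψ (coord₁ b m + i) :=
    fun m i v hv => lie_vermaGrade (D_mem_gradedPiece b m) hv
  refine ⟨?_, hlie⟩
  obtain ⟨f, hf, hfw⟩ := exists_verma_hom (b := b) (ψ := ψ)
    (w := loopMk (coord₁ b) (Verma b ψ) 0 (vermaGen b ψ))
    (fun m hm => by rw [lie_loopMk, vermaGen_lie_pos b ψ hm, map_zero])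
    (fun k => by
      have := vermaGen_lie_zero b ψ (D₀ b k)
      change ⁅D (k • b 1), _⁆ = _ at this
      rw [lie_loopMk, this, map_smul]
      congr 2
      simp [-zsmul_eq_mul, -smul_eq_mul])
    (fun m => by
      have := vermaGen_lie_zero b ψ (h₀ b m)
      change ⁅h m, _⁆ = _ at this
      rw [h_lie_loopMk, this, map_smul])
  have key : ∀ n, ∀ v ∈ vermaGrade b ψ n, f v = loopMk (coord₁ b) (Verma b ψ) n v := fun n => by
    have : vermaGrade b ψ n ≤ LinearMap.ker (f - loopMk (coord₁ b) (Verma b ψ) n) := by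
      refine Submodule.span_le.2 ?_
      rintro _ ⟨l, hl, hn, rfl⟩
      rw [SetLike.mem_coe, LinearMap.mem_ker, LinearMap.sub_apply, sub_eq_zero]
      induction l generalizing n with
      | nil =>
        simp only [List.map_nil, List.sum_nil] at hn
        subst hn
        simpa using hfw
      | cons p l ih =>
        rw [List.map_cons, List.sum_cons] at hn
        rw [List.map_cons, List.prod_cons, mul_smul]
        change f ⁅p.2, _⁆ = loopMk _ _ n ⁅p.2, _⁆
        rw [hf, ih _ (fun q hq => hl q (List.mem_cons_of_mem _ hq)) rfl,
          lie_loopMk_of_mem (fun m => rfl) (hl p List.mem_cons_self), ← hn, add_comm]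
    intro v hv
    have := this hv
    rwa [LinearMap.mem_ker, LinearMap.sub_apply, sub_eq_zero] at this
  refine isInternal_of_proj ?_ (fun n => loopCoeff (coord₁ b) (Verma b ψ) n ∘ₗ f)
    (fun i x hx => ?_) fun i j hij x hx => ?_
  · rw [eq_top_iff]
    have hst : ∀ m, ∀ v ∈ ⨆ i, vermaGrade b ψ i, ⁅D m, v⁆ ∈ ⨆ i, vermaGrade b ψ i := fun m v hv => by
      have : (⨆ i, vermaGrade b ψ i) ≤ (⨆ i, vermaGrade b ψ i).comap (act (D m)) :=
        iSup_le fun i v hv => Submodule.mem_iSup_of_mem _ (hlie m i v hv)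
      exact this hv
    have : LieSubmodule.lieSpan ℂ VirasoroLike {vermaGen b ψ} ≤ ofStable _ hst := by
      rw [LieSubmodule.lieSpan_le]
      rintro _ rfl
      exact Submodule.mem_iSup_of_mem 0 vermaGen_mem
    rw [lieSpan_vermaGen] at this
    exact fun v _ => this (LieSubmodule.mem_top v)
  · rw [LinearMap.comp_apply, key i x hx, loopCoeff_loopMk, if_pos rfl]
  · rw [LinearMap.comp_apply, key j x hx, loopCoeff_loopMk, if_neg hij]

end Verma

section GradedBy

variable {ι : Type*} [DecidableEq ι] [AddCommGroup ι] {φ : ℤ × ℤ →+ ι}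
  {M : Type*} [AddCommGroup M] [Module ℂ M] [LieRingModule VirasoroLike M]
  [LieModule ℂ VirasoroLike M] {𝒢 : ι → Submodule ℂ M}

theorem gproj_quotient (hI : DirectSum.IsInternal 𝒢) {N : LieSubmodule ℂ VirasoroLike M}
    (hJ : DirectSum.IsInternal fun i =>
      (𝒢 i).map (LieSubmodule.Quotient.mk' N : M →ₗ[ℂ] M ⧸ N)) (i : ι) (x : M) :
    gproj hJ i (LieSubmodule.Quotient.mk' N x) = LieSubmodule.Quotient.mk' N (gproj hI i x) := by
  refine gproj_induction hI (p := fun x => gproj hJ i (LieSubmodule.Quotient.mk' N x) =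
    LieSubmodule.Quotient.mk' N (gproj hI i x)) (by simp)
    (fun x y hx hy => by simp only [map_add, hx, hy]) (fun j x hx => ?_) x
  have hx' : LieSubmodule.Quotient.mk' N x ∈
      (𝒢 j).map (LieSubmodule.Quotient.mk' N : M →ₗ[ℂ] M ⧸ N) := ⟨x, hx, rfl⟩
  by_cases hj : j = i
  · subst hj
    rw [gproj_of_mem hI hx, gproj_of_mem hJ hx']
  · rw [gproj_of_mem_ne hI hj hx, gproj_of_mem_ne hJ hj hx', map_zero]

theorem IsGradedBy.isGradedSubspace_comap (hG : IsGradedBy φ 𝒢) {K : LieSubmodule ℂ VirasoroLike M}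
    (hK : IsGradedSubspace 𝒢 (K : Submodule ℂ M)) {N : LieSubmodule ℂ VirasoroLike (M ⧸ K)}
    (hN : IsGradedSubspace (fun i => (𝒢 i).map (LieSubmodule.Quotient.mk' K : M →ₗ[ℂ] M ⧸ K))
      (N : Submodule ℂ (M ⧸ K))) :
    IsGradedSubspace 𝒢 (N.comap (LieSubmodule.Quotient.mk' K) : Submodule ℂ M) := by
  rw [isGradedSubspace_iff hG.isInternal]
  rw [isGradedSubspace_iff (hG.quotient hK).isInternal] at hN
  intro i x hx
  have := hN i (LieSubmodule.Quotient.mk' K x) hx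
  rwa [gproj_quotient hG.isInternal] at this

theorem comap_mk_le {K : LieSubmodule ℂ VirasoroLike M} {N : LieSubmodule ℂ VirasoroLike (M ⧸ K)}
    (h : N.comap (LieSubmodule.Quotient.mk' K) ≤ K) : N = ⊥ := by
  rw [eq_bot_iff]
  intro x hx
  obtain ⟨y, rfl⟩ := LieSubmodule.Quotient.surjective_mk' K x
  have : y ∈ K := h hx
  rw [LieSubmodule.mem_bot]
  exact (LieSubmodule.Quotient.mk_eq_zero' (N := K)).2 this

theorem eq_top_of_comap_mk {K : LieSubmodule ℂ VirasoroLike M}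
    {N : LieSubmodule ℂ VirasoroLike (M ⧸ K)}
    (h : N.comap (LieSubmodule.Quotient.mk' K) = ⊤) : N = ⊤ := by
  rw [eq_top_iff]
  intro x _
  obtain ⟨y, rfl⟩ := LieSubmodule.Quotient.surjective_mk' K x
  have : y ∈ N.comap (LieSubmodule.Quotient.mk' K) := h ▸ LieSubmodule.mem_top y
  exact this

end GradedBy

/-! ### The irreducible highest weight modules -/

section VHat

variable {b : Module.Basis (Fin 2) ℤ (ℤ × ℤ)} {ψ : gradedPiece b 0 →ₗ[ℂ] ℂ}

theorem D_eq_of_repr_eq_zero {m : ℤ × ℤ} (hm : b.repr m 0 = 0) : m = b.repr m 1 • b 1 := by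
  conv_lhs => rw [← repr_smul_add b m, hm, zero_smul, zero_add]

/-- The line through `v₀` is stable under `L₀` and killed by `L₊`, so the triangular argument
applies to it. -/
theorem verma_le_sup (x : Verma b ψ) : x ∈ Submodule.span ℂ {vermaGen b ψ} ⊔
    lowPart (vermaGrade_isGradedBy (b := b) (ψ := ψ)).isInternal (AddMonoidHom.id ℤ) 0 := by
  have hG := vermaGrade_isGradedBy (b := b) (ψ := ψ)
  refine hG.lieSpan_le (d := AddMonoidHom.id ℤ) (n := 0) ?_ ?_ ?_ ?_ ?_
  · rw [Submodule.span_singleton_le_iff_mem]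
    exact mem_layer_of_mem hG.isInternal (d := AddMonoidHom.id ℤ) vermaGen_mem
  · intro m hm v hv
    obtain ⟨c, rfl⟩ := Submodule.mem_span_singleton.1 hv
    rw [D_eq_of_repr_eq_zero (b := b) hm, lie_smul]
    refine Submodule.smul_mem _ _ ?_
    have := vermaGen_lie_zero b ψ (D₀ b (b.repr m 1))
    change ⁅D (b.repr m 1 • b 1), _⁆ = _ at this
    rw [this]
    exact Submodule.smul_mem _ _ (Submodule.mem_span_singleton_self _)
  · intro m hm v hv
    obtain ⟨c, rfl⟩ := Submodule.mem_span_singleton.1 hv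
    rw [lie_smul, vermaGen_lie_pos b ψ hm, smul_zero]
  · intro m v hv
    obtain ⟨c, rfl⟩ := Submodule.mem_span_singleton.1 hv
    rw [lie_smul]
    refine Submodule.smul_mem _ _ ?_
    have := vermaGen_lie_zero b ψ (h₀ b m)
    change ⁅h m, _⁆ = _ at this
    rw [this]
    exact Submodule.smul_mem _ _ (Submodule.mem_span_singleton_self _)
  · have : (⊤ : LieSubmodule ℂ VirasoroLike (Verma b ψ)) ≤
        LieSubmodule.lieSpan ℂ VirasoroLike (Submodule.span ℂ {vermaGen b ψ} : Set (Verma b ψ)) := by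
      rw [← lieSpan_vermaGen]
      exact LieSubmodule.lieSpan_mono Submodule.subset_span
    exact this (LieSubmodule.mem_top x)

theorem exists_gproj_verma (n : ℤ) (hn : 0 ≤ n) (x : Verma b ψ) :
    ∃ c : ℂ, gproj (vermaGrade_isGradedBy (b := b) (ψ := ψ)).isInternal n x =
      if n = 0 then c • vermaGen b ψ else 0 := by
  have hG := vermaGrade_isGradedBy (b := b) (ψ := ψ)
  obtain ⟨_, ht, y, hy, rfl⟩ := Submodule.mem_sup.1 (verma_le_sup x)
  obtain ⟨c, rfl⟩ := Submodule.mem_span_singleton.1 ht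
  refine ⟨c, ?_⟩
  rw [map_add, mem_lowPart.1 hy n hn, add_zero, map_smul]
  split_ifs with h
  · subst h
    rw [gproj_of_mem _ vermaGen_mem]
  · rw [gproj_of_mem_ne _ (Ne.symm h) vermaGen_mem, smul_zero]

/-- A graded submodule with a component in degree `0` contains `v₀` and is everything. So the proper
ones all lie in negative degrees, and so does their sum. -/
theorem le_lowPart_of_graded {N : LieSubmodule ℂ VirasoroLike (Verma b ψ)}
    (hN : IsGradedSubspace (vermaGrade b ψ) (N : Submodule ℂ (Verma b ψ))) (hN' : N ≠ ⊤) :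
    (N : Submodule ℂ (Verma b ψ)) ≤
      lowPart (vermaGrade_isGradedBy (b := b) (ψ := ψ)).isInternal (AddMonoidHom.id ℤ) 0 := by
  intro x hx
  rw [mem_lowPart]
  intro n hn
  obtain ⟨c, hc⟩ := exists_gproj_verma n hn x
  split_ifs at hc with h
  · by_cases h0 : c = 0
    · rw [hc, h0, zero_smul]
    · refine absurd ?_ hN'
      rw [← top_le_iff, ← lieSpan_vermaGen, LieSubmodule.lieSpan_le]
      rintro _ rfl
      have := (isGradedSubspace_iff (vermaGrade_isGradedBy (b := b) (ψ := ψ)).isInternal).1 hN n x hx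
      rw [hc] at this
      exact (N.smul_mem_iff h0).1 this
  · exact hc

theorem vermaMax_le_lowPart : (vermaMaxSubmodule b ψ : Submodule ℂ (Verma b ψ)) ≤
    lowPart (vermaGrade_isGradedBy (b := b) (ψ := ψ)).isInternal (AddMonoidHom.id ℤ) 0 := by
  rw [vermaMaxSubmodule, LieSubmodule.sSup_toSubmodule]
  refine sSup_le ?_
  rintro _ ⟨N, ⟨hN, hN'⟩, rfl⟩
  exact le_lowPart_of_graded hN hN'

theorem vermaMax_graded :
    IsGradedSubspace (vermaGrade b ψ) (vermaMaxSubmodule b ψ : Submodule ℂ (Verma b ψ)) := by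
  rw [vermaMaxSubmodule, LieSubmodule.sSup_toSubmodule]
  refine IsGradedSubspace.sSup ?_
  rintro _ ⟨N, ⟨hN, -⟩, rfl⟩
  exact hN

theorem vHatGrade_isGradedBy : IsGradedBy (coord₁ b) (vHatGrade b ψ) :=
  vermaGrade_isGradedBy.quotient vermaMax_graded

theorem vHatGen_mem : vHatGen b ψ ∈ vHatGrade b ψ 0 := ⟨_, vermaGen_mem, rfl⟩

/-- The hypothesis that the induced module is nonzero is carried along and discharged later from the
module under study. -/
theorem vHatGen_ne_zero (hgen : vermaGen b ψ ≠ 0) : vHatGen b ψ ≠ 0 := fun h => by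
  have h1 : vermaGen b ψ ∈ vermaMaxSubmodule b ψ := LieSubmodule.Quotient.mk_eq_zero'.1 h
  have h2 := mem_lowPart.1 (vermaMax_le_lowPart h1) 0 le_rfl
  rw [gproj_of_mem _ vermaGen_mem] at h2
  exact hgen h2

theorem vHatGrade_zero_le : vHatGrade b ψ 0 ≤ Submodule.span ℂ {vHatGen b ψ} := by
  rintro _ ⟨x, hx, rfl⟩
  obtain ⟨c, hc⟩ := exists_gproj_verma 0 le_rfl x
  rw [gproj_of_mem _ hx, if_pos rfl] at hc
  rw [hc]
  exact Submodule.mem_span_singleton.2 ⟨c, rfl⟩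

theorem vHatGrade_eq_bot {n : ℤ} (hn : 0 < n) : vHatGrade b ψ n = ⊥ := by
  rw [Submodule.eq_bot_iff]
  rintro _ ⟨x, hx, rfl⟩
  obtain ⟨c, hc⟩ := exists_gproj_verma n hn.le x
  rw [gproj_of_mem _ hx, if_neg hn.ne'] at hc
  rw [hc]
  exact LinearMap.map_zero _

theorem vHat_irreducible (N : LieSubmodule ℂ VirasoroLike (VHat b ψ))
    (hN : IsGradedSubspace (vHatGrade b ψ) (N : Submodule ℂ (VHat b ψ))) : N = ⊥ ∨ N = ⊤ := by
  have h1 := vermaGrade_isGradedBy.isGradedSubspace_comap vermaMax_graded hN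
  by_cases h2 : N.comap (LieSubmodule.Quotient.mk' (vermaMaxSubmodule b ψ)) = ⊤
  · exact Or.inr (eq_top_of_comap_mk h2)
  · exact Or.inl (comap_mk_le (le_sSup ⟨h1, h2⟩))

theorem vHatGen_lie_pos {m : ℤ × ℤ} (hm : 0 < b.repr m 0) : ⁅D m, vHatGen b ψ⁆ = 0 := by
  change LieSubmodule.Quotient.mk' (vermaMaxSubmodule b ψ) ⁅D m, vermaGen b ψ⁆ = 0
  rw [vermaGen_lie_pos b ψ hm, map_zero]

theorem vHatGen_lie_zero (x : gradedPiece b 0) :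
    ⁅(x : VirasoroLike), vHatGen b ψ⁆ = ψ x • vHatGen b ψ := by
  change LieSubmodule.Quotient.mk' (vermaMaxSubmodule b ψ) ⁅(x : VirasoroLike), vermaGen b ψ⁆ = _
  rw [vermaGen_lie_zero, map_smul]
  rfl

theorem vHatGen_lie_D (k : ℤ) : ⁅D (k • b 1), vHatGen b ψ⁆ = ψ (D₀ b k) • vHatGen b ψ :=
  vHatGen_lie_zero (D₀ b k)

theorem vHatGen_lie_h (m : ℤ × ℤ) : ⁅h m, vHatGen b ψ⁆ = ψ (h₀ b m) • vHatGen b ψ :=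
  vHatGen_lie_zero (h₀ b m)

end VHat

/-! ### The loop module `V(ψ)` -/

section VPsi

variable {b : Module.Basis (Fin 2) ℤ (ℤ × ℤ)} {ψ : gradedPiece b 0 →ₗ[ℂ] ℂ}

theorem loopMk_mem_vPsiGrade {n k : ℤ} {v : VHat b ψ} (hv : v ∈ vHatGrade b ψ n) :
    loopMk (coord₂ b) (VHat b ψ) k v ∈ vPsiGrade b ψ (n • b 0 + k • b 1) := by
  have e0 : b.repr (n • b 0 + k • b 1) 0 = n := by simp [-zsmul_eq_mul, -smul_eq_mul]
  have e1 : b.repr (n • b 0 + k • b 1) 1 = k := by simp [-zsmul_eq_mul, -smul_eq_mul]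
  rw [vPsiGrade, e0, e1]
  exact ⟨v, hv, rfl⟩

theorem vPsi_isGradedModule : IsGradedModule (VPsi b ψ) (vPsiGrade b ψ) := by
  have hG := vHatGrade_isGradedBy (b := b) (ψ := ψ)
  refine ⟨isInternal_of_proj ?_ (fun γ => loopMk (coord₂ b) (VHat b ψ) (b.repr γ 1) ∘ₗ
    gproj hG.isInternal (b.repr γ 0) ∘ₗ loopCoeff (coord₂ b) (VHat b ψ) (b.repr γ 1)) ?_ ?_, ?_⟩
  · rw [eq_top_iff]
    intro x _
    induction x using loop_induction with
    | h0 => exact zero_mem _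
    | hadd x y hx hy => exact add_mem (hx trivial) (hy trivial)
    | h k v =>
      refine gproj_induction hG.isInternal
        (p := fun v => loopMk (coord₂ b) (VHat b ψ) k v ∈ ⨆ i, vPsiGrade b ψ i)
        (by rw [map_zero]; exact zero_mem _)
        (fun x y hx hy => by rw [map_add]; exact add_mem hx hy) (fun n x hx => ?_) v
      exact Submodule.mem_iSup_of_mem _ (loopMk_mem_vPsiGrade hx)
  · rintro γ _ ⟨x, hx, rfl⟩
    simp only [LinearMap.comp_apply]
    rw [loopCoeff_loopMk, if_pos rfl, gproj_of_mem _ hx]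
  · rintro γ γ' hγ _ ⟨x, hx, rfl⟩
    simp only [LinearMap.comp_apply]
    rw [loopCoeff_loopMk]
    split_ifs with h1
    · rw [gproj_of_mem_ne _ (fun h0 => hγ (repr_ext b h0 h1)) hx, LinearMap.map_zero]
    · rw [LinearMap.map_zero, LinearMap.map_zero]
  · rintro m γ _ ⟨x, hx, rfl⟩
    rw [lie_loopMk]
    refine ⟨⁅D m, x⁆, ?_, ?_⟩
    · have := hG.lie_mem m _ x hx
      rwa [repr_add]
    · rw [repr_add, add_comm]
      rfl

theorem lie_topVec (j k : ℤ) : ⁅D (j • b 1), topVec b ψ k⁆ = ψ (D₀ b j) • topVec b ψ (k + j) := by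
  rw [topVec, lie_loopMk, vHatGen_lie_D, LinearMap.map_smul]
  congr 2
  simp [-zsmul_eq_mul, -smul_eq_mul]

theorem h_lie_topVec (m : ℤ × ℤ) (k : ℤ) : ⁅h m, topVec b ψ k⁆ = ψ (h₀ b m) • topVec b ψ k := by
  rw [topVec, h_lie_loopMk, vHatGen_lie_h, LinearMap.map_smul]

theorem lie_topVec_pos {m : ℤ × ℤ} (hm : 0 < b.repr m 0) (k : ℤ) : ⁅D m, topVec b ψ k⁆ = 0 := by
  rw [topVec, lie_loopMk, vHatGen_lie_pos hm, LinearMap.map_zero]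

theorem topVec_mem (k : ℤ) : topVec b ψ k ∈ vPsiGrade b ψ (k • b 1) := by
  have := loopMk_mem_vPsiGrade (k := k) (vHatGen_mem (b := b) (ψ := ψ))
  rwa [zero_smul, zero_add] at this

theorem topVec_ne_zero (hgen : vermaGen b ψ ≠ 0) (k : ℤ) : topVec b ψ k ≠ 0 := fun h =>
  vHatGen_ne_zero hgen (loopMk_injective k (h.trans (LinearMap.map_zero _).symm))

theorem vPsiGrade_le (k : ℤ) : vPsiGrade b ψ (k • b 1) ≤ Submodule.span ℂ {topVec b ψ k} := by
  have e0 : b.repr (k • b 1) 0 = 0 := by simp [-zsmul_eq_mul, -smul_eq_mul]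
  have e1 : b.repr (k • b 1) 1 = k := by simp [-zsmul_eq_mul, -smul_eq_mul]
  rw [vPsiGrade, e0, e1]
  rintro _ ⟨x, hx, rfl⟩
  obtain ⟨c, rfl⟩ := Submodule.mem_span_singleton.1 (vHatGrade_zero_le hx)
  rw [LinearMap.map_smul]
  exact Submodule.smul_mem _ _ (Submodule.mem_span_singleton_self _)

theorem vPsiGrade_eq_bot {γ : ℤ × ℤ} (hγ : 0 < b.repr γ 0) : vPsiGrade b ψ γ = ⊥ := by
  rw [vPsiGrade, vHatGrade_eq_bot hγ, Submodule.map_bot]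

/-- The `v` for which all `v ⊗ t ^ k` lie in the span form a submodule of the induced module
containing its generator; all `k` are needed at once because the action changes the exponent. -/
theorem lieSpan_topVec : LieSubmodule.lieSpan ℂ VirasoroLike (Set.range (topVec b ψ)) = ⊤ := by
  let N := LieSubmodule.lieSpan ℂ VirasoroLike (Set.range (topVec b ψ))
  let P : Submodule ℂ (Verma b ψ) := ⨅ k : ℤ, (N : Submodule ℂ (VPsi b ψ)).comap
    (loopMk (coord₂ b) (VHat b ψ) k ∘ₗ
      (LieSubmodule.Quotient.mk' (vermaMaxSubmodule b ψ) : _ →ₗ[ℂ] VHat b ψ))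
  have memP : ∀ v, v ∈ P ↔ ∀ k, loopMk (coord₂ b) (VHat b ψ) k
      (LieSubmodule.Quotient.mk' (vermaMaxSubmodule b ψ) v) ∈ N := fun v => by
    simp only [P, Submodule.mem_iInf]; rfl
  have hP : ∀ m, ∀ v ∈ P, ⁅D m, v⁆ ∈ P := fun m v hv => by
    rw [memP] at hv ⊢
    intro k
    have := N.lie_mem (x := D m) (hv (k - coord₂ b m))
    rwa [lie_loopMk, sub_add_cancel] at this
  have hPt : (⊤ : LieSubmodule ℂ VirasoroLike (Verma b ψ)) ≤ ofStable P hP := by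
    rw [← lieSpan_vermaGen, LieSubmodule.lieSpan_le]
    rintro _ rfl
    exact (memP _).2 fun k => LieSubmodule.subset_lieSpan ⟨k, rfl⟩
  rw [eq_top_iff]
  intro x _
  induction x using loop_induction with
  | h0 => exact zero_mem _
  | hadd x y hx hy => exact add_mem (hx trivial) (hy trivial)
  | h k v =>
    obtain ⟨y, rfl⟩ := LieSubmodule.Quotient.surjective_mk' (vermaMaxSubmodule b ψ) v
    exact (memP y).1 (hPt (LieSubmodule.mem_top y)) k

end VPsi

/-- An irreducible graded module whose top layer is spanned by vectors `t k` of degree `γ₀ + k b₂`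
on which the `D(j b₂)` act as multiples, prescribed by `ψ`, of the shift by `j`. -/
structure IsShiftModule {V : Type*} [AddCommGroup V] [Module ℂ V] [LieRingModule VirasoroLike V]
    [LieModule ℂ VirasoroLike V] (𝒱 : ℤ × ℤ → Submodule ℂ V)
    (b : Module.Basis (Fin 2) ℤ (ℤ × ℤ)) (ψ : gradedPiece b 0 →ₗ[ℂ] ℂ) (γ₀ : ℤ × ℤ) (s : ℕ)
    (t : ℤ → V) : Prop where
  graded : IsGradedModule V 𝒱
  irreducible : IsGradedIrreducible V 𝒱
  top : ∀ γ, b.repr γ₀ 0 < b.repr γ 0 → 𝒱 γ = ⊥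
  mem : ∀ k, t k ∈ 𝒱 (γ₀ + k • b 1)
  ne_zero_iff : ∀ k, t k ≠ 0 ↔ (s : ℤ) ∣ k
  lie_D : ∀ j k, ⁅D (j • b 1), t k⁆ = ψ (D₀ b j) • t (k + j)
  lie_h : ∀ m k, ⁅h m, t k⁆ = ψ (h₀ b m) • t k
  le_span : ∀ k, 𝒱 (γ₀ + k • b 1) ≤ Submodule.span ℂ {t k}

/-! ### The quotient by the largest graded submodule avoiding `W_i`. -/

section VBar

variable {b : Module.Basis (Fin 2) ℤ (ℤ × ℤ)} {ψ : gradedPiece b 0 →ₗ[ℂ] ℂ}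

theorem gproj_topVec (γ : ℤ × ℤ) (j : ℤ) :
    gproj (vPsi_isGradedModule (b := b) (ψ := ψ)).isInternal γ (topVec b ψ j) =
      if γ = j • b 1 then topVec b ψ j else 0 := by
  split_ifs with h
  · subst h; exact gproj_of_mem _ (topVec_mem j)
  · exact gproj_of_mem_ne _ (Ne.symm h) (topVec_mem j)

theorem smul_b₂_inj {j k : ℤ} : j • b 1 = k • b 1 ↔ j = k :=
  ⟨fun h => smul_left_injective ℤ (b.ne_zero 1) h, fun h => h ▸ rfl⟩

theorem gproj_eq_zero_of_mem_span {A : Set ℤ} {x : VPsi b ψ}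
    (hx : x ∈ Submodule.span ℂ (topVec b ψ '' A)) {γ : ℤ × ℤ} (hγ : ∀ j ∈ A, γ ≠ j • b 1) :
    gproj (vPsi_isGradedModule (b := b) (ψ := ψ)).isInternal γ x = 0 := by
  have : Submodule.span ℂ (topVec b ψ '' A) ≤
      LinearMap.ker (gproj (vPsi_isGradedModule (b := b) (ψ := ψ)).isInternal γ) := by
    refine Submodule.span_le.2 ?_
    rintro _ ⟨j, hj, rfl⟩
    rw [SetLike.mem_coe, LinearMap.mem_ker, gproj_topVec, if_neg (hγ j hj)]
  exact this hx

theorem topVec_mem_span_iff (hgen : vermaGen b ψ ≠ 0) {A : Set ℤ} {j : ℤ} :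
    topVec b ψ j ∈ Submodule.span ℂ (topVec b ψ '' A) ↔ j ∈ A := by
  refine ⟨fun h => ?_, fun h => Submodule.subset_span ⟨j, h, rfl⟩⟩
  by_contra hj
  have := gproj_eq_zero_of_mem_span h (γ := j • b 1)
    fun k hk hjk => hj (smul_b₂_inj.1 hjk ▸ hk)
  rw [gproj_topVec, if_pos rfl] at this
  exact topVec_ne_zero hgen j this

/-- `D(k b₂)` moves `v₀ ⊗ t ^ j` to `v₀ ⊗ t ^ (j + k)` exactly when `ψ(D(k b₂)) ≠ 0`, so the
exponents reached from `i` form a translate of the monoid generated by these `k`. -/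
theorem W_eq (i : ℤ) : W b ψ i = Submodule.span ℂ
    (topVec b ψ '' {j | j - i ∈ AddSubmonoid.closure {k | ψ (D₀ b k) ≠ 0}}) := by
  set R := Submodule.span ℂ
    (topVec b ψ '' {j | j - i ∈ AddSubmonoid.closure {k | ψ (D₀ b k) ≠ 0}}) with hR
  refine le_antisymm ?_ ?_
  · let A : LieSubalgebra ℂ VirasoroLike :=
      { carrier := {x | ∀ v ∈ R, ⁅x, v⁆ ∈ R}
        zero_mem' := fun v _ => by rw [zero_lie]; exact zero_mem _
        add_mem' := fun {x y} hx hy v hv => by rw [add_lie]; exact add_mem (hx v hv) (hy v hv)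
        smul_mem' := fun c x hx v hv => by rw [smul_lie]; exact R.smul_mem _ (hx v hv)
        lie_mem' := fun {x y} hx hy v hv => by
          rw [lie_lie]; exact sub_mem (hx _ (hy v hv)) (hy _ (hx v hv)) }
    have hA : ∀ x, (∀ j, j - i ∈ AddSubmonoid.closure {k | ψ (D₀ b k) ≠ 0} →
        ⁅x, topVec b ψ j⁆ ∈ R) → x ∈ A := fun x hx v hv => by
      have : R ≤ R.comap (act x) := by
        refine Submodule.span_le.2 ?_
        rintro _ ⟨j, hj, rfl⟩
        exact hx j hj
      exact this hv
    have hle : heisenberg b ≤ A := by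
      refine LieSubalgebra.lieSpan_le.2 ?_
      rintro _ (rfl | ⟨k, rfl⟩)
      · refine hA _ fun j hj => ?_
        rw [h_lie_topVec]
        exact R.smul_mem _ (Submodule.subset_span ⟨j, hj, rfl⟩)
      · refine hA _ fun j hj => ?_
        dsimp only
        rw [lie_topVec]
        by_cases h0 : ψ (D₀ b k) = 0
        · rw [h0, zero_smul]; exact zero_mem _
        · refine R.smul_mem _ (Submodule.subset_span ⟨j + k, ?_, rfl⟩)
          rw [Set.mem_ofPred_eq, add_sub_right_comm]
          exact add_mem hj (AddSubmonoid.subset_closure h0)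
    let R' : LieSubmodule ℂ (heisenberg b) (VPsi b ψ) :=
      { R with lie_mem := fun {x v} hv => hle x.2 v hv }
    have : LieSubmodule.lieSpan ℂ (heisenberg b) {topVec b ψ i} ≤ R' := by
      rw [LieSubmodule.lieSpan_le]
      rintro _ rfl
      exact Submodule.subset_span ⟨i, by simp, rfl⟩
    exact this
  · have key : ∀ k ∈ AddSubmonoid.closure {k | ψ (D₀ b k) ≠ 0}, ∀ l, topVec b ψ l ∈ W b ψ i →
        topVec b ψ (l + k) ∈ W b ψ i := fun k hk => by
      induction hk using AddSubmonoid.closure_induction with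
      | mem k hk =>
        intro l hl
        have h1 : D (k • b 1) ∈ heisenberg b :=
          LieSubalgebra.subset_lieSpan (Set.mem_insert_of_mem _ ⟨k, rfl⟩)
        have h2 : ⁅(⟨D (k • b 1), h1⟩ : heisenberg b), topVec b ψ l⁆ ∈ W b ψ i :=
          (LieSubmodule.lieSpan ℂ (heisenberg b) {topVec b ψ i}).lie_mem hl
        change ⁅D (k • b 1), topVec b ψ l⁆ ∈ W b ψ i at h2
        rw [lie_topVec] at h2
        exact ((W b ψ i).smul_mem_iff hk).1 h2
      | zero => intro l hl; rwa [add_zero]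
      | add j k _ _ hj hk => intro l hl; rw [← add_assoc]; exact hk _ (hj _ hl)
    refine Submodule.span_le.2 ?_
    rintro _ ⟨j, hj, rfl⟩
    have := key _ hj i (LieSubmodule.subset_lieSpan rfl)
    rwa [add_sub_cancel] at this

theorem hasPeriod_iff (hgen : vermaGen b ψ ≠ 0) {i : ℤ} {s : ℕ} :
    HasPeriod b ψ i s ↔
      ∀ k, k ∈ AddSubmonoid.closure {k | ψ (D₀ b k) ≠ 0} ↔ (s : ℤ) ∣ k := by
  have hr : Set.range (fun k : ℤ => topVec b ψ (i + s * k)) =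
      topVec b ψ '' {j | (s : ℤ) ∣ j - i} := by
    ext x
    constructor
    · rintro ⟨k, rfl⟩
      exact ⟨i + s * k, by simp, rfl⟩
    · rintro ⟨j, ⟨k, hk⟩, rfl⟩
      exact ⟨k, by dsimp only; rw [← hk, add_sub_cancel]⟩
  rw [HasPeriod, W_eq, hr]
  constructor
  · intro h k
    have h1 := topVec_mem_span_iff hgen (j := i + k)
      (A := {j | j - i ∈ AddSubmonoid.closure {k | ψ (D₀ b k) ≠ 0}})
    have h2 := topVec_mem_span_iff hgen (j := i + k) (A := {j | (s : ℤ) ∣ j - i})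
    rw [h] at h1
    have := h1.symm.trans h2
    simpa only [Set.mem_ofPred_eq, add_sub_cancel_left] using this
  · intro h
    simp only [h]

variable {i : ℤ} {s : ℕ}
  (hper : ∀ k, k ∈ AddSubmonoid.closure {k | ψ (D₀ b k) ≠ 0} ↔ (s : ℤ) ∣ k)
include hper

theorem W_eq_of_period : W b ψ i = Submodule.span ℂ (topVec b ψ '' {j | (s : ℤ) ∣ j - i}) := by
  rw [W_eq]
  simp only [hper]

/-- The degree subspaces of `W_i` are lines, so a graded submodule avoids `W_i` when it has no
component in those degrees. This condition passes to sums, so the kernel itself avoids `W_i`. -/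
theorem graded_inf_W_iff {N : LieSubmodule ℂ VirasoroLike (VPsi b ψ)}
    (hN : IsGradedSubspace (vPsiGrade b ψ) (N : Submodule ℂ (VPsi b ψ))) :
    (N : Submodule ℂ (VPsi b ψ)) ⊓ W b ψ i = ⊥ ↔ ∀ x ∈ N, ∀ j, (s : ℤ) ∣ j - i →
      gproj (vPsi_isGradedModule (b := b) (ψ := ψ)).isInternal (j • b 1) x = 0 := by
  rw [W_eq_of_period hper]
  constructor
  · intro h x hx j hj
    have h1 := (isGradedSubspace_iff vPsi_isGradedModule.isInternal).1 hN (j • b 1) x hx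
    have h2 := vPsiGrade_le j (gproj_mem (vPsi_isGradedModule (b := b) (ψ := ψ)).isInternal _ x)
    have h3 : Submodule.span ℂ {topVec b ψ j} ≤
        Submodule.span ℂ (topVec b ψ '' {j | (s : ℤ) ∣ j - i}) :=
      Submodule.span_mono (Set.singleton_subset_iff.2 ⟨j, hj, rfl⟩)
    replace h3 := h3 h2
    exact (Submodule.mem_bot ℂ).1 (h ▸ Submodule.mem_inf.2 ⟨h1, h3⟩)
  · intro h
    rw [Submodule.eq_bot_iff]
    rintro x ⟨hx, hx'⟩
    refine eq_zero_of_gproj vPsi_isGradedModule.isInternal fun γ => ?_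
    by_cases hγ : ∃ j, (s : ℤ) ∣ j - i ∧ γ = j • b 1
    · obtain ⟨j, hj, rfl⟩ := hγ
      exact h x hx j hj
    · exact gproj_eq_zero_of_mem_span hx' fun j hj hγj => hγ ⟨j, hj, hγj⟩

theorem vBarKernel_gproj {x : VPsi b ψ} (hx : x ∈ vBarKernel b ψ i) {j : ℤ}
    (hj : (s : ℤ) ∣ j - i) :
    gproj (vPsi_isGradedModule (b := b) (ψ := ψ)).isInternal (j • b 1) x = 0 := by
  have : (vBarKernel b ψ i : Submodule ℂ (VPsi b ψ)) ≤
      LinearMap.ker (gproj (vPsi_isGradedModule (b := b) (ψ := ψ)).isInternal (j • b 1)) := by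
    rw [vBarKernel, LieSubmodule.sSup_toSubmodule]
    refine sSup_le ?_
    rintro _ ⟨N, ⟨hN, hN'⟩, rfl⟩ y hy
    exact (graded_inf_W_iff hper hN).1 hN' y hy j hj
  exact this hx

/-- The top vectors in the residue class of `j` modulo `s` span a space stable under `L₀`, so the
submodule they generate meets the top layer only in that class and misses `W_i`. -/
theorem topVec_mem_vBarKernel {j : ℤ} (hj : ¬ (s : ℤ) ∣ j - i) :
    topVec b ψ j ∈ vBarKernel b ψ i := by
  have hG := isGradedBy_id_iff.2 (vPsi_isGradedModule (b := b) (ψ := ψ))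
  have hgr := hG.isGradedSubspace_lieSpan_of_homogeneous (T := {topVec b ψ j})
    (by rintro _ rfl; exact ⟨_, topVec_mem j⟩)
  have hmem : LieSubmodule.lieSpan ℂ VirasoroLike {topVec b ψ j} ≤ vBarKernel b ψ i := by
    refine le_sSup ⟨hgr, (graded_inf_W_iff hper hgr).2 fun x hx l hl => ?_⟩
    set T := Submodule.span ℂ (topVec b ψ '' {l | (s : ℤ) ∣ l - j}) with hT
    have hstab : ∀ y, (∀ l, (s : ℤ) ∣ l - j → ⁅y, topVec b ψ l⁆ ∈ T) →
        ∀ v ∈ T, ⁅y, v⁆ ∈ T := fun y hy v hv => by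
      have : T ≤ T.comap (act y) := by
        refine Submodule.span_le.2 ?_
        rintro _ ⟨l, hl, rfl⟩
        exact hy l hl
      exact this hv
    have h1 := hG.lieSpan_le (d := coord₁ b) (n := 0) (T := T) ?_ ?_ ?_ ?_
      ((LieSubmodule.lieSpan_mono (Set.singleton_subset_iff.2
        (Submodule.subset_span ⟨j, by simp, rfl⟩) : {topVec b ψ j} ⊆ (T : Set (VPsi b ψ)))) hx)
    · obtain ⟨y, hy, z, hz, rfl⟩ := Submodule.mem_sup.1 h1
      rw [map_add, gproj_eq_zero_of_mem_span hy fun k hk hlk => ?_,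
        mem_lowPart.1 hz _ (by simp [-zsmul_eq_mul, -smul_eq_mul]), add_zero]
      rw [smul_b₂_inj] at hlk
      subst hlk
      rw [Set.mem_ofPred_eq] at hk
      have := dvd_sub hl hk
      rw [sub_sub_sub_cancel_left] at this
      exact hj this
    · refine Submodule.span_le.2 ?_
      rintro _ ⟨l, -, rfl⟩
      have := mem_layer_of_mem hG.isInternal (d := coord₁ b) (topVec_mem (b := b) (ψ := ψ) l)
      simpa [-zsmul_eq_mul, -smul_eq_mul] using this
    · intro m hm
      refine hstab _ fun l hl => ?_
      replace hm : b.repr m 0 = 0 := hm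
      rw [D_eq_of_repr_eq_zero (b := b) hm, lie_topVec]
      by_cases h0 : ψ (D₀ b (b.repr m 1)) = 0
      · rw [h0, zero_smul]; exact zero_mem _
      · refine T.smul_mem _ (Submodule.subset_span ⟨_, ?_, rfl⟩)
        rw [Set.mem_ofPred_eq, add_sub_right_comm]
        exact dvd_add hl ((hper _).1 (AddSubmonoid.subset_closure h0))
    · intro m hm v hv
      have : T ≤ LinearMap.ker (act (D m)) := by
        refine Submodule.span_le.2 ?_
        rintro _ ⟨l, -, rfl⟩
        exact lie_topVec_pos hm l
      exact this hv
    · intro m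
      refine hstab _ fun l hl => ?_
      rw [h_lie_topVec]
      exact T.smul_mem _ (Submodule.subset_span ⟨l, hl, rfl⟩)
  exact hmem (LieSubmodule.subset_lieSpan rfl)

omit hper in
theorem vBarKernel_graded :
    IsGradedSubspace (vPsiGrade b ψ) (vBarKernel b ψ i : Submodule ℂ (VPsi b ψ)) := by
  rw [vBarKernel, LieSubmodule.sSup_toSubmodule]
  refine IsGradedSubspace.sSup ?_
  rintro _ ⟨N, ⟨hN, -⟩, rfl⟩
  exact hN

omit hper in
theorem vBar_isGradedModule : IsGradedModule (VBar b ψ i) (vBarGrade b ψ i) :=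
  isGradedBy_id_iff.1 ((isGradedBy_id_iff.2 vPsi_isGradedModule).quotient vBarKernel_graded)

/-- The image of `v₀ ⊗ t ^ k` in `V̄(ψ, i, s)`. -/
def barVec (b : Module.Basis (Fin 2) ℤ (ℤ × ℤ)) (ψ : gradedPiece b 0 →ₗ[ℂ] ℂ) (i k : ℤ) :
    VBar b ψ i := LieSubmodule.Quotient.mk' (vBarKernel b ψ i) (topVec b ψ k)

theorem barVec_ne_zero_iff (hgen : vermaGen b ψ ≠ 0) {j : ℤ} :
    barVec b ψ i j ≠ 0 ↔ (s : ℤ) ∣ j - i := by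
  rw [barVec, Ne, LieSubmodule.Quotient.mk_eq_zero]
  constructor
  · intro h
    by_contra hj
    exact h (topVec_mem_vBarKernel hper hj)
  · intro hj h
    have := vBarKernel_gproj hper h hj
    rw [gproj_topVec, if_pos rfl] at this
    exact topVec_ne_zero hgen j this

/-- A graded submodule meeting `W_i` contains one `v₀ ⊗ t ^ j` with `j ≡ i` modulo `s`, hence by the
period all of them. The other top vectors vanish in the quotient, and top vectors generate. -/
theorem vBar_irreducible (hgen : vermaGen b ψ ≠ 0) :
    IsGradedIrreducible (VBar b ψ i) (vBarGrade b ψ i) := by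
  refine ⟨⟨⟨barVec b ψ i i, 0, (barVec_ne_zero_iff hper hgen).2 (by simp)⟩⟩, fun N hN => ?_⟩
  have h1 := (isGradedBy_id_iff.2 (vPsi_isGradedModule (b := b) (ψ := ψ))).isGradedSubspace_comap
    vBarKernel_graded hN
  set N' := N.comap (LieSubmodule.Quotient.mk' (vBarKernel b ψ i)) with hN'
  by_cases h2 : (N' : Submodule ℂ (VPsi b ψ)) ⊓ W b ψ i = ⊥
  · exact Or.inl (comap_mk_le (le_sSup ⟨h1, h2⟩))
  · refine Or.inr (eq_top_of_comap_mk ?_)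
    rw [graded_inf_W_iff hper h1] at h2
    push Not at h2
    obtain ⟨x, hx, j, hj, hxj⟩ := h2
    have hx' := (isGradedSubspace_iff vPsi_isGradedModule.isInternal).1 h1 (j • b 1) x hx
    obtain ⟨c, hc⟩ := Submodule.mem_span_singleton.1
      (vPsiGrade_le j (gproj_mem (vPsi_isGradedModule (b := b) (ψ := ψ)).isInternal _ x))
    have hjN : topVec b ψ j ∈ N' := by
      have hc0 : c ≠ 0 := by
        rintro rfl
        exact hxj (by rw [← hc, zero_smul])
      rw [← hc] at hx'
      exact (N'.smul_mem_iff hc0).1 hx'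
    have key : ∀ k ∈ AddSubmonoid.closure {k | ψ (D₀ b k) ≠ 0}, ∀ l, topVec b ψ l ∈ N' →
        topVec b ψ (l + k) ∈ N' := fun k hk => by
      induction hk using AddSubmonoid.closure_induction with
      | mem k hk =>
        intro l hl
        have h2 := N'.lie_mem (x := D (k • b 1)) hl
        rw [lie_topVec] at h2
        exact (N'.smul_mem_iff hk).1 h2
      | zero => intro l hl; rwa [add_zero]
      | add j k _ _ hj hk => intro l hl; rw [← add_assoc]; exact hk _ (hj _ hl)
    rw [← top_le_iff, ← lieSpan_topVec, LieSubmodule.lieSpan_le]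
    rintro _ ⟨l, rfl⟩
    by_cases hl : (s : ℤ) ∣ l - i
    · have := key (l - j) ((hper _).2 (by
        have := dvd_sub hl hj
        rwa [sub_sub_sub_cancel_right] at this)) j hjN
      rwa [add_sub_cancel] at this
    · change LieSubmodule.Quotient.mk' (vBarKernel b ψ i) (topVec b ψ l) ∈ N
      rw [(LieSubmodule.Quotient.mk_eq_zero (N := vBarKernel b ψ i)).2
        (topVec_mem_vBarKernel hper hl)]
      exact zero_mem _

/-- Indexing from `i` makes the nonzero top vectors those with `s ∣ k`. -/
theorem vBar_isShiftModule (hgen : vermaGen b ψ ≠ 0) :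
    IsShiftModule (vBarGrade b ψ i) b ψ (i • b 1) s (fun k => barVec b ψ i (i + k)) where
  graded := vBar_isGradedModule
  irreducible := vBar_irreducible hper hgen
  top γ hγ := by
    rw [vBarGrade, vPsiGrade_eq_bot, Submodule.map_bot]
    simpa [-zsmul_eq_mul, -smul_eq_mul] using hγ
  mem k := by
    rw [← add_smul]
    exact ⟨_, topVec_mem _, rfl⟩
  ne_zero_iff k := by
    rw [barVec_ne_zero_iff hper hgen, add_sub_cancel_left]
  lie_D j k := by
    change LieSubmodule.Quotient.mk' (vBarKernel b ψ i) ⁅D (j • b 1), topVec b ψ (i + k)⁆ = _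
    rw [lie_topVec, map_smul, add_assoc]
    rfl
  lie_h m k := by
    change LieSubmodule.Quotient.mk' (vBarKernel b ψ i) ⁅h m, topVec b ψ (i + k)⁆ = _
    rw [h_lie_topVec, map_smul]
    rfl
  le_span k := by
    rw [← add_smul]
    rintro _ ⟨x, hx, rfl⟩
    obtain ⟨c, rfl⟩ := Submodule.mem_span_singleton.1 (vPsiGrade_le _ hx)
    exact Submodule.mem_span_singleton.2 ⟨c, rfl⟩

end VBar

theorem gproj_eq_of_proj {ι M : Type*} [DecidableEq ι] [AddCommGroup M] [Module ℂ M]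
    {𝒢 : ι → Submodule ℂ M} (hI : DirectSum.IsInternal 𝒢) (p : ι → M →ₗ[ℂ] M)
    (hp : ∀ i, ∀ x ∈ 𝒢 i, p i x = x) (hp' : ∀ i j, j ≠ i → ∀ x ∈ 𝒢 j, p i x = 0) (i : ι) (x : M) :
    gproj hI i x = p i x := by
  refine gproj_induction hI (p := fun x => gproj hI i x = p i x) (by simp)
    (fun x y hx hy => by simp only [map_add, hx, hy]) (fun j x hx => ?_) x
  by_cases hj : j = i
  · subst hj; rw [gproj_of_mem hI hx, hp _ x hx]
  · rw [gproj_of_mem_ne hI hj hx, hp' _ _ hj x hx]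

/-! ### Uniqueness of the irreducible module with a given top layer. -/

section Product

variable {V V' : Type*} [AddCommGroup V] [Module ℂ V] [LieRingModule VirasoroLike V]
  [LieModule ℂ VirasoroLike V] [AddCommGroup V'] [Module ℂ V'] [LieRingModule VirasoroLike V']
  [LieModule ℂ VirasoroLike V']

instance : LieRingModule VirasoroLike (V × V') where
  bracket x v := (⁅x, v.1⁆, ⁅x, v.2⁆)
  add_lie x y v := Prod.ext (add_lie x y v.1) (add_lie x y v.2)
  lie_add x v w := Prod.ext (lie_add x v.1 w.1) (lie_add x v.2 w.2)
  leibniz_lie x y v := Prod.ext (leibniz_lie x y v.1) (leibniz_lie x y v.2)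

instance : LieModule ℂ VirasoroLike (V × V') where
  smul_lie c x v := Prod.ext (smul_lie c x v.1) (smul_lie c x v.2)
  lie_smul c x v := Prod.ext (lie_smul c x v.1) (lie_smul c x v.2)

theorem lie_prod (x : VirasoroLike) (v : V) (v' : V') : ⁅x, (v, v')⁆ = (⁅x, v⁆, ⁅x, v'⁆) := rfl

/-- The grading of `V × V'` for which `V` and `V'` are shifted by `γ₀` and `γ₀'`. -/
def prodGrade (𝒱 : ℤ × ℤ → Submodule ℂ V) (𝒱' : ℤ × ℤ → Submodule ℂ V') (γ₀ γ₀' γ : ℤ × ℤ) :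
    Submodule ℂ (V × V') := (𝒱 (γ₀ + γ)).prod (𝒱' (γ₀' + γ))

variable {𝒱 : ℤ × ℤ → Submodule ℂ V} {𝒱' : ℤ × ℤ → Submodule ℂ V'}

theorem prodGrade_isGradedModule (hG : IsGradedModule V 𝒱) (hG' : IsGradedModule V' 𝒱')
    (γ₀ γ₀' : ℤ × ℤ) : IsGradedModule (V × V') (prodGrade 𝒱 𝒱' γ₀ γ₀') := by
  refine ⟨isInternal_of_proj ?_ (fun γ => (gproj hG.isInternal (γ₀ + γ)).prodMap
    (gproj hG'.isInternal (γ₀' + γ))) ?_ ?_, ?_⟩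
  · rw [eq_top_iff]
    rintro ⟨x, y⟩ _
    rw [show (x, y) = (x, 0) + (0, y) by simp]
    refine add_mem ?_ ?_
    · refine gproj_induction hG.isInternal
        (p := fun x => ((x, 0) : V × V') ∈ ⨆ i, prodGrade 𝒱 𝒱' γ₀ γ₀' i) (zero_mem _)
        (fun x y hx hy => by simpa using add_mem hx hy) (fun γ x hx => ?_) x
      exact Submodule.mem_iSup_of_mem (γ - γ₀) ⟨by simpa using hx, zero_mem _⟩
    · refine gproj_induction hG'.isInternal
        (p := fun y => ((0, y) : V × V') ∈ ⨆ i, prodGrade 𝒱 𝒱' γ₀ γ₀' i) (zero_mem _)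
        (fun x y hx hy => by simpa using add_mem hx hy) (fun γ x hx => ?_) y
      exact Submodule.mem_iSup_of_mem (γ - γ₀') ⟨zero_mem _, by simpa using hx⟩
  · rintro γ ⟨x, y⟩ ⟨hx, hy⟩
    exact Prod.ext (gproj_of_mem _ hx) (gproj_of_mem _ hy)
  · rintro γ γ' hγ ⟨x, y⟩ ⟨hx, hy⟩
    exact Prod.ext (gproj_of_mem_ne _ (fun h => hγ (add_left_cancel h)) hx)
      (gproj_of_mem_ne _ (fun h => hγ (add_left_cancel h)) hy)
  · rintro m γ ⟨x, y⟩ ⟨hx, hy⟩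
    refine ⟨?_, ?_⟩
    · have := hG.lie_mem m _ x hx
      rwa [add_left_comm] at this
    · have := hG'.lie_mem m _ y hy
      rwa [add_left_comm] at this

theorem gproj_prod (hG : IsGradedModule V 𝒱) (hG' : IsGradedModule V' 𝒱') (γ₀ γ₀' γ : ℤ × ℤ)
    (x : V × V') : gproj (prodGrade_isGradedModule hG hG' γ₀ γ₀').isInternal γ x =
      (gproj hG.isInternal (γ₀ + γ) x.1, gproj hG'.isInternal (γ₀' + γ) x.2) := by
  refine gproj_eq_of_proj _ (fun γ => (gproj hG.isInternal (γ₀ + γ)).prodMap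
    (gproj hG'.isInternal (γ₀' + γ))) ?_ ?_ γ x
  · rintro γ ⟨x, y⟩ ⟨hx, hy⟩
    exact Prod.ext (gproj_of_mem _ hx) (gproj_of_mem _ hy)
  · rintro γ γ' hγ ⟨x, y⟩ ⟨hx, hy⟩
    exact Prod.ext (gproj_of_mem_ne _ (fun h => hγ (add_left_cancel h)) hx)
      (gproj_of_mem_ne _ (fun h => hγ (add_left_cancel h)) hy)

variable {b : Module.Basis (Fin 2) ℤ (ℤ × ℤ)} {ψ : gradedPiece b 0 →ₗ[ℂ] ℂ} {γ₀ γ₀' : ℤ × ℤ}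
  {s : ℕ} {t : ℤ → V} {t' : ℤ → V'}

theorem IsShiftModule.lie_pos (H : IsShiftModule 𝒱 b ψ γ₀ s t) {m : ℤ × ℤ} (hm : 0 < b.repr m 0)
    (k : ℤ) : ⁅D m, t k⁆ = 0 := by
  have := H.graded.lie_mem m _ _ (H.mem k)
  rwa [H.top _ (by simpa [-zsmul_eq_mul, -smul_eq_mul] using hm), Submodule.mem_bot] at this

theorem IsShiftModule.ne_zero (H : IsShiftModule 𝒱 b ψ γ₀ s t) : t 0 ≠ 0 :=
  (H.ne_zero_iff 0).2 (dvd_zero _)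

theorem IsShiftModule.lieSpan_eq_top (H : IsShiftModule 𝒱 b ψ γ₀ s t) :
    LieSubmodule.lieSpan ℂ VirasoroLike {t 0} = ⊤ :=
  lieSpan_singleton_eq_top H.graded H.irreducible (H.mem 0) H.ne_zero

/-- Shift modules with the same parameters are isomorphic. -/
theorem IsShiftModule.exists_equiv (H : IsShiftModule 𝒱 b ψ γ₀ s t)
    (H' : IsShiftModule 𝒱' b ψ γ₀' s t') : ∃ e : V ≃ₗ⁅ℂ, VirasoroLike⁆ V', ∀ n,
      (𝒱 n).map (e : V →ₗ[ℂ] V') = 𝒱' (n + (γ₀' - γ₀)) := by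
  have hP := prodGrade_isGradedModule H.graded H'.graded γ₀ γ₀'
  have hG := isGradedBy_id_iff.2 hP
  let w : ℤ → V × V' := fun k => (t k, t' k)
  have hw : ∀ k, w k ∈ prodGrade 𝒱 𝒱' γ₀ γ₀' (k • b 1) := fun k => ⟨H.mem k, H'.mem k⟩
  let T : Submodule ℂ (V × V') := Submodule.span ℂ (Set.range w)
  have hstab : ∀ y, (∀ l, ⁅y, w l⁆ ∈ T) → ∀ v ∈ T, ⁅y, v⁆ ∈ T := fun y hy v hv => by
    have : T ≤ T.comap (act y) := by
      refine Submodule.span_le.2 ?_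
      rintro _ ⟨l, rfl⟩
      exact hy l
    exact this hv
  -- `R`, generated by the pairs of corresponding top vectors, will be the graph of the isomorphism.
  set R := LieSubmodule.lieSpan ℂ VirasoroLike (T : Set (V × V')) with hR
  have hTR : ∀ x ∈ T, x ∈ R := fun x hx => LieSubmodule.subset_lieSpan hx
  have hRg : ∀ γ, ∀ x ∈ R, gproj hP.isInternal γ x ∈ R := by
    refine (isGradedSubspace_iff hP.isInternal).1 (hG.isGradedSubspace_lieSpan fun x hx γ => ?_)
    have : T ≤ (R : Submodule ℂ (V × V')).comap (gproj hP.isInternal γ) := by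
      refine Submodule.span_le.2 ?_
      rintro _ ⟨l, rfl⟩
      rw [SetLike.mem_coe, Submodule.mem_comap]
      by_cases h : l • b 1 = γ
      · subst h
        rw [gproj_of_mem _ (hw l)]
        exact hTR _ (Submodule.subset_span ⟨l, rfl⟩)
      · rw [gproj_of_mem_ne _ h (hw l)]
        exact zero_mem _
    exact this hx
  -- Nothing new appears in the top layer of `R`, so its part in degree `0` is the line through `w
  -- 0`.
  have hRT : ∀ x ∈ R, x ∈ prodGrade 𝒱 𝒱' γ₀ γ₀' ((0 : ℤ) • b 1) → ∃ c : ℂ, x = c • w 0 :=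
    fun x hx hx0 => by
      have h1 : x ∈ T := by
        refine hG.mem_of_mem_lieSpan (d := coord₁ b) (n := 0) ?_ ?_ ?_ ?_ ?_ hx
        · refine Submodule.span_le.2 ?_
          rintro _ ⟨l, rfl⟩
          have := mem_layer_of_mem hG.isInternal (d := coord₁ b) (hw l)
          simpa [-zsmul_eq_mul, -smul_eq_mul] using this
        · intro m hm
          refine hstab _ fun l => ?_
          replace hm : b.repr m 0 = 0 := hm
          rw [D_eq_of_repr_eq_zero (b := b) hm, lie_prod, H.lie_D, H'.lie_D]
          exact T.smul_mem (ψ (D₀ b (b.repr m 1))) (Submodule.subset_span ⟨_, rfl⟩)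
        · intro m hm v hv
          have : T ≤ LinearMap.ker (act (D m)) := by
            refine Submodule.span_le.2 ?_
            rintro _ ⟨l, rfl⟩
            exact Prod.ext (H.lie_pos hm l) (H'.lie_pos hm l)
          exact this hv
        · intro m
          refine hstab _ fun l => ?_
          rw [lie_prod, H.lie_h, H'.lie_h]
          exact T.smul_mem (ψ (h₀ b m)) (Submodule.subset_span ⟨_, rfl⟩)
        · have := mem_layer_of_mem hG.isInternal (d := coord₁ b) hx0
          simpa [-zsmul_eq_mul, -smul_eq_mul] using this
      rw [← gproj_of_mem hP.isInternal hx0]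
      have : T ≤ (Submodule.span ℂ {w 0}).comap (gproj hP.isInternal ((0 : ℤ) • b 1)) := by
        refine Submodule.span_le.2 ?_
        rintro _ ⟨l, rfl⟩
        rw [SetLike.mem_coe, Submodule.mem_comap]
        by_cases h : l = 0
        · subst h
          rw [gproj_of_mem _ (hw 0)]
          exact Submodule.mem_span_singleton_self _
        · rw [gproj_of_mem_ne _ (fun h' => h (smul_b₂_inj.1 h')) (hw l)]
          exact zero_mem _
      obtain ⟨c, hc⟩ := Submodule.mem_span_singleton.1 (this h1)
      exact ⟨c, hc.symm⟩
  -- The kernel of the second projection is a graded submodule of `V`. Were it everything, `(t 0,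
  -- 0)` would be a multiple of `(t 0, t' 0)`; so it is zero.
  have hinl : ∀ x : V, (x, (0 : V')) ∈ R → x = 0 := by
    let N : Submodule ℂ V := (R : Submodule ℂ (V × V')).comap (LinearMap.inl ℂ V V')
    have hN : ∀ m, ∀ v ∈ N, ⁅D m, v⁆ ∈ N := fun m v hv => by
      have h1 : (v, (0 : V')) ∈ R := hv
      have := R.lie_mem (x := D m) h1
      rw [lie_prod, lie_zero] at this
      exact this
    have hNg : IsGradedSubspace 𝒱 (ofStable N hN : Submodule ℂ V) := by
      rw [isGradedSubspace_iff H.graded.isInternal]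
      intro γ x hx
      have h1 := hRg (γ - γ₀) _ hx
      rw [gproj_prod H.graded H'.graded] at h1
      have h2 : (gproj H.graded.isInternal γ x, (0 : V')) ∈ R := by simpa using h1
      exact h2
    have hne : ofStable N hN ≠ ⊤ := fun h => by
      have h1 : (t 0, (0 : V')) ∈ R := by
        have : t 0 ∈ ofStable N hN := h ▸ LieSubmodule.mem_top (t 0)
        exact this
      obtain ⟨c, hc⟩ := hRT _ h1 ⟨H.mem 0, zero_mem _⟩
      have hc1 : t 0 = c • t 0 := congrArg Prod.fst hc
      have hc2 : 0 = c • t' 0 := congrArg Prod.snd hc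
      have hc0 := (smul_eq_zero.1 hc2.symm).resolve_right H'.ne_zero
      rw [hc0, zero_smul] at hc1
      exact H.ne_zero hc1
    have hbot := (H.irreducible.eq_bot_or_eq_top _ hNg).resolve_right hne
    intro x hx
    have : x ∈ ofStable N hN := hx
    rwa [hbot, LieSubmodule.mem_bot] at this
  have hinr : ∀ y : V', ((0 : V), y) ∈ R → y = 0 := by
    let N : Submodule ℂ V' := (R : Submodule ℂ (V × V')).comap (LinearMap.inr ℂ V V')
    have hN : ∀ m, ∀ v ∈ N, ⁅D m, v⁆ ∈ N := fun m v hv => by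
      have h1 : ((0 : V), v) ∈ R := hv
      have := R.lie_mem (x := D m) h1
      rw [lie_prod, lie_zero] at this
      exact this
    have hNg : IsGradedSubspace 𝒱' (ofStable N hN : Submodule ℂ V') := by
      rw [isGradedSubspace_iff H'.graded.isInternal]
      intro γ x hx
      have h1 := hRg (γ - γ₀') _ hx
      rw [gproj_prod H.graded H'.graded] at h1
      have h2 : ((0 : V), gproj H'.graded.isInternal γ x) ∈ R := by simpa using h1
      exact h2
    have hne : ofStable N hN ≠ ⊤ := fun h => by
      have h1 : ((0 : V), t' 0) ∈ R := by
        have : t' 0 ∈ ofStable N hN := h ▸ LieSubmodule.mem_top (t' 0)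
        exact this
      obtain ⟨c, hc⟩ := hRT _ h1 ⟨zero_mem _, H'.mem 0⟩
      have hc1 : 0 = c • t 0 := congrArg Prod.fst hc
      have hc2 : t' 0 = c • t' 0 := congrArg Prod.snd hc
      have hc0 := (smul_eq_zero.1 hc1.symm).resolve_right H.ne_zero
      rw [hc0, zero_smul] at hc2
      exact H'.ne_zero hc2
    have hbot := (H'.irreducible.eq_bot_or_eq_top _ hNg).resolve_right hne
    intro x hx
    have : x ∈ ofStable N hN := hx
    rwa [hbot, LieSubmodule.mem_bot] at this
  have hw0 : w 0 ∈ R := hTR _ (Submodule.subset_span ⟨0, rfl⟩)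
  -- The projections of `R` are onto because `t 0` and `t' 0` generate.
  have hfst : ∀ x : V, ∃ y, (x, y) ∈ R := by
    let N : Submodule ℂ V := (R : Submodule ℂ (V × V')).map (LinearMap.fst ℂ V V')
    have hN : ∀ m, ∀ v ∈ N, ⁅D m, v⁆ ∈ N := by
      rintro m _ ⟨v, hv, rfl⟩
      exact ⟨_, R.lie_mem (x := D m) hv, rfl⟩
    have hle : (⊤ : LieSubmodule ℂ VirasoroLike V) ≤ ofStable N hN := by
      rw [← H.lieSpan_eq_top, LieSubmodule.lieSpan_le]
      rintro _ rfl
      exact ⟨w 0, hw0, rfl⟩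
    intro x
    obtain ⟨⟨x, y⟩, hv, rfl⟩ := hle (LieSubmodule.mem_top x)
    exact ⟨y, hv⟩
  have hsnd : ∀ y : V', ∃ x, (x, y) ∈ R := by
    let N : Submodule ℂ V' := (R : Submodule ℂ (V × V')).map (LinearMap.snd ℂ V V')
    have hN : ∀ m, ∀ v ∈ N, ⁅D m, v⁆ ∈ N := by
      rintro m _ ⟨v, hv, rfl⟩
      exact ⟨_, R.lie_mem (x := D m) hv, rfl⟩
    have hle : (⊤ : LieSubmodule ℂ VirasoroLike V') ≤ ofStable N hN := by
      rw [← H'.lieSpan_eq_top, LieSubmodule.lieSpan_le]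
      rintro _ rfl
      exact ⟨w 0, hw0, rfl⟩
    intro x
    obtain ⟨⟨x, y⟩, hv, rfl⟩ := hle (LieSubmodule.mem_top x)
    exact ⟨x, hv⟩
  choose f hf using hfst
  choose g hg using hsnd
  have hfu : ∀ x y, (x, y) ∈ R → f x = y := fun x y hxy => by
    have := sub_mem (hf x) hxy
    rw [Prod.mk_sub_mk, sub_self] at this
    exact sub_eq_zero.1 (hinr _ this)
  have hgu : ∀ x y, (x, y) ∈ R → g y = x := fun x y hxy => by
    have := sub_mem (hg y) hxy
    rw [Prod.mk_sub_mk, sub_self] at this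
    exact sub_eq_zero.1 (hinl _ this)
  let e : V ≃ₗ⁅ℂ, VirasoroLike⁆ V' :=
    { toFun := f
      map_add' := fun x y => hfu _ _ (add_mem (hf x) (hf y))
      map_smul' := fun c x => hfu _ _ (R.smul_mem c (hf x))
      map_lie' := fun {x v} => hfu _ _ (R.lie_mem (x := x) (hf v))
      invFun := g
      left_inv := fun x => hgu _ _ (hf x)
      right_inv := fun y => hfu _ _ (hg y) }
  refine ⟨e, fun n => le_antisymm ?_ ?_⟩
  · rintro _ ⟨x, hx, rfl⟩
    have h1 := hRg (n - γ₀) _ (hf x)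
    rw [gproj_prod H.graded H'.graded, add_sub_cancel, gproj_of_mem _ hx] at h1
    have h2 := hfu _ _ h1
    change f x ∈ _
    rw [h2, show n + (γ₀' - γ₀) = γ₀' + (n - γ₀) by abel]
    exact gproj_mem _ _ _
  · intro y hy
    have h1 := hRg (n - γ₀) _ (hg y)
    rw [show n + (γ₀' - γ₀) = γ₀' + (n - γ₀) by abel] at hy
    rw [gproj_prod H.graded H'.graded, add_sub_cancel, gproj_of_mem _ hy] at h1
    have h2 := hgu _ _ h1
    refine ⟨g y, ?_, hfu _ _ (hg y)⟩
    rw [h2]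
    exact gproj_mem _ _ _

end Product

/-- Operators that satisfy the defining relations, with scalar central elements, give a
representation. -/
theorem exists_linearMap_of_relations {M : Type*} [AddCommGroup M] [Module ℂ M]
    (F : ℤ × ℤ → Module.End ℂ M) (y₁ y₂ : ℂ) (h0 : F 0 = 0)
    (hF : ∀ m n v, F m (F n v) - F n (F m v) =
      (-(det m n : ℂ)) • F (m + n) v + if m + n = 0 then (m.1 * y₁ + m.2 * y₂) • v else 0) :
    ∃ ρ : VirasoroLike →ₗ[ℂ] Module.End ℂ M,
      (∀ x y v, ρ ⁅x, y⁆ v = ρ x (ρ y v) - ρ y (ρ x v)) ∧ (∀ m, ρ (D m) = F m) ∧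
      ∀ (m : ℤ × ℤ) v, ρ (h m) v = (m.1 * y₁ + m.2 * y₂ : ℂ) • v := by
  let f : VirasoroLike →ₗ[ℂ] Module.End ℂ M := lift F (y₁ • 1) (y₂ • 1)
  have hD : ∀ m, f (D m) = F m := fun m => lift_D _ _ _ h0 m
  have hc₁ : f c₁ = y₁ • 1 := lift_c₁ _ _ _
  have hc₂ : f c₂ = y₂ • 1 := lift_c₂ _ _ _
  have hh : ∀ m, f (h m) = (m.1 * y₁ + m.2 * y₂ : ℂ) • 1 := fun m => by
    rw [h, map_add, map_smul, map_smul, hc₁, hc₂, smul_smul, smul_smul, add_smul]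
  let μ := LinearMap.mul ℂ (Module.End ℂ M)
  have key : bracket.compr₂ f = μ.compl₁₂ f f - (μ.compl₁₂ f f).flip := by
    refine linearMap_ext (fun m => linearMap_ext (fun n => ?_) ?_ ?_)
      (linearMap_ext (fun n => ?_) ?_ ?_) (linearMap_ext (fun n => ?_) ?_ ?_)
    · simp only [μ, LinearMap.compr₂_apply, LinearMap.sub_apply, LinearMap.compl₁₂_apply,
        LinearMap.flip_apply, LinearMap.mul_apply', bracket_D_D, bracketD, map_add, map_smul, hD]
      refine LinearMap.ext fun v => ?_
      rw [LinearMap.sub_apply, Module.End.mul_apply, Module.End.mul_apply, hF]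
      split_ifs with h1
      · rw [hh]; rfl
      · rw [map_zero]; rfl
    all_goals
      simp [μ, hD, hc₁, hc₂, smul_comm y₁ y₂]
  refine ⟨f, fun x y v => ?_, hD, fun m v => ?_⟩
  · exact LinearMap.congr_fun (LinearMap.congr_fun (LinearMap.congr_fun key x) y) v
  · rw [hh]; rfl

/-! ### Nonvanishing of the induced module and the forward implication. -/

variable {V : Type*} [AddCommGroup V] [Module ℂ V] [LieRingModule VirasoroLike V]
  [LieModule ℂ VirasoroLike V] {𝒱 : ℤ × ℤ → Submodule ℂ V}
  {b : Module.Basis (Fin 2) ℤ (ℤ × ℤ)} {ψ : gradedPiece b 0 →ₗ[ℂ] ℂ} {γ₀ : ℤ × ℤ}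
  {s : ℕ} {t : ℤ → V}

theorem h₀_eq (m : ℤ × ℤ) :
    ψ (h₀ b m) = m.1 * ψ (h₀ b (1, 0)) + m.2 * ψ (h₀ b (0, 1)) := by
  have : h₀ b m = (m.1 : ℂ) • h₀ b (1, 0) + (m.2 : ℂ) • h₀ b (0, 1) := by
    refine Subtype.ext ?_
    change h m = (m.1 : ℂ) • h (1, 0) + (m.2 : ℂ) • h (0, 1)
    rw [← c₁_eq_h, ← c₂_eq_h, h]
  rw [this, map_add, map_smul, map_smul, smul_eq_mul, smul_eq_mul]

/-- The formal sum of the `t k` generates a highest weight module, so the induced module is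
nonzero. -/
theorem IsShiftModule.vermaGen_ne_zero (H : IsShiftModule 𝒱 b ψ γ₀ s t)
    (hh : ∀ m (v : V), ⁅h m, v⁆ = ψ (h₀ b m) • v) : vermaGen b ψ ≠ 0 := by
  -- On sequences in `V` the action is combined with a translation of the index by the
  -- `b₂`-coordinate. This turns the shift of the `t k` into multiplication by `ψ`, so that `t`,
  -- seen as one sequence, satisfies the highest weight relations.
  let F : ℤ × ℤ → Module.End ℂ (ℤ → V) := fun m =>
    (act (D m)).compLeft ℤ ∘ₗ LinearMap.funLeft ℂ V (fun k => k - coord₂ b m)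
  have hFa : ∀ m f k, F m f k = ⁅D m, f (k - coord₂ b m)⁆ := fun m f k => rfl
  obtain ⟨ρ, hρ, hρD, hρh⟩ := exists_linearMap_of_relations F (ψ (h₀ b (1, 0))) (ψ (h₀ b (0, 1)))
    (by
      refine LinearMap.ext fun f => funext fun k => ?_
      rw [hFa, D_zero, zero_lie]; rfl)
    (fun m n f => by
      funext k
      simp only [Pi.sub_apply, Pi.add_apply, Pi.smul_apply, hFa]
      rw [sub_right_comm k (coord₂ b n), D_lie_D_lie m n, hh, ← h₀_eq, sub_sub, map_add]
      split_ifs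
      · rw [Pi.smul_apply]
        rename_i h1
        have : coord₂ b m + coord₂ b n = 0 := by rw [← map_add, h1, map_zero]
        rw [this, sub_zero]
        abel
      · rw [Pi.zero_apply]
        abel)
  let _ : LieRingModule VirasoroLike (ℤ → V) :=
    { bracket := fun x f => ρ x f
      add_lie := fun x y f => by simp
      lie_add := fun x f g => by simp
      leibniz_lie := fun x y f => by simp [hρ] }
  let _ : LieModule ℂ VirasoroLike (ℤ → V) :=
    { smul_lie := fun c x f => by
        change ρ (c • x) f = c • ρ x f
        simp
      lie_smul := fun c x f => (ρ x).map_smul c f }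
  have hD : ∀ m (f : ℤ → V), ⁅D m, f⁆ = F m f := fun m f => by
    rw [← hρD]; rfl
  obtain ⟨f, -, hf⟩ := exists_verma_hom (b := b) (ψ := ψ) (w := t)
    (fun m hm => by
      rw [hD]
      funext k
      rw [hFa, H.lie_pos hm]; rfl)
    (fun k => by
      rw [hD]
      funext j
      have : coord₂ b (k • b 1) = k := by simp [-zsmul_eq_mul, -smul_eq_mul]
      rw [hFa, H.lie_D, this, sub_add_cancel]; rfl)
    (fun m => by
      refine (hρh m t).trans ?_
      rw [h₀_eq m])
  intro h0
  rw [h0, map_zero] at hf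
  exact H.ne_zero (congrFun hf 0).symm

/-- The modules in the class `𝒪` with a generalized highest weight vector are shift modules of
exp-polynomial type. -/
theorem exists_isShiftModule (hgr : IsGradedModule V 𝒱) (hghw : IsGeneralizedHighestWeight V 𝒱)
    (hnt : ¬ LieModule.IsTrivial VirasoroLike V) (hO : InClassO V 𝒱) :
    ∃ (b : Module.Basis (Fin 2) ℤ (ℤ × ℤ)) (ψ : gradedPiece b 0 →ₗ[ℂ] ℂ) (γ₀ : ℤ × ℤ) (s : ℕ)
      (t : ℤ → V), IsExpPolynomial b ψ ∧ 0 < s ∧ IsShiftModule 𝒱 b ψ γ₀ s t ∧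
        vermaGen b ψ ≠ 0 ∧
        ∀ k, k ∈ AddSubmonoid.closure {k | ψ (D₀ b k) ≠ 0} ↔ (s : ℤ) ∣ k := by
  obtain ⟨hV, hfin⟩ := hO
  obtain ⟨χ, hχ⟩ := exists_central_character hgr hV hfin
  obtain ⟨b, γ₀, hγ₀, htop⟩ := exists_top_layer hgr hV hfin hnt hghw
  obtain ⟨u, hu, hu0⟩ := Submodule.exists_mem_ne_zero_of_ne_bot hγ₀
  have H : HasTopLayer 𝒱 b γ₀ χ :=
    ⟨hgr, hV, hχ, htop, central_eq_zero hgr hfin hχ htop hu hu0⟩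
  obtain ⟨ψ, s, t, hψ, hs, htm, ht0, hact, hh, hspan, hd, hc⟩ := H.exists_expPolynomial hfin hnt hu hu0
  have HS : IsShiftModule 𝒱 b ψ γ₀ s t :=
    ⟨hgr, hV, htop, htm, ht0, hact, fun m k => hh m (t k), hspan⟩
  refine ⟨b, ψ, γ₀, s, t, hψ, hs, HS, HS.vermaGen_ne_zero hh, fun k => ⟨fun hk => ?_, hc k⟩⟩
  induction hk using AddSubmonoid.closure_induction with
  | mem k hk => exact hd k hk
  | zero => exact dvd_zero _
  | add j k _ _ hj hk => exact dvd_add hj hk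

/-- Generalized highest weight modules in the class `𝒪` are the `V̄(ψ, i, s)` up to a shift of the
grading. -/
theorem exists_equiv_vBar (hgr : IsGradedModule V 𝒱) (hghw : IsGeneralizedHighestWeight V 𝒱)
    (hnt : ¬ LieModule.IsTrivial VirasoroLike V) (hO : InClassO V 𝒱) :
    ∃ (b : Module.Basis (Fin 2) ℤ (ℤ × ℤ)) (ψ : gradedPiece b 0 →ₗ[ℂ] ℂ) (i : ℤ) (s : ℕ),
      IsExpPolynomial b ψ ∧ 0 < s ∧ HasPeriod b ψ i s ∧
        ∃ (e : V ≃ₗ⁅ℂ, VirasoroLike⁆ VBar b ψ i) (d : ℤ × ℤ), ∀ n,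
          (𝒱 n).map (e : V →ₗ[ℂ] VBar b ψ i) = vBarGrade b ψ i (n + d) := by
  obtain ⟨b, ψ, γ₀, s, t, hψ, hs, H, hgen, hper⟩ := exists_isShiftModule hgr hghw hnt hO
  -- The offset `i = 0` suffices, since a translation of the grading is allowed.
  obtain ⟨e, he⟩ := H.exists_equiv (vBar_isShiftModule (i := 0) hper hgen)
  exact ⟨b, ψ, 0, s, hψ, hs, (hasPeriod_iff hgen).2 hper, e, _, he⟩

/-! ### Recurrent sequences with values in a vector space. -/

section Recurrence

open Polynomial

variable {M M' : Type*} [AddCommGroup M] [Module ℂ M] [AddCommGroup M'] [Module ℂ M']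

theorem aeval_shift_translate (P : ℂ[X]) (u : ℤ → M) (l : ℤ) :
    aeval shift P (fun k => u (k + l)) = fun k => aeval shift P u (k + l) := by
  funext k
  simp only [aeval_shift_apply]
  exact Finset.sum_congr rfl fun i _ => by rw [add_right_comm]

theorem aeval_shift_map (P : ℂ[X]) (u : ℤ → M) (f : M →ₗ[ℂ] M') :
    aeval shift P (fun k => f (u k)) = fun k => f (aeval shift P u k) := by
  funext k
  simp only [aeval_shift_apply, map_sum, map_smul]

/-- The commutator of the shift with multiplication by `k` is the shift itself, so multiplication by
`k` acts on polynomials in the shift as the derivation `X d/dX`. -/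
theorem aeval_shift_mul_index (P : ℂ[X]) (u : ℤ → M) :
    aeval shift P (fun k : ℤ => ((k : ℤ) : ℂ) • u k) =
      (fun k : ℤ => ((k : ℤ) : ℂ) • aeval shift P u k) + aeval shift (X * derivative P) u := by
  induction P using Polynomial.induction_on' with
  | add P Q hP hQ =>
    simp only [map_add, mul_add, LinearMap.add_apply, hP, hQ]
    funext k
    simp only [Pi.add_apply, smul_add]
    abel
  | monomial n a =>
    have h1 : X * derivative (monomial n a) = monomial n (a * n) := by
      rcases n with _ | n
      · simp
      · rw [derivative_monomial, X_mul_monomial, Nat.add_sub_cancel]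
    funext k
    rw [h1, Pi.add_apply]
    simp only [aeval_monomial, Module.End.mul_apply, Module.algebraMap_end_apply, Pi.smul_apply,
      shift_pow_apply]
    push_cast
    module

/-- A factor linear in `k` costs one derivative of the annihilating polynomial, and the derivative
of `P ^ 2` is still divisible by `P`. -/
theorem aeval_shift_sq_eq_zero {P : ℂ[X]} {u : ℤ → M} (hu : aeval shift P u = 0) (c c' : ℂ) (l : ℤ) :
    aeval shift (P ^ 2) (fun k : ℤ => (c * k + c') • u (k + l)) = 0 := by
  have h1 : ∀ Q, aeval shift (Q * P) u = 0 := fun Q => by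
    rw [map_mul, Module.End.mul_apply, hu, map_zero]
  have h2 : aeval shift (P ^ 2) u = 0 := by rw [sq]; exact h1 P
  have e : (fun k : ℤ => (c * k + c') • u (k + l)) =
      c • (fun k : ℤ => ((k : ℤ) : ℂ) • u (k + l)) + c' • fun k => u (k + l) := by
    funext k
    simp only [Pi.add_apply, Pi.smul_apply]
    module
  rw [e, map_add, map_smul, map_smul, aeval_shift_mul_index, aeval_shift_translate,
    aeval_shift_translate, derivative_sq, h2,
    show X * (C 2 * P * derivative P) = (X * C 2 * derivative P) * P by ring, h1]
  funext k
  simp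

/-- The values of a recurrent sequence span a finite dimensional space. -/
theorem finiteDimensional_of_recurrent {u : ℤ → M} (hu : u ∈ recurrent) :
    FiniteDimensional ℂ (Submodule.span ℂ (Set.range u)) := by
  obtain ⟨Q, hQ, hQu⟩ := hu
  -- Removing factors `X`, which is harmless as the shift is invertible, makes the constant
  -- coefficient nonzero. The recurrence can then be run in both directions from a window of `d`
  -- terms.
  obtain ⟨P, hP, hP0, hPu⟩ : ∃ P : ℂ[X], P ≠ 0 ∧ P.coeff 0 ≠ 0 ∧ aeval shift P u = 0 := by
    obtain ⟨n, hn⟩ : ∃ n, Q.natDegree = n := ⟨_, rfl⟩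
    induction n generalizing Q with
    | zero =>
      refine ⟨Q, hQ, fun h => hQ ?_, hQu⟩
      rw [eq_C_of_natDegree_eq_zero hn, h, C_0]
    | succ n ih =>
      by_cases h : Q.coeff 0 = 0
      · obtain ⟨R, rfl⟩ := X_dvd_iff.2 h
        have hR : R ≠ 0 := right_ne_zero_of_mul hQ
        refine ih R hR ?_ ?_
        · rw [map_mul, aeval_X, Module.End.mul_apply] at hQu
          funext k
          simpa using congrFun hQu (k - 1)
        · rw [natDegree_mul X_ne_zero hR, natDegree_X] at hn
          omega
      · exact ⟨Q, hQ, h, hQu⟩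
  set d := P.natDegree with hd
  obtain ⟨W, hW⟩ : ∃ W, W = Submodule.span ℂ (Set.range fun l : Fin d => u (l : ℕ)) := ⟨_, rfl⟩
  have hrec : ∀ k : ℤ, ∑ i ∈ Finset.range (d + 1), P.coeff i • u (k + i) = 0 := fun k => by
    rw [← aeval_shift_apply, hPu]; rfl
  have hup : ∀ k : ℤ, (∀ l < d, u (k + l) ∈ W) → u (k + d) ∈ W := fun k hk => by
    have h1 := hrec k
    rw [Finset.sum_range_succ] at h1
    have h2 : P.coeff d • u (k + d) ∈ W := by
      rw [eq_neg_of_add_eq_zero_right h1]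
      exact W.neg_mem (W.sum_mem fun i hi => W.smul_mem _ (hk i (Finset.mem_range.1 hi)))
    exact (W.smul_mem_iff (leadingCoeff_ne_zero.2 hP)).1 h2
  have hdown : ∀ k : ℤ, (∀ l < d, u (k + 1 + l) ∈ W) → u k ∈ W := fun k hk => by
    have h1 := hrec k
    rw [Finset.sum_range_succ'] at h1
    have h2 : P.coeff 0 • u (k + (0 : ℕ)) ∈ W := by
      rw [eq_neg_of_add_eq_zero_right h1]
      refine W.neg_mem (W.sum_mem fun i hi => W.smul_mem _ ?_)
      have := hk i (Finset.mem_range.1 hi)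
      rwa [show k + 1 + i = k + (i + 1 : ℕ) by push_cast; ring] at this
    simpa using (W.smul_mem_iff hP0).1 h2
  have hwin : ∀ k : ℤ, ∀ l < d, u (k + l) ∈ W := fun k => by
    induction k using Int.induction_on with
    | zero =>
      intro l hl
      rw [zero_add]
      rw [hW]
      exact Submodule.subset_span ⟨⟨l, hl⟩, rfl⟩
    | succ k ih =>
      intro l hl
      rcases Nat.lt_or_ge (l + 1) d with h | h
      · have := ih (l + 1) h
        rwa [show (k : ℤ) + (l + 1 : ℕ) = k + 1 + l by push_cast; ring] at this
      · have := hup k ih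
        rwa [show (k : ℤ) + d = k + 1 + l by omega] at this
    | pred k ih =>
      intro l hl
      rcases Nat.eq_zero_or_pos l with rfl | h
      · have := hdown (-(k : ℤ) - 1) (by simpa using ih)
        simpa using this
      · have := ih (l - 1) (by omega)
        rwa [show -(k : ℤ) + (l - 1 : ℕ) = -k - 1 + l by omega] at this
  have hle : Submodule.span ℂ (Set.range u) ≤ W := by
    refine Submodule.span_le.2 ?_
    rintro _ ⟨k, rfl⟩
    have := hup (k - d) (hwin _)
    rwa [sub_add_cancel] at this
  have : FiniteDimensional ℂ W := by
    rw [hW]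
    exact FiniteDimensional.span_of_finite ℂ (Set.finite_range _)
  exact Submodule.finiteDimensional_of_le hle

end Recurrence

/-! ### Sequences of operators of fixed `b₁`-degree. -/

section Sequences

variable (b : Module.Basis (Fin 2) ℤ (ℤ × ℤ)) {M : Type*} [AddCommGroup M] [Module ℂ M]
  [LieRingModule VirasoroLike M] [LieModule ℂ VirasoroLike M]

/-- The sequence of the `D(j b₁ + k b₂) w`. -/
def lieSeq (j : ℤ) (w : M) (k : ℤ) : M := ⁅D (j • b 0 + k • b 1), w⁆

/-- The coefficient is linear in `k`, the case handled by squaring the annihilating polynomial. The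
condition `i + j ≠ 0` excludes the central term. -/
theorem D_lieSeq (i j k l : ℤ) (w : M) (hij : i + j ≠ 0) :
    ⁅D (i • b 0 + l • b 1), lieSeq b j w k⁆ = lieSeq b j ⁅D (i • b 0 + l • b 1), w⁆ k +
      ((-(det (b 0) (b 1) : ℂ) * i) * k + det (b 0) (b 1) * j * l) • lieSeq b (i + j) w (k + l) := by
  have e1 : i • b 0 + l • b 1 + (j • b 0 + k • b 1) = (i + j) • b 0 + (k + l) • b 1 := by
    rw [add_smul, add_smul]; abel
  have e2 : det (i • b 0 + l • b 1) (j • b 0 + k • b 1) = det (b 0) (b 1) * (i * k - j * l) := by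
    simp only [det_add_left, det_add_right, det_zsmul_left, det_zsmul_right, det_self]
    rw [det_comm (b 1) (b 0)]; ring
  unfold lieSeq
  rw [D_lie_D_lie_of_ne, e1, e2]
  · congr 2
    push_cast
    ring
  · rw [e1]
    intro h0
    have := congrArg (fun m => b.repr m 0) h0
    simp [-zsmul_eq_mul, -smul_eq_mul] at this
    exact hij this

theorem lieSeq_add (j : ℤ) (v w : M) : lieSeq b j (v + w) = lieSeq b j v + lieSeq b j w :=
  funext fun _ => lie_add _ _ _

theorem lieSeq_smul (j : ℤ) (c : ℂ) (w : M) : lieSeq b j (c • w) = c • lieSeq b j w :=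
  funext fun _ => lie_smul _ _ _

theorem lieSeq_zero (j : ℤ) : lieSeq b j (0 : M) = 0 := funext fun _ => lie_zero _

/-- The vectors on which all the sequences of operators of negative degree are recurrent. -/
def recVectors : Submodule ℂ M where
  carrier := {w | ∀ j < 0, lieSeq b j w ∈ recurrent}
  zero_mem' j _ := by rw [lieSeq_zero]; exact zero_mem _
  add_mem' hv hw j hj := by rw [lieSeq_add]; exact add_mem (hv j hj) (hw j hj)
  smul_mem' c w hw j hj := by rw [lieSeq_smul]; exact Submodule.smul_mem _ _ (hw j hj)

/-- For negative degrees the commutator stays in negative degree, so it is again a recurrent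
sequence times a linear factor. -/
theorem lie_mem_recVectors {w : M} (hw : w ∈ recVectors b) {m : ℤ × ℤ} (hm : b.repr m 0 < 0) :
    ⁅D m, w⁆ ∈ recVectors b := by
  intro j hj
  rw [← repr_smul_add b m]
  set i := b.repr m 0
  set l := b.repr m 1
  have e : lieSeq b j ⁅D (i • b 0 + l • b 1), w⁆ =
      (fun k => act (D (i • b 0 + l • b 1)) (lieSeq b j w k)) - fun k : ℤ =>
        ((-(det (b 0) (b 1) : ℂ) * i) * k + det (b 0) (b 1) * j * l) • lieSeq b (i + j) w (k + l) := by
    funext k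
    rw [Pi.sub_apply, eq_sub_iff_add_eq]
    exact (D_lieSeq b i j k l w (by omega)).symm
  rw [e]
  obtain ⟨P, hP, hPu⟩ := hw j hj
  obtain ⟨Q, hQ, hQu⟩ := hw (i + j) (by omega)
  refine sub_mem ⟨P, hP, ?_⟩ ⟨Q ^ 2, pow_ne_zero 2 hQ, aeval_shift_sq_eq_zero hQu _ _ _⟩
  rw [aeval_shift_map, hPu]
  funext k
  exact map_zero _

end Sequences

/-! ### Finite dimensionality of the homogeneous subspaces. -/

section VHat

variable {b : Module.Basis (Fin 2) ℤ (ℤ × ℤ)} {ψ : gradedPiece b 0 →ₗ[ℂ] ℂ}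

theorem lieSpan_vHatGen : LieSubmodule.lieSpan ℂ VirasoroLike {vHatGen b ψ} = ⊤ := by
  refine eq_top_of_comap_mk ?_
  rw [← top_le_iff, ← lieSpan_vermaGen, LieSubmodule.lieSpan_le]
  rintro _ rfl
  exact LieSubmodule.subset_lieSpan rfl

/-- A subspace that contains `v₀` and all the `D(m) v` with `m` of negative degree and `v` in it is
everything. -/
theorem mem_of_negative_stable {N : Submodule ℂ (VHat b ψ)}
    (hN : ∀ m, b.repr m 0 < 0 → ∀ v ∈ Submodule.span ℂ {vHatGen b ψ} ⊔ N, ⁅D m, v⁆ ∈ N)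
    (x : VHat b ψ) : x ∈ Submodule.span ℂ {vHatGen b ψ} ⊔ N := by
  refine lieSpan_le_of_triangular (coord₁ b) ?_ ?_ ?_ hN ?_
  · intro m hm v hv
    obtain ⟨c, rfl⟩ := Submodule.mem_span_singleton.1 hv
    rw [coord₁_apply] at hm
    rw [D_eq_of_repr_eq_zero (b := b) hm, lie_smul, vHatGen_lie_D]
    exact Submodule.smul_mem _ _ (Submodule.smul_mem _ _ (Submodule.mem_span_singleton_self _))
  · intro m hm v hv
    obtain ⟨c, rfl⟩ := Submodule.mem_span_singleton.1 hv
    rw [lie_smul, vHatGen_lie_pos hm, smul_zero]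
  · intro m v hv
    obtain ⟨c, rfl⟩ := Submodule.mem_span_singleton.1 hv
    rw [lie_smul, vHatGen_lie_h]
    exact Submodule.smul_mem _ _ (Submodule.smul_mem _ _ (Submodule.mem_span_singleton_self _))
  · have : (⊤ : LieSubmodule ℂ VirasoroLike (VHat b ψ)) ≤
        LieSubmodule.lieSpan ℂ VirasoroLike (Submodule.span ℂ {vHatGen b ψ} : Set (VHat b ψ)) := by
      rw [← lieSpan_vHatGen]
      exact LieSubmodule.lieSpan_mono Submodule.subset_span
    exact this (LieSubmodule.mem_top x)

/-- The sequence `k ψ(D(k b₂))`, with the value at `0` given by `ψ(h(b₁))`, is recurrent. -/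
theorem IsExpPolynomial.recurrent (hψ : IsExpPolynomial b ψ) :
    (fun k : ℤ => if k = 0 then -(det (b 0) (b 1) : ℂ) * ψ (h₀ b (b 0)) else k * ψ (D₀ b k)) ∈
      VirasoroLike.recurrent := by
  obtain ⟨r, p, α, hα, hk, h0⟩ := hψ.exists_eq
  have : (fun k : ℤ => if k = 0 then -(det (b 0) (b 1) : ℂ) * ψ (h₀ b (b 0)) else
      k * ψ (D₀ b k)) = ∑ j, fun k : ℤ => (p j).eval (k : ℂ) * α j ^ k := by
    funext k
    rw [Finset.sum_apply]
    split_ifs with h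
    · subst h
      rw [h0, ← mul_assoc, neg_mul_neg, det_sq, one_mul]
      exact Finset.sum_congr rfl fun j _ => by
        rw [Int.cast_zero, zpow_zero, mul_one, Polynomial.coeff_zero_eq_eval_zero]
    · rw [hk k h, mul_div_cancel₀ _ (Int.cast_ne_zero.2 h)]
  rw [this]
  exact sum_mem fun j _ => expPoly_mem_recurrent _ (hα j)

theorem lieSeq_mem_vHatGrade (j k : ℤ) {n : ℤ} {w : VHat b ψ} (hw : w ∈ vHatGrade b ψ n) :
    lieSeq b j w k ∈ vHatGrade b ψ (j + n) := by
  have := vHatGrade_isGradedBy.lie_mem (j • b 0 + k • b 1) n w hw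
  simpa [-zsmul_eq_mul, -smul_eq_mul, lieSeq] using this

/-- Induction on the depth `n`: a polynomial in the shift turns the sequence of degree `-n` into
vectors killed by all positive operators, which vanish by irreducibility. -/
theorem vHatGen_mem_recVectors (hgen : vermaGen b ψ ≠ 0) (hψ : IsExpPolynomial b ψ) :
    vHatGen b ψ ∈ recVectors b := by
  have hG := vHatGrade_isGradedBy (b := b) (ψ := ψ)
  suffices h : ∀ n : ℕ, 0 < n → lieSeq b (-(n : ℤ)) (vHatGen b ψ) ∈ recurrent by
    intro j hj
    have := h j.natAbs (by omega)
    rwa [show -(j.natAbs : ℤ) = j by omega] at this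
  intro n
  induction n using Nat.strong_induction_on with
  | _ n ih =>
    intro hn
    have ih' : ∀ j : ℕ, ∃ Q : Polynomial ℂ, Q ≠ 0 ∧ (0 < j → j < n →
        Polynomial.aeval shift Q (lieSeq b (-(j : ℤ)) (vHatGen b ψ)) = 0) := fun j => by
      by_cases hj : 0 < j ∧ j < n
      · obtain ⟨Q, hQ, hQu⟩ := ih j hj.2 hj.1
        exact ⟨Q, hQ, fun _ _ => hQu⟩
      · exact ⟨1, one_ne_zero, fun h1 h2 => absurd ⟨h1, h2⟩ hj⟩
    choose Q hQ hQu using ih'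
    obtain ⟨P, hP, hPu⟩ := hψ.recurrent
    set g : ℤ → ℂ := fun k : ℤ => if k = 0 then -(det (b 0) (b 1) : ℂ) * ψ (h₀ b (b 0)) else
      k * ψ (D₀ b k) with hg
    -- The factor `P` handles operators returning to the top layer; the squares handle those landing
    -- at a depth `0 < j < n`, with their linear coefficients. At `j = 0` the factor is merely some
    -- nonzero polynomial.
    let R : Polynomial ℂ := P * ∏ j ∈ Finset.range n, Q j ^ 2
    have hRP : P ∣ R := dvd_mul_right _ _
    have hRQ : ∀ j < n, Q j ^ 2 ∣ R := fun j hj =>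
      (Finset.dvd_prod_of_mem (fun j => Q j ^ 2) (Finset.mem_range.2 hj)).mul_left _
    have hdvd : ∀ {S : Polynomial ℂ} {u : ℤ → VHat b ψ}, S ∣ R →
        Polynomial.aeval shift S u = 0 → Polynomial.aeval shift R u = 0 := by
      rintro S u ⟨S', hS'⟩ hu
      rw [hS', mul_comm, map_mul, Module.End.mul_apply, hu, map_zero]
    refine ⟨R, mul_ne_zero hP (Finset.prod_ne_zero_iff.2 fun j _ => pow_ne_zero 2 (hQ j)), ?_⟩
    funext k
    refine hG.eq_zero_of_killed vHat_irreducible (d := AddMonoidHom.id ℤ) (i := -(n : ℤ))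
      (j := 0) (by simpa using hn) (fun h => vHatGen_ne_zero hgen ?_) ?_ fun m hm => ?_
    · have := vHatGen_mem (b := b) (ψ := ψ)
      rwa [h, Submodule.mem_bot] at this
    · rw [aeval_shift_apply]
      refine Submodule.sum_mem _ fun i _ => Submodule.smul_mem _ _ ?_
      have := lieSeq_mem_vHatGrade (-(n : ℤ)) (k + i) (vHatGen_mem (b := b) (ψ := ψ))
      rwa [add_zero] at this
    · replace hm : 0 < b.repr m 0 := hm
      have e := congrFun (aeval_shift_map R (lieSeq b (-(n : ℤ)) (vHatGen b ψ)) (act (D m))) k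
      change act (D m) _ = 0
      rw [← e]
      refine congrFun (?_ : Polynomial.aeval shift R _ = 0) k
      have hv : ⁅D m, vHatGen b ψ⁆ = 0 := vHatGen_lie_pos hm
      obtain ⟨i, l, hi, hml⟩ : ∃ i l : ℤ, i = b.repr m 0 ∧ m = i • b 0 + l • b 1 :=
        ⟨_, _, rfl, (repr_smul_add b m).symm⟩
      rw [← hi] at hm
      -- Raising by `i = n` gives a translate of the scalar sequence `g`, where `ψ(h(b₂)) = 0`
      -- removes the dependence of the central term on `l`. For `i < n` the induction hypothesis
      -- applies, and for `i > n` the result has positive degree and is zero.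
      by_cases hin : i + -(n : ℤ) = 0
      · have hin' : i = n := by omega
        have e2 : (fun k => act (D m) (lieSeq b (-(n : ℤ)) (vHatGen b ψ) k)) = fun k : ℤ =>
            LinearMap.toSpanSingleton ℂ _ ((-(det (b 0) (b 1) : ℂ) * n) • vHatGen b ψ) (g (k + l)) := by
          funext k
          change ⁅D m, ⁅D (-(n : ℤ) • b 0 + k • b 1), vHatGen b ψ⁆⁆ = g (k + l) • _
          have e3 : m + (-(n : ℤ) • b 0 + k • b 1) = (k + l) • b 1 := by
            rw [hml, hin', neg_smul, add_smul]; abel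
          have e4 : det m (-(n : ℤ) • b 0 + k • b 1) = det (b 0) (b 1) * (n * (k + l)) := by
            rw [hml, hin']
            simp only [det_add_left, det_add_right, det_zsmul_left, det_zsmul_right, det_self]
            rw [det_comm (b 1) (b 0)]; ring
          rw [D_lie_D_lie, hv, lie_zero, zero_add, e3, e4, vHatGen_lie_D, vHatGen_lie_h]
          simp only [hg]
          by_cases hkl : k + l = 0
          · rw [hkl, zero_smul, if_pos rfl, if_pos rfl, mul_zero, mul_zero, Int.cast_zero,
              neg_zero, zero_smul, zero_add]
            have e5 : ψ (h₀ b m) = n * ψ (h₀ b (b 0)) := by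
              have : h₀ b m = (n : ℂ) • h₀ b (b 0) + (l : ℂ) • h₀ b (b 1) := by
                refine Subtype.ext ?_
                change h m = (n : ℂ) • h (b 0) + (l : ℂ) • h (b 1)
                rw [hml, h_add, h_zsmul, h_zsmul, hin', Int.cast_natCast]
              rw [this, map_add, map_smul, map_smul, hψ.map_h_b₂, smul_zero, add_zero, smul_eq_mul]
            rw [e5, smul_smul]
            congr 1
            linear_combination (-(n : ℂ) * ψ (h₀ b (b 0))) * det_sq b
          · rw [if_neg hkl, if_neg (fun h => hkl (smul_b₂_inj.1 (h.trans (zero_smul ℤ (b 1)).symm))),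
              add_zero, smul_smul, smul_smul]
            congr 1
            push_cast
            ring
        rw [e2, aeval_shift_map, aeval_shift_translate]
        have hg0 : Polynomial.aeval shift R g = 0 := by
          obtain ⟨S', hS'⟩ := hRP
          rw [hS', mul_comm, map_mul, Module.End.mul_apply, hPu, map_zero]
        rw [hg0]
        funext k
        exact map_zero _
      · rcases lt_or_gt_of_ne hin with h | h
        · have e2 : (fun k => act (D m) (lieSeq b (-(n : ℤ)) (vHatGen b ψ) k)) = fun k : ℤ =>
              ((-(det (b 0) (b 1) : ℂ) * i) * k + det (b 0) (b 1) * (-(n : ℤ) : ℤ) * l) •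
                lieSeq b (i + -(n : ℤ)) (vHatGen b ψ) (k + l) := by
            funext k
            have := D_lieSeq b i (-(n : ℤ)) k l (vHatGen b ψ) hin
            rw [← hml, hv, lieSeq_zero, Pi.zero_apply, zero_add] at this
            exact this
          obtain ⟨j, hj⟩ : ∃ j : ℕ, i + -(n : ℤ) = -(j : ℤ) := ⟨(n - i).toNat, by omega⟩
          rw [e2, hj]
          exact hdvd (hRQ j (by omega)) (aeval_shift_sq_eq_zero (hQu j (by omega) (by omega)) _ _ _)
        · have e2 : (fun k => act (D m) (lieSeq b (-(n : ℤ)) (vHatGen b ψ) k)) = 0 := by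
            funext k
            have h1 := lieSeq_mem_vHatGrade (-(n : ℤ)) k (vHatGen_mem (b := b) (ψ := ψ))
            have h2 := hG.lie_mem m _ _ h1
            rw [vHatGrade_eq_bot (by rw [coord₁_apply, ← hi]; omega), Submodule.mem_bot] at h2
            exact h2
          rw [e2, map_zero]

theorem mem_recVectors (hgen : vermaGen b ψ ≠ 0) (hψ : IsExpPolynomial b ψ) (x : VHat b ψ) :
    x ∈ recVectors b := by
  have hle : Submodule.span ℂ {vHatGen b ψ} ⊔ recVectors b ≤ recVectors b :=
    sup_le (Submodule.span_le.2 (Set.singleton_subset_iff.2 (vHatGen_mem_recVectors hgen hψ))) le_rfl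
  exact hle (mem_of_negative_stable (fun m hm v hv => lie_mem_recVectors b (hle hv) hm) x)

theorem vHatGrade_neg_le (n : ℤ) (hn : n < 0) : vHatGrade b ψ n ≤
    Submodule.span ℂ {v | ∃ m, b.repr m 0 < 0 ∧ ∃ w ∈ vHatGrade b ψ (n - b.repr m 0), ⁅D m, w⁆ = v} := by
  have hG := vHatGrade_isGradedBy (b := b) (ψ := ψ)
  intro x hx
  let N : Submodule ℂ (VHat b ψ) :=
    Submodule.span ℂ {v | ∃ m, b.repr m 0 < 0 ∧ ∃ w, ⁅D m, w⁆ = v}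
  have hN := mem_of_negative_stable (N := N)
    (fun m hm v _ => Submodule.subset_span ⟨m, hm, v, rfl⟩) x
  rw [← gproj_of_mem hG.isInternal hx]
  obtain ⟨y, hy, z, hz, rfl⟩ := Submodule.mem_sup.1 hN
  obtain ⟨c, rfl⟩ := Submodule.mem_span_singleton.1 hy
  rw [map_add, map_smul, gproj_of_mem_ne hG.isInternal hn.ne' vHatGen_mem, smul_zero, zero_add]
  clear hx hN hy
  induction hz using Submodule.span_induction with
  | mem v hv =>
    obtain ⟨m, hm, w, rfl⟩ := hv
    refine Submodule.subset_span ⟨m, hm, gproj hG.isInternal (n - b.repr m 0) w, gproj_mem _ _ _, ?_⟩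
    exact (hG.gproj_lie' m n w).symm
  | zero => rw [map_zero]; exact zero_mem _
  | add v w _ _ hv hw => rw [map_add]; exact add_mem hv hw
  | smul c v _ hv => rw [map_smul]; exact Submodule.smul_mem _ _ hv

/-- Degree `-n` is spanned by the terms of finitely many recurrent sequences: one for each `0 < j ≤
n` and each element of a finite spanning set in degree `-n + j`. -/
theorem finiteDimensional_vHatGrade (hgen : vermaGen b ψ ≠ 0) (hψ : IsExpPolynomial b ψ) (n : ℤ) :
    FiniteDimensional ℂ (vHatGrade b ψ n) := by
  rcases lt_or_ge 0 n with hn | hn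
  · rw [vHatGrade_eq_bot hn]
    infer_instance
  obtain ⟨n, rfl⟩ : ∃ k : ℕ, n = -(k : ℤ) := ⟨n.natAbs, by omega⟩
  clear hn
  induction n using Nat.strong_induction_on with
  | _ n ih =>
    rcases Nat.eq_zero_or_pos n with rfl | hn
    · exact Submodule.finiteDimensional_of_le vHatGrade_zero_le
    · have hF : ∀ j : ℕ, ∃ F : Finset (VHat b ψ), 0 < j → j ≤ n →
          Submodule.span ℂ (F : Set (VHat b ψ)) = vHatGrade b ψ (-(n : ℤ) + j) := fun j => by
        by_cases hj : 0 < j ∧ j ≤ n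
        · have := ih (n - j) (by omega)
          rw [show -((n - j : ℕ) : ℤ) = -(n : ℤ) + j by omega] at this
          obtain ⟨F, hF⟩ := (Submodule.fg_iff_finiteDimensional _).2 this
          exact ⟨F, fun _ _ => hF⟩
        · exact ⟨∅, fun h1 h2 => absurd ⟨h1, h2⟩ hj⟩
      choose F hF using hF
      let S : ℕ → VHat b ψ → Submodule ℂ (VHat b ψ) := fun j w =>
        Submodule.span ℂ (Set.range (lieSeq b (-(j : ℤ)) w))
      let T : Submodule ℂ (VHat b ψ) := (Finset.Icc 1 n).sup fun j => (F j).sup (S j)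
      have hT : FiniteDimensional ℂ T := by
        have hsup : ∀ A B : Submodule ℂ (VHat b ψ), FiniteDimensional ℂ A →
            FiniteDimensional ℂ B → FiniteDimensional ℂ (A ⊔ B : Submodule ℂ (VHat b ψ)) :=
          fun A B _ _ => Submodule.finiteDimensional_sup A B
        have hbot : FiniteDimensional ℂ (⊥ : Submodule ℂ (VHat b ψ)) := inferInstance
        refine Finset.sup_induction (p := fun A : Submodule ℂ (VHat b ψ) => FiniteDimensional ℂ A)
          hbot (fun A hA B hB => hsup A B hA hB) fun j hj => ?_
        refine Finset.sup_induction (p := fun A : Submodule ℂ (VHat b ψ) => FiniteDimensional ℂ A)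
          hbot (fun A hA B hB => hsup A B hA hB) fun w _ => ?_
        exact finiteDimensional_of_recurrent
          (mem_recVectors hgen hψ w _ (by have := Finset.mem_Icc.1 hj; omega))
      refine Submodule.finiteDimensional_of_le (S₂ := T)
        ((vHatGrade_neg_le _ (by omega)).trans (Submodule.span_le.2 ?_))
      rintro _ ⟨m, hm, w, hw, rfl⟩
      rcases lt_or_ge 0 (-(n : ℤ) - b.repr m 0) with h | h
      · rw [vHatGrade_eq_bot h, Submodule.mem_bot] at hw
        rw [hw, lie_zero]
        exact zero_mem _
      · obtain ⟨j, hj⟩ : ∃ j : ℕ, b.repr m 0 = -(j : ℤ) := ⟨(-(b.repr m 0)).toNat, by omega⟩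
        have hj1 : 0 < j := by omega
        have hjn : j ≤ n := by omega
        rw [hj, sub_neg_eq_add, ← hF j hj1 hjn] at hw
        have hsup : (F j).sup (S j) ≤ T :=
          Finset.le_sup (f := fun j => (F j).sup (S j)) (Finset.mem_Icc.2 ⟨hj1, hjn⟩)
        refine hsup ?_
        induction hw using Submodule.span_induction with
        | mem w hw =>
          refine Finset.le_sup (f := S j) (Finset.mem_coe.1 hw) (Submodule.subset_span
            ⟨b.repr m 1, ?_⟩)
          rw [lieSeq, ← hj, repr_smul_add]
        | zero => rw [lie_zero]; exact zero_mem _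
        | add v w _ _ hv hw => rw [lie_add]; exact add_mem hv hw
        | smul c v _ hv => rw [lie_smul]; exact Submodule.smul_mem _ _ hv

theorem vBar_isQuasiFinite (hgen : vermaGen b ψ ≠ 0) (hψ : IsExpPolynomial b ψ) (i : ℤ) :
    IsQuasiFinite (VBar b ψ i) (vBarGrade b ψ i) := by
  intro γ
  have := finiteDimensional_vHatGrade hgen hψ (b.repr γ 0)
  unfold vBarGrade vPsiGrade
  infer_instance

end VHat

/-! ### Uniqueness of the grading up to translation. -/

section Rigidity

variable {M : Type*} [AddCommGroup M] [Module ℂ M] [LieRingModule VirasoroLike M]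
  [LieModule ℂ VirasoroLike M] {ℬ 𝒢 : ℤ × ℤ → Submodule ℂ M}
  {b : Module.Basis (Fin 2) ℤ (ℤ × ℤ)} {ψ : gradedPiece b 0 →ₗ[ℂ] ℂ} {γ₀ : ℤ × ℤ} {s : ℕ}
  {t : ℤ → M}

/-- A vector killed by all the operators of positive degree lies in the top layer. -/
theorem IsShiftModule.mem_span_of_killed (H : IsShiftModule ℬ b ψ γ₀ s t) {x : M}
    (hx : ∀ m, 0 < b.repr m 0 → ⁅D m, x⁆ = 0) :
    x ∈ Submodule.span ℂ (Set.range fun j : ℤ => t (s * j)) := by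
  have hG := isGradedBy_id_iff.2 H.graded
  refine mem_of_gproj_mem H.graded.isInternal fun γ => ?_
  have hk : ∀ m, 0 < b.repr m 0 → ⁅D m, gproj H.graded.isInternal γ x⁆ = 0 := fun m hm => by
    rw [← hG.gproj_lie m γ x, hx m hm, map_zero]
  rcases lt_trichotomy (b.repr γ 0) (b.repr γ₀ 0) with h | h | h
  · rw [hG.eq_zero_of_killed H.irreducible.eq_bot_or_eq_top (d := coord₁ b) (j := γ₀) h ?_
      (gproj_mem _ _ _) hk]
    · exact zero_mem _
    · intro h0
      have := H.mem 0
      rw [zero_smul, add_zero, h0, Submodule.mem_bot] at this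
      exact H.ne_zero this
  · obtain ⟨k, hk⟩ : ∃ k : ℤ, γ = γ₀ + k • b 1 := by
      refine ⟨b.repr γ 1 - b.repr γ₀ 1, repr_ext b ?_ ?_⟩ <;>
        simp [-zsmul_eq_mul, -smul_eq_mul, h]
    have h1 : gproj H.graded.isInternal γ x ∈ ℬ (γ₀ + k • b 1) := hk ▸ gproj_mem _ _ _
    obtain ⟨c, hc⟩ := Submodule.mem_span_singleton.1 (H.le_span k h1)
    rw [← hc]
    refine Submodule.smul_mem _ _ ?_
    by_cases hs : (s : ℤ) ∣ k
    · obtain ⟨j, rfl⟩ := hs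
      exact Submodule.subset_span ⟨j, rfl⟩
    · rw [not_not.1 (fun h => hs ((H.ne_zero_iff k).1 h))]
      exact zero_mem _
  · have := gproj_mem H.graded.isInternal γ x
    rw [H.top γ h, Submodule.mem_bot] at this
    rw [this]
    exact zero_mem _

theorem IsShiftModule.linearIndependent (H : IsShiftModule ℬ b ψ γ₀ s t) (hs : 0 < s) :
    LinearIndependent ℂ fun j : ℤ => t (s * j) := by
  refine iSupIndep.linearIndependent (fun j : ℤ => ℬ (γ₀ + ((s : ℤ) * j) • b 1))
    (H.graded.isInternal.submodule_iSupIndep.comp fun i j hij => ?_) (fun j => H.mem _)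
    fun j => (H.ne_zero_iff _).2 (dvd_mul_right _ _)
  have h1 : ((s : ℤ) * i) = s * j := smul_b₂_inj.1 (add_left_cancel hij)
  exact mul_left_cancel₀ (by omega) h1

/-- The shifts of the top layer by the periods are homogeneous for every grading. -/
theorem IsShiftModule.exists_shift (H : IsShiftModule ℬ b ψ γ₀ s t) (hG : IsGradedModule M 𝒢) {k : ℤ}
    (hk : k ∈ AddSubmonoid.closure {k | ψ (D₀ b k) ≠ 0}) : ∃ E : Module.End ℂ M,
      (∀ j, E (t j) = t (j + k)) ∧ ∀ g, ∀ x ∈ 𝒢 g, E x ∈ 𝒢 (g + k • b 1) := by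
  induction hk using AddSubmonoid.closure_induction with
  | mem k hk =>
    refine ⟨(ψ (D₀ b k))⁻¹ • act (D (k • b 1)), fun j => ?_, fun g x hx => ?_⟩
    · change (ψ (D₀ b k))⁻¹ • ⁅D (k • b 1), t j⁆ = _
      rw [H.lie_D, inv_smul_smul₀ hk]
    · rw [add_comm]
      exact Submodule.smul_mem _ _ (hG.lie_mem _ _ _ hx)
  | zero => exact ⟨1, fun j => by rw [add_zero]; rfl, fun g x hx => by rwa [zero_smul, add_zero]⟩
  | add k l _ _ hk hl =>
    obtain ⟨E, hE, hE'⟩ := hk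
    obtain ⟨F, hF, hF'⟩ := hl
    refine ⟨F * E, fun j => ?_, fun g x hx => ?_⟩
    · rw [Module.End.mul_apply, hE, hF, add_assoc]
    · rw [add_smul, ← add_assoc]
      exact hF' _ _ (hE' _ _ hx)

/-- The generator of the top layer is homogeneous for every grading. -/
theorem IsShiftModule.exists_mem (H : IsShiftModule ℬ b ψ γ₀ s t) (hs : 0 < s)
    (hper : ∀ k : ℤ, k ∈ AddSubmonoid.closure {k | ψ (D₀ b k) ≠ 0} ↔ (s : ℤ) ∣ k)
    (hG : IsGradedModule M 𝒢) : ∃ g, t 0 ∈ 𝒢 g := by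
  have hGid := isGradedBy_id_iff.2 hG
  choose E hE hE' using fun j : ℤ => H.exists_shift hG ((hper _).2 (dvd_mul_right (s : ℤ) j))
  -- `Φ` identifies Laurent polynomials with the top layer and `A f` extends multiplication by `f`.
  -- The identity `hAΦ` is commutativity of the product, compared degree by degree in the other
  -- grading.
  let Φ := Finsupp.linearCombination ℂ fun j : ℤ => t (s * j)
  let A := Finsupp.linearCombination ℂ E
  have hΦ : Function.Injective Φ := H.linearIndependent hs
  have hAΦ : ∀ f g, A f (Φ g) = A g (Φ f) := fun f g => by
    induction f using Finsupp.induction_linear with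
    | zero => simp
    | add f f' hf hf' => simp only [map_add, LinearMap.add_apply, hf, hf']
    | single i a =>
      induction g using Finsupp.induction_linear with
      | zero => simp
      | add f f' hf hf' => simp only [map_add, LinearMap.add_apply, hf, hf']
      | single j c =>
        simp only [Φ, A, Finsupp.linearCombination_single, LinearMap.smul_apply, map_smul, hE]
        rw [smul_comm, add_comm]
  have hEinv : ∀ j f, E (-j) (E j (Φ f)) = Φ f := fun j f => by
    induction f using Finsupp.induction_linear with
    | zero => simp
    | add f f' hf hf' => simp only [map_add, hf, hf']
    | single i a =>
      simp only [Φ, Finsupp.linearCombination_single, map_smul, hE]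
      congr 2
      ring
  have hA : ∀ f x, A f x = ∑ j ∈ f.support, f j • E j x := fun f x => by
    simp only [A, Finsupp.linearCombination_apply, Finsupp.sum, LinearMap.sum_apply,
      LinearMap.smul_apply]
  have hinj : ∀ {i j : ℤ}, ((s : ℤ) * i) • b 1 = ((s : ℤ) * j) • b 1 → i = j := fun h =>
    mul_left_cancel₀ (by omega) (smul_b₂_inj.1 h)
  -- the supports of homogeneous vectors are translates of each other
  have key : ∀ {f g : ℤ →₀ ℂ} {p q : ℤ × ℤ}, Φ f ∈ 𝒢 p → Φ g ∈ 𝒢 q → f ≠ 0 → ∀ j, g j ≠ 0 →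
      ∃ i, f i ≠ 0 ∧ p + ((s : ℤ) * j) • b 1 = q + ((s : ℤ) * i) • b 1 := by
    intro f g p q hf hg hf0 j hj
    by_contra! hcon
    have h1 := congrArg (gproj hG.isInternal (p + ((s : ℤ) * j) • b 1)) (hAΦ g f)
    rw [hA, hA, map_sum, map_sum, Finset.sum_eq_single j, Finset.sum_eq_zero, map_smul,
      gproj_of_mem _ (hE' j _ _ hf)] at h1
    · have h2 := (smul_eq_zero.1 h1).resolve_left hj
      have h3 := hEinv j f
      rw [h2, map_zero] at h3
      exact hf0 (hΦ (by rw [← h3, map_zero]))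
    · intro i hi
      rw [map_smul, gproj_of_mem_ne _ (hcon i (Finsupp.mem_support_iff.1 hi)).symm (hE' i _ _ hg),
        smul_zero]
    · intro i _ hij
      rw [map_smul, gproj_of_mem_ne _ (fun h => hij (hinj (add_left_cancel h))) (hE' i _ _ hf),
        smul_zero]
    · intro h
      rw [Finsupp.notMem_support_iff.1 h, zero_smul, map_zero]
  have hcomp : ∀ g, ∃ f, Φ f = gproj hG.isInternal g (t 0) := fun g => by
    have := H.mem_span_of_killed (x := gproj hG.isInternal g (t 0)) fun m hm => by
      rw [← hGid.gproj_lie m g, H.lie_pos hm, map_zero]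
    rwa [← Finsupp.range_linearCombination] at this
  choose f hf using hcomp
  have hf' : ∀ g, Φ (f g) ∈ 𝒢 g := fun g => by rw [hf]; exact gproj_mem _ _ _
  obtain ⟨F, hF, hsum⟩ := exists_finset_sum_gproj hG.isInternal (t 0)
  have hF' : ∀ g ∉ F, f g = 0 := fun g hg => hΦ (by rw [hf, hF g hg, map_zero])
  have hsum' : ∑ g ∈ F, f g = Finsupp.single 0 1 := by
    refine hΦ ?_
    rw [map_sum, Finset.sum_congr rfl fun g _ => hf g, ← hsum]
    simp [Φ]
  -- An extreme exponent `k`, in the direction of the sign of `ε`, occurring in some component of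
  -- `1` occurs in only one. Otherwise `key` gives exponents `i`, `j` with `i + j = 2k`, and
  -- extremality forces both to be `k` and the two degrees to agree. So `k` survives in the sum,
  -- which is `1`, and `k = 0`.
  have hext : ∀ ε : ℤ, ε ≠ 0 → ∀ g j, f g j ≠ 0 → ε * j ≤ 0 := by
    intro ε hε g j hgj
    have hmem : ∀ {g j}, f g j ≠ 0 → j ∈ F.biUnion fun g => (f g).support := fun {g j} h => by
      refine Finset.mem_biUnion.2 ⟨g, ?_, Finsupp.mem_support_iff.2 h⟩
      by_contra hg
      rw [hF' g hg] at h
      exact h rfl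
    obtain ⟨k, hk, hmax⟩ := Finset.exists_max_image _ (fun j => ε * j) ⟨j, hmem hgj⟩
    refine (hmax j (hmem hgj)).trans ?_
    obtain ⟨p, hp, hpk⟩ := Finset.mem_biUnion.1 hk
    rw [Finsupp.mem_support_iff] at hpk
    have hne : (∑ g ∈ F, f g) k ≠ 0 := by
      rw [Finsupp.finsetSum_apply, Finset.sum_eq_single p]
      · exact hpk
      · intro q _ hqp
        by_contra hq
        obtain ⟨i, hi, hi'⟩ := key (hf' p) (hf' q) (fun h => hpk (by rw [h]; rfl)) k hq
        obtain ⟨j, hj, hj'⟩ := key (hf' q) (hf' p) (fun h => hq (by rw [h]; rfl)) k hpk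
        have h1 := hmax i (hmem hi)
        have h2 := hmax j (hmem hj)
        have h3 : 2 * k = i + j := by
          refine hinj ?_
          have := congrArg₂ (· + ·) hi' hj'
          have h4 : p + q + ((s : ℤ) * (2 * k)) • b 1 = p + q + ((s : ℤ) * (i + j)) • b 1 := by
            rw [show (s : ℤ) * (2 * k) = s * k + s * k by ring, mul_add, add_smul, add_smul]
            rw [add_add_add_comm p _ q _, add_add_add_comm q _ p _, add_comm q p] at this
            exact this
          exact add_left_cancel h4
        have h5 : ε * i + ε * j = 2 * (ε * k) := by rw [← mul_add, ← h3]; ring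
        have h6 : ε * i = ε * k := by omega
        rw [mul_left_cancel₀ hε h6] at hi'
        exact hqp (add_right_cancel hi').symm
      · exact fun h => absurd hp h
    rw [hsum', Finsupp.single_apply] at hne
    have : 0 = k := by
      by_contra h
      exact hne (if_neg h)
    rw [← this, mul_zero]
  have hzero : ∀ g j, f g j ≠ 0 → j = 0 := fun g j h => by
    have h1 := hext 1 one_ne_zero g j h
    have h2 := hext (-1) (by decide) g j h
    omega
  obtain ⟨p, hp⟩ : ∃ p, f p ≠ 0 := by
    by_contra! h
    rw [Finset.sum_eq_zero fun g _ => h g] at hsum'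
    exact one_ne_zero (Finsupp.single_eq_zero.1 hsum'.symm)
  refine ⟨p, mem_of_gproj_eq_zero hG.isInternal fun q hq => ?_⟩
  rw [← hf]
  by_contra hq0
  have hfq : f q ≠ 0 := fun h => hq0 (by rw [h, map_zero])
  obtain ⟨j, hj⟩ := Finsupp.ne_iff.1 hfq
  obtain ⟨i, hi, hi'⟩ := key (hf' p) (hf' q) hp j hj
  rw [hzero p i hi, hzero q j hj] at hi'
  exact hq (add_right_cancel hi').symm

/-- The grading of a shift module is unique up to translation. -/
theorem IsShiftModule.exists_grading_eq (H : IsShiftModule ℬ b ψ γ₀ s t) (hs : 0 < s)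
    (hper : ∀ k : ℤ, k ∈ AddSubmonoid.closure {k | ψ (D₀ b k) ≠ 0} ↔ (s : ℤ) ∣ k)
    (hG : IsGradedModule M 𝒢) : ∃ d, ∀ n, 𝒢 n = ℬ (n + d) := by
  obtain ⟨g, hg⟩ := H.exists_mem hs hper hG
  have ht : t 0 ∈ ℬ γ₀ := by simpa using H.mem 0
  -- Vectors homogeneous for both gradings, with the offset read off at `t 0`, span a submodule; it
  -- contains the generator `t 0`.
  have hstab : ∀ m, ∀ v ∈ ⨆ n, 𝒢 n ⊓ ℬ (n + (γ₀ - g)), ⁅D m, v⁆ ∈ ⨆ n, 𝒢 n ⊓ ℬ (n + (γ₀ - g)) := by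
    intro m v hv
    refine Submodule.iSup_induction _ (motive := fun v => ⁅D m, v⁆ ∈ ⨆ n, 𝒢 n ⊓ ℬ (n + (γ₀ - g))) hv
      (fun n v hv => ?_) (by rw [lie_zero]; exact zero_mem _) fun v w hv hw => by
        rw [lie_add]; exact add_mem hv hw
    refine Submodule.mem_iSup_of_mem (m + n) ⟨hG.lie_mem m n v hv.1, ?_⟩
    rw [add_assoc]
    exact H.graded.lie_mem m _ v hv.2
  have hall : ∀ x, x ∈ ⨆ n, 𝒢 n ⊓ ℬ (n + (γ₀ - g)) := fun x => by
    have hle : (⊤ : LieSubmodule ℂ VirasoroLike M) ≤ ofStable _ hstab := by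
      rw [← H.lieSpan_eq_top, LieSubmodule.lieSpan_le]
      rintro _ rfl
      refine mem_ofStable.2 (Submodule.mem_iSup_of_mem g ⟨hg, ?_⟩)
      rwa [add_sub_cancel]
    exact hle (LieSubmodule.mem_top x)
  have hproj : ∀ n x, gproj hG.isInternal n x = gproj H.graded.isInternal (n + (γ₀ - g)) x := by
    intro n x
    refine Submodule.iSup_induction _ (motive := fun x => gproj hG.isInternal n x =
      gproj H.graded.isInternal (n + (γ₀ - g)) x) (hall x) (fun k x hx => ?_) (by simp)
      fun x y hx hy => by rw [map_add, map_add, hx, hy]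
    by_cases hk : k = n
    · subst hk
      rw [gproj_of_mem _ hx.1, gproj_of_mem _ hx.2]
    · rw [gproj_of_mem_ne _ hk hx.1, gproj_of_mem_ne _ (fun h => hk (add_right_cancel h)) hx.2]
  refine ⟨γ₀ - g, fun n => le_antisymm (fun x hx => ?_) fun x hx => ?_⟩
  · rw [← gproj_of_mem hG.isInternal hx, hproj]
    exact gproj_mem _ _ _
  · rw [← gproj_of_mem H.graded.isInternal hx, ← hproj]
    exact gproj_mem _ _ _

end Rigidity

/-! ### Transport of gradings and of the class `𝒪` along isomorphisms. -/

section Transport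

variable {V V' : Type*} [AddCommGroup V] [Module ℂ V] [LieRingModule VirasoroLike V]
  [LieModule ℂ VirasoroLike V] [AddCommGroup V'] [Module ℂ V'] [LieRingModule VirasoroLike V']
  [LieModule ℂ VirasoroLike V'] {𝒱 : ℤ × ℤ → Submodule ℂ V} {𝒱' : ℤ × ℤ → Submodule ℂ V'}

theorem IsGradedModule.map (hG : IsGradedModule V 𝒱) (e : V ≃ₗ⁅ℂ, VirasoroLike⁆ V') :
    IsGradedModule V' fun n => (𝒱 n).map (e : V →ₗ[ℂ] V') where
  isInternal := by
    have he : ∀ x, (e : V →ₗ[ℂ] V') x = e x := fun _ => rfl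
    refine isInternal_of_proj ?_ (fun n => (e : V →ₗ[ℂ] V') ∘ₗ gproj hG.isInternal n ∘ₗ
      (e.symm : V' →ₗ[ℂ] V)) ?_ ?_
    · rw [← Submodule.map_iSup, hG.isInternal.submodule_iSup_eq_top, Submodule.map_top,
        LinearMap.range_eq_top]
      exact e.surjective
    · rintro n _ ⟨x, hx, rfl⟩
      change e (gproj hG.isInternal n (e.symm (e x))) = e x
      rw [e.symm_apply_apply, gproj_of_mem _ hx]
    · rintro n k hk _ ⟨x, hx, rfl⟩
      change e (gproj hG.isInternal n (e.symm (e x))) = 0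
      rw [e.symm_apply_apply, gproj_of_mem_ne _ hk hx, map_zero]
  lie_mem := by
    rintro m n _ ⟨x, hx, rfl⟩
    exact ⟨_, hG.lie_mem m n x hx, (e : V →ₗ⁅ℂ, VirasoroLike⁆ V').map_lie (D m) x⟩

/-- The class `𝒪` is invariant under isomorphisms that translate the gradings. -/
theorem InClassO.of_equiv (hO : InClassO V' 𝒱') (e : V ≃ₗ⁅ℂ, VirasoroLike⁆ V') {d : ℤ × ℤ}
    (he : ∀ n, (𝒱 n).map (e : V →ₗ[ℂ] V') = 𝒱' (n + d)) : InClassO V 𝒱 := by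
  refine ⟨⟨?_, fun N hN => ?_⟩, fun n => ?_⟩
  · have := hO.1.nontrivial
    exact e.toEquiv.nontrivial
  · let N' : LieSubmodule ℂ VirasoroLike V' := N.map (e : V →ₗ⁅ℂ, VirasoroLike⁆ V')
    have hN' : (N' : Submodule ℂ V') = (N : Submodule ℂ V).map (e : V →ₗ[ℂ] V') := rfl
    have hgr : IsGradedSubspace 𝒱' (N' : Submodule ℂ V') := by
      unfold IsGradedSubspace at hN ⊢
      rw [← (Equiv.addRight d).iSup_comp]
      simp only [Equiv.coe_addRight, ← he, hN']
      conv_lhs => rw [hN]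
      rw [Submodule.map_iSup]
      refine iSup_congr fun n => Submodule.map_inf _ e.injective
    have hmem : ∀ x, e x ∈ N' ↔ x ∈ N := fun x => by
      constructor
      · rintro ⟨y, hy, hxy⟩
        exact e.injective hxy ▸ hy
      · exact fun hx => ⟨x, hx, rfl⟩
    rcases hO.1.eq_bot_or_eq_top N' hgr with h | h
    · refine Or.inl ((LieSubmodule.eq_bot_iff N).2 fun x hx => ?_)
      have := (hmem x).2 hx
      rw [h, LieSubmodule.mem_bot] at this
      exact e.injective (this.trans (map_zero e).symm)
    · refine Or.inr (LieSubmodule.ext _ _ fun x => ⟨fun _ => LieSubmodule.mem_top x, fun _ => ?_⟩)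
      exact (hmem x).1 (h ▸ LieSubmodule.mem_top (e x))
  · have := hO.2 (n + d)
    rw [← he] at this
    exact (Submodule.equivMapOfInjective (e : V →ₗ[ℂ] V') e.injective (𝒱 n)).symm.finiteDimensional

end Transport

/-! ### The converse implication. -/

section Converse

variable {V : Type*} [AddCommGroup V] [Module ℂ V] [LieRingModule VirasoroLike V]
  [LieModule ℂ VirasoroLike V] {𝒱 : ℤ × ℤ → Submodule ℂ V}
  {b : Module.Basis (Fin 2) ℤ (ℤ × ℤ)} {ψ : gradedPiece b 0 →ₗ[ℂ] ℂ} {i : ℤ} {s : ℕ}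

theorem isTrivial_vBar (hgen : vermaGen b ψ = 0) : LieModule.IsTrivial VirasoroLike (VBar b ψ i) := by
  have h1 : ∀ v : Verma b ψ, v = 0 := fun v => by
    have : v ∈ (⊤ : LieSubmodule ℂ VirasoroLike (Verma b ψ)) := LieSubmodule.mem_top v
    have h0 : LieSubmodule.lieSpan ℂ VirasoroLike {(0 : Verma b ψ)} ≤ ⊥ :=
      LieSubmodule.lieSpan_le.2 (by rintro _ rfl; exact zero_mem _)
    rw [← lieSpan_vermaGen, hgen] at this
    exact h0 this
  have h2 : ∀ v : VHat b ψ, v = 0 := fun v => by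
    obtain ⟨v, rfl⟩ := LieSubmodule.Quotient.surjective_mk' _ v
    rw [h1 v, map_zero]
  have h3 : ∀ v : VPsi b ψ, v = 0 := fun v => by
    induction v using loop_induction with
    | h0 => rfl
    | hadd v w hv hw => rw [hv, hw, add_zero]
    | h k v => rw [h2 v, map_zero]
  refine ⟨fun x v => ?_⟩
  obtain ⟨v, rfl⟩ := LieSubmodule.Quotient.surjective_mk' _ v
  rw [h3 v, map_zero, lie_zero]

/-- A nontrivial graded module isomorphic to some `V̄(ψ, i, s)` is in the class `𝒪`. -/
theorem inClassO_of_equiv_vBar (hgr : IsGradedModule V 𝒱) (hnt : ¬ LieModule.IsTrivial VirasoroLike V)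
    (hψ : IsExpPolynomial b ψ) (hs : 0 < s) (hper : HasPeriod b ψ i s)
    (e : V ≃ₗ⁅ℂ, VirasoroLike⁆ VBar b ψ i) : InClassO V 𝒱 := by
  have hgen : vermaGen b ψ ≠ 0 := fun h => by
    have := isTrivial_vBar (i := i) h
    refine hnt ⟨fun x v => e.injective ?_⟩
    rw [map_zero]
    exact ((e : V →ₗ⁅ℂ, VirasoroLike⁆ VBar b ψ i).map_lie x v).trans (LieModule.IsTrivial.trivial _ _)
  have hper' := (hasPeriod_iff hgen).1 hper
  have H := vBar_isShiftModule (i := i) hper' hgen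
  -- The isomorphism transports the grading of `V` to a second grading of `VBar`, which by rigidity
  -- is a translate of the standard one.
  obtain ⟨d, hd⟩ := H.exists_grading_eq hs hper' (hgr.map e)
  exact InClassO.of_equiv ⟨H.irreducible, vBar_isQuasiFinite hgen hψ i⟩ e hd

end Converse

end VirasoroLike

end

theorem theorem4p6 (V : Type*) [AddCommGroup V] [Module ℂ V] [LieRingModule VirasoroLike V]
    [LieModule ℂ VirasoroLike V] (𝒱 : ℤ × ℤ → Submodule ℂ V)
    (hgr : VirasoroLike.IsGradedModule V 𝒱)
    (hghw : VirasoroLike.IsGeneralizedHighestWeight V 𝒱)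
    (hnt : ¬ LieModule.IsTrivial VirasoroLike V) :
    (VirasoroLike.InClassO V 𝒱 ↔
      ∃ (b : Module.Basis (Fin 2) ℤ (ℤ × ℤ)) (ψ : VirasoroLike.gradedPiece b 0 →ₗ[ℂ] ℂ)
        (i : ℤ) (s : ℕ), VirasoroLike.IsExpPolynomial b ψ ∧ 0 < s ∧
          VirasoroLike.HasPeriod b ψ i s ∧
          Nonempty (V ≃ₗ⁅ℂ, VirasoroLike⁆ VirasoroLike.VBar b ψ i)) ∧
    (VirasoroLike.InClassO V 𝒱 →
      ∃ (b : Module.Basis (Fin 2) ℤ (ℤ × ℤ)) (ψ : VirasoroLike.gradedPiece b 0 →ₗ[ℂ] ℂ)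
        (i : ℤ) (s : ℕ), VirasoroLike.IsExpPolynomial b ψ ∧ 0 < s ∧
          VirasoroLike.HasPeriod b ψ i s ∧
          ∃ (e : V ≃ₗ⁅ℂ, VirasoroLike⁆ VirasoroLike.VBar b ψ i) (d : ℤ × ℤ), ∀ n,
            (𝒱 n).map (e : V →ₗ[ℂ] VirasoroLike.VBar b ψ i) =
              VirasoroLike.vBarGrade b ψ i (n + d)) := by
  refine ⟨⟨fun hO => ?_, ?_⟩, VirasoroLike.exists_equiv_vBar hgr hghw hnt⟩
  · obtain ⟨b, ψ, i, s, hψ, hs, hper, e, -⟩ := VirasoroLike.exists_equiv_vBar hgr hghw hnt hO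
    exact ⟨b, ψ, i, s, hψ, hs, hper, ⟨e⟩⟩
  · rintro ⟨b, ψ, i, s, hψ, hs, hper, ⟨e⟩⟩
    exact VirasoroLike.inClassO_of_equiv_vBar hgr hnt hψ hs hper e
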